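/- **Setting.** Let $X_1,\dots,X_n\in\mathbb R^d$, $\frac1d\le\alpha<\frac12$. Assume that there are $S\subseteq[n]$ with $|S|=\alpha n$ and $\mu^*\in\mathbb R^d$ such that 1. $a\,d\le\alpha n\le A\,d\log^p d$ (that is, $\alpha n=\Theta(d\cdot\mathrm{polylog}(d))$); 2. $\frac1{|S|}\sum_{i\in S}(X_i-\mu^*)(X_i-\mu^*)^\top\preceq\mathbf I$; 3. for all unit vectors $v\in\mathbb R^d$ and all $t\ge0$, $\Pr_{i\sim_{\rm unif}S}[\langle X_i-\mu^*,v\rangle>t]\le\exp(-c_1t^2)+\frac1{c_2\log^3d}$. **Algorithm** $\mathsf{FastGaussianMultifilter}(X,\alpha)$, with positive constants $c_{\rm dir},c_{\rm split},c_{\rm rad},c_{\rm loss},c_{\rm depth}$. For a set $T$ of indices, $\widetilde{\mathrm{Cov}}_{N}(T)=\frac1N\sum_{i\in T}(X_i-\mu(T))(X_i-\mu(T))^\top$, where $\mu(T)$ is the empirical mean. * *Main.* Partition $[n]$ by $\mathsf{NaiveCluster}$ into $T'_1,\dots,T'_k$; return the union of the lists $\mathsf{BoundedDiameter}(T'_i,\alpha_i)$,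 $\alpha_i=\frac{n}{|T'_i|}\alpha$. * $\mathsf{NaiveCluster}$: draw $u\in\mathbb R^d$ with independent entries uniform in $\{0,\dots,2^b-1\}$, $b=\lceil 7\log_2d\rceil$, sort the values $\langle u,X_i\rangle$, and cut at each gap larger than $2\|u\|_2\sqrt{nd}$ between consecutive values. * $\mathsf{BoundedDiameter}(T,\alpha)$, $N=|T|$: put $\beta=\frac1{\log d}$, $R=c_{\rm rad}\log d\,(\log\log d)^{1.5}$, $C=c_{\rm loss}\log^2d$, $D=\lceil c_{\rm depth}\log^2d\rceil$. Start with the list $\{T\}$; $D$ times, replace the list by all sets of size at least $\frac{\alpha N}2$ in the outputs of $\mathsf{GaussianPartition}$ on its members. Return the empirical means of the final sets. * $\mathsf{GaussianPartition}(T_p)$: let $\mathbf M=\widetilde{\mathrm{Cov}}_N(T_p)$, draw $N_{\rm dir}=\lceil c_{\rm dir}\log d\rceil$ independent uniform vectors $u_j\in\{\pm1\}^d$, let $v_j=\mathbf M^{\lceil\log d\rceil}u_j$, and, starting with $\{T_p\}$, for $j=1,\dots,N_{\rm dir}$ replace each set of the current list by the output of $\mathsf{Gaussian1DPartition}$ on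 it in direction $v_j$, with $\Delta=\frac1{C N_{\rm dir}N}$. * $\mathsf{Gaussian1DPartition}(T',v)$: sort the values $Y_i=\langle v,X_i\rangle$, $i\in T'$, and treat $T'$ as follows, recursively. Let $T_{\rm in}$ be the current set, $m=|T_{\rm in}|$. If the middle $1-\alpha\Delta$ quantiles of its values ($\lfloor\alpha\Delta m/2\rfloor$ values removed at either end) lie in an interval of length $R\|v\|_2$, output this middle part (if nonempty). Otherwise let $k_{\max}=\lceil c_{\rm split}\log\log(\frac1{\alpha\Delta})/\beta\rceil$, $r=\frac R{4k_{\max}}$, $\tau_k=\mathrm{med}(Y)+2kr\|v\|_2$; for the first $k\in\{-k_{\max},\dots,k_{\max}\}$ for which the sets $T^{(1)}=\{Y_i\le\tau_k+r\|v\|_2\}$ and $T^{(2)}=\{Y_i\ge\tau_k-r\|v\|_2\}$ (within $T_{\rm in}$) satisfy $|T^{(1)}|^{1+\beta}+|T^{(2)}|^{1+\beta}<|T_{\rm in}|^{1+\beta}$, treat $T^{(1)}$ and $T^{(2)}$ recursively (if there is no such $k$, output the middle part). All sets are intervals of the sorted sequence, and the set sizes are found by binary search. **Running time** is the worst-case number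 of elementary steps (over all outcomes of the coins) on a randomized real RAM with exact arithmetic: arithmetic operations, square roots, logarithms, powers, rounding and comparisons of reals, index operations, memory accesses, loop iterations and fair coin tosses cost one unit each. **Theorem.** For all constants $c_1,c_2,a,A>0$ and $p\in\mathbb N$ there are constants $c_{\rm dir},c_{\rm split},c_{\rm rad},c_{\rm loss},c_{\rm depth}>0$, $K>0$ and $d_0\ge3$ such that for all $d\ge d_0$ and all $n,\alpha,X,S,\mu^*$ as above, $\mathsf{FastGaussianMultifilter}(X,\alpha)$ runs in time at most $$K\left(nd\log^4d+n\log^5d\,\log\log d\right)$$ and, with probability at least $1-\frac1d$, returns a list $L$ with $|L|\le\frac K\alpha$ that contains some $\hat\mu$ with $$\|\hat\mu-\mu^*\|_2\le K\,\frac{\log d\,(\log\log d)^{1.5}}{\sqrt\alpha}.$$ -/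

import Mathlib

noncomputable section

/-! ### Unit-cost randomized real RAM

A value of `RAM β` is a terminating randomized computation with result in `β`: `step` is one
elementary operation, `flip` is one toss of a fair coin. Both cost one unit of time. -/

/-- A randomized computation with a step count, as the tree of all its executions. -/
inductive RAM (β : Type) : Type
  | ret (b : β) : RAM β
  | step (c : RAM β) : RAM β
  | flip (k : Bool → RAM β) : RAM β

namespace RAM

variable {β γ ι σ : Type}

/-- Sequential composition. -/
def bind : RAM β → (β → RAM γ) → RAM γ
  | ret b, f => f b
  | step c, f => step (bind c f)
  | flip k, f => flip (fun b => bind (k b) f)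

instance : Monad RAM where
  pure := ret
  bind := bind

/-- Worst-case running time: the largest number of elementary operations and coin tosses on any
execution. -/
def time : RAM β → ℕ
  | ret _ => 0
  | step c => c.time + 1
  | flip k => max (k true).time (k false).time + 1

/-- Distribution of the result, the coins being fair and independent. -/
def dist : RAM β → PMF β
  | ret b => PMF.pure b
  | step c => c.dist
  | flip k => (PMF.uniformOfFintype Bool).bind (fun b => (k b).dist)

/-! Elementary operations on reals (exact arithmetic), each of cost one. -/

/-- One elementary operation with result `b`. It is used only through the named operations
below and for storing a bounded number of values. -/
def op (b : β) : RAM β := step (ret b)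

def addR (x y : ℝ) : RAM ℝ := op (x + y)
def subR (x y : ℝ) : RAM ℝ := op (x - y)
def mulR (x y : ℝ) : RAM ℝ := op (x * y)
def divR (x y : ℝ) : RAM ℝ := op (x / y)
def sqrtR (x : ℝ) : RAM ℝ := op (Real.sqrt x)
def logR (x : ℝ) : RAM ℝ := op (Real.log x)
def powR (x y : ℝ) : RAM ℝ := op (x ^ y)
def leR (x y : ℝ) : RAM Bool := op (decide (x ≤ y))
def ltR (x y : ℝ) : RAM Bool := op (decide (x < y))
def floorR (x : ℝ) : RAM ℕ := op ⌊x⌋₊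
def ceilR (x : ℝ) : RAM ℕ := op ⌈x⌉₊

/-! Elementary operations on indices, each of cost one. -/

def castN (k : ℕ) : RAM ℝ := op (k : ℝ)
def addN (k l : ℕ) : RAM ℕ := op (k + l)
def subN (k l : ℕ) : RAM ℕ := op (k - l)
def halfN (k : ℕ) : RAM ℕ := op (k / 2)
def ltN (k l : ℕ) : RAM Bool := op (decide (k < l))

/-! Memory access, each of cost one. A vector is an array of `d` cells. -/

def load {d : ℕ} (v : Fin d → ℝ) (j : Fin d) : RAM ℝ := op (v j)
def store {d : ℕ} (v : Fin d → ℝ) (j : Fin d) (x : ℝ) : RAM (Fin d → ℝ) :=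
  op (Function.update v j x)
def get (Y : Array ℝ) (i : ℕ) : RAM ℝ := op (Y.getD i 0)

/-- A fair random sign. -/
def sign : RAM ℝ := flip (fun b => ret (if b then 1 else -1))

/-- A fair random bit, as a real number. -/
def bit : RAM ℝ := flip (fun b => ret (if b then 1 else 0))

/-- `k` elementary operations (used for copying `k` memory cells). -/
def charge : ℕ → RAM Unit
  | 0 => ret ()
  | k + 1 => step (charge k)

/-- A loop with state over a list; one unit per iteration in addition to the body. -/
def forEach : List ι → σ → (σ → ι → RAM σ) → RAM σ
  | [], s, _ => ret s
  | i :: l, s, f => step (bind (f s i) (fun s' => forEach l s' f))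

/-- A loop that lists the results of its body; one unit per iteration in addition to the body. -/
def collect : List ι → (ι → RAM β) → RAM (List β)
  | [], _ => ret []
  | i :: l, f => step (bind (f i) (fun b => bind (collect l f) (fun bs => ret (b :: bs))))

/-- Number of entries of a list, by traversal. -/
def size (l : List ι) : RAM ℕ := forEach l 0 (fun k _ => addN k 1)

/-- Concatenation, at the cost of the length of the first list. -/
def append (l l' : List ι) : RAM (List ι) := do
  charge l.length
  return l ++ l'

/-- Copy a list to an array. -/
def toArr (l : List ι) : RAM (Array ι) := do
  charge l.length
  return l.toArray

/-! ### Vectors -/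

/-- Fill a vector coordinate by coordinate. -/
def tabulate {d : ℕ} (f : Fin d → RAM ℝ) : RAM (Fin d → ℝ) :=
  forEach (List.finRange d) (fun _ => 0) (fun v j => do
    let x ← f j
    store v j x)

/-- Inner product. -/
def dot {d : ℕ} (x y : Fin d → ℝ) : RAM ℝ :=
  forEach (List.finRange d) 0 (fun s j => do
    let a ← load x j
    let b ← load y j
    let c ← mulR a b
    addR s c)

/-- Euclidean length. -/
def len {d : ℕ} (x : Fin d → ℝ) : RAM ℝ := do
  let s ← dot x x
  sqrtR s

/-- `x - y`. -/
def vsub {d : ℕ} (x y : Fin d → ℝ) : RAM (Fin d → ℝ) :=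
  tabulate (fun j => do
    let a ← load x j
    let b ← load y j
    subR a b)

/-- `x + s y`. -/
def vaxpy {d : ℕ} (x : Fin d → ℝ) (s : ℝ) (y : Fin d → ℝ) : RAM (Fin d → ℝ) :=
  tabulate (fun j => do
    let a ← load x j
    let b ← load y j
    let c ← mulR s b
    addR a c)

/-- `x / s`. -/
def vdiv {d : ℕ} (x : Fin d → ℝ) (s : ℝ) : RAM (Fin d → ℝ) :=
  tabulate (fun j => do
    let a ← load x j
    divR a s)

/-- The zero vector. -/
def vzero (d : ℕ) : RAM (Fin d → ℝ) := tabulate (fun _ => op 0)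

/-! ### Sorting and searching -/

/-- Merge two lists sorted by their first components. -/
def merge : List (ℝ × ι) → List (ℝ × ι) → RAM (List (ℝ × ι))
  | [], l => step (ret l)
  | l, [] => step (ret l)
  | x :: xs, y :: ys => do
      let b ← leR x.1 y.1
      if b then do
        let l ← merge xs (y :: ys)
        op (x :: l)
      else do
        let l ← merge (x :: xs) ys
        op (y :: l)
  termination_by l l' => l.length + l'.length

/-- Merge sort by the first component, in nondecreasing order. -/
def mergeSort (l : List (ℝ × ι)) : RAM (List (ℝ × ι)) :=
  if _h : 2 ≤ l.length then do
    charge l.length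
    let l₁ ← mergeSort (l.take (l.length / 2))
    let l₂ ← mergeSort (l.drop (l.length / 2))
    merge l₁ l₂
  else step (ret l)
  termination_by l.length
  decreasing_by
    · simp only [List.length_take]; omega
    · simp only [List.length_drop]; omega

/-- Binary search for the first position in `[lo, hi)` whose entry passes the test `P`, for an
array on which the test is monotone (`hi` if there is none). The first argument only bounds the
number of rounds and `hi - lo` is always enough. -/
def binSearch (Y : Array ℝ) (P : ℝ → RAM Bool) : ℕ → ℕ → ℕ → RAM ℕ
  | 0, lo, _ => ret lo
  | f + 1, lo, hi => do
      let more ← ltN lo hi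
      if more then do
        let s ← addN lo hi
        let mid ← halfN s
        let y ← get Y mid
        let b ← P y
        if b then binSearch Y P f lo mid
        else do
          let mid' ← addN mid 1
          binSearch Y P f mid' hi
      else ret lo

end RAM

/-! ### The algorithm

The data set is a family `X : Fin n → Fin d → ℝ`; its subsets are lists of indices. -/

open RAM

/-- The leading constants of the parameters of the algorithm. -/
structure MultifilterConsts where
  /-- number of directions `⌈dir * log d⌉` -/
  dir : ℝ
  /-- number of split thresholds on each side, `⌈split * log log (1 / (α Δ)) / β⌉` -/
  split : ℝ
  /-- interval length `R = rad * log d * (log log d) ^ 1.5` -/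
  rad : ℝ
  /-- loss parameter `C = loss * (log d) ^ 2` -/
  loss : ℝ
  /-- number of layers `D = ⌈depth * (log d) ^ 2⌉` -/
  depth : ℝ

/-- All the constants are positive. -/
def MultifilterConsts.Pos (c : MultifilterConsts) : Prop :=
  0 < c.dir ∧ 0 < c.split ∧ 0 < c.rad ∧ 0 < c.loss ∧ 0 < c.depth

section Algorithm

variable {n d : ℕ}

/-- Cut a sorted list at every gap larger than `G` between consecutive values. -/
def cutAtGaps (G : ℝ) : List (ℝ × Fin n) → RAM (List (List (Fin n)))
  | [] => ret []
  | [x] => op [[x.2]]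
  | x :: y :: l => do
      let rest ← cutAtGaps G (y :: l)
      let gap ← subR y.1 x.1
      let far ← ltR G gap
      if far then op ([x.2] :: rest)
      else match rest with
        | [] => op [[x.2]]
        | c :: cs => op ((x.2 :: c) :: cs)

/-- A uniformly random element of `{0, …, 2 ^ b - 1}`. -/
def randomInt (b : ℕ) : RAM ℝ :=
  forEach (List.range b) 0 (fun s _ => do
    let e ← bit
    let t ← addR s s
    addR t e)

/-- `NaiveCluster`: project on a random direction `u` with independent entries uniform in
`{0, …, 2 ^ b - 1}`, `2 ^ b ≥ d ^ 7`, and cut the sorted projections at the gaps larger than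
`2 ‖u‖ √(n d)`. -/
def naiveCluster (X : Fin n → Fin d → ℝ) : RAM (List (List (Fin n))) := do
  let dR ← castN d
  let ld ← logR dR
  let l2 ← logR 2
  let t ← mulR 7 ld
  let t ← divR t l2
  let b ← ceilR t
  let u ← tabulate (fun _ => randomInt b)
  let ys ← collect (List.finRange n) (fun i => do
    let y ← dot u (X i)
    return (y, i))
  let sorted ← mergeSort ys
  let nu ← len u
  let nR ← castN n
  let nd ← mulR nR dR
  let w ← sqrtR nd
  let w ← mulR nu w
  let G ← mulR 2 w
  cutAtGaps G sorted

/-- Empirical mean of the points in `T`. -/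
def empMean (X : Fin n → Fin d → ℝ) (T : List (Fin n)) : RAM (Fin d → ℝ) := do
  let z ← vzero d
  let s ← forEach T z (fun acc i => vaxpy acc 1 (X i))
  let m ← size T
  let mR ← castN m
  vdiv s mR

/-- The product `M w`, `M = (1 / N) ∑ i ∈ T, (X i - μ) (X i - μ)ᵀ`. -/
def covApply (X : Fin n → Fin d → ℝ) (N : ℕ) (T : List (Fin n)) (μ w : Fin d → ℝ) :
    RAM (Fin d → ℝ) := do
  let z ← vzero d
  let s ← forEach T z (fun acc i => do
    let y ← vsub (X i) μ
    let a ← dot y w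
    vaxpy acc a y)
  let NR ← castN N
  vdiv s NR

/-- Try the thresholds `τ = med + 2 k r ‖v‖`, `-kmax ≤ k ≤ kmax`, one after the other, for the
positions `[lo, hi)` of the sorted array `Y`. The two candidate sets are `[lo, e)`, the entries
`≤ τ + r ‖v‖`, and `[s, hi)`, the entries `≥ τ - r ‖v‖`; the first pair with
`|[lo, e)| ^ (1 + β) + |[s, hi)| ^ (1 + β) < |[lo, hi)| ^ (1 + β)` is returned as `(e, s)`.
Here `rv = r ‖v‖`, and the list enumerates `k + kmax`. -/
def findSplit (Y : Array ℝ) (β rv med : ℝ) (kmax lo hi : ℕ) : List ℕ → RAM (Option (ℕ × ℕ))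
  | [] => ret none
  | i :: is => do
      let iR ← castN i
      let kR ← castN kmax
      let k ← subR iR kR
      let t ← mulR 2 k
      let t ← mulR t rv
      let τ ← addR med t
      let θ₁ ← addR τ rv
      let θ₂ ← subR τ rv
      let e ← binSearch Y (fun y => ltR θ₁ y) (hi - lo) lo hi
      let s ← binSearch Y (fun y => leR θ₂ y) (hi - lo) lo hi
      let m ← subN hi lo
      let m₁ ← subN e lo
      let m₂ ← subN hi s
      let mR ← castN m
      let mR₁ ← castN m₁
      let mR₂ ← castN m₂
      let q ← addR 1 β
      let p ← powR mR q
      let p₁ ← powR mR₁ q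
      let p₂ ← powR mR₂ q
      let p₁₂ ← addR p₁ p₂
      let ok ← ltR p₁₂ p
      if ok then op (some (e, s))
      else findSplit Y β rv med kmax lo hi is

/-- `GaussianSplitOrCluster` on the positions `[lo, hi)` of the sorted array `Y` of the values
`⟨v, X i⟩`, with `nv = ‖v‖`. The result is one interval of positions (`inl`), or two (`inr`).
The middle `1 - α Δ` quantiles are obtained by removing `⌊α Δ m / 2⌋` of the `m` values at
either end. Should no threshold be valid, the middle quantiles are returned. -/
def gaussianSplitOrCluster (c : MultifilterConsts) (Y : Array ℝ) (nv α β R Δ : ℝ) (lo hi : ℕ) :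
    RAM ((ℕ × ℕ) ⊕ ((ℕ × ℕ) × (ℕ × ℕ))) := do
  let m ← subN hi lo
  let mR ← castN m
  let αΔ ← mulR α Δ
  let t ← mulR αΔ mR
  let t ← divR t 2
  let q ← floorR t
  let a ← addN lo q
  let b ← subN hi q
  let nonempty ← ltN a b
  if nonempty then do
    let y₀ ← get Y a
    let b' ← subN b 1
    let y₁ ← get Y b'
    let w ← subR y₁ y₀
    let ℓ ← mulR R nv
    let short ← leR w ℓ
    if short then return Sum.inl (a, b)
    else do
      let x ← divR 1 αΔ
      let x ← logR x
      let x ← logR x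
      let x ← mulR c.split x
      let x ← divR x β
      let kmax ← ceilR x
      let kR ← castN kmax
      let k4 ← mulR 4 kR
      let r ← divR R k4
      let rv ← mulR r nv
      let h ← halfN m
      let pos ← addN lo h
      let med ← get Y pos
      let k2 ← addN kmax kmax
      let res ← findSplit Y β rv med kmax lo hi (List.range (k2 + 1))
      match res with
      | some (e, s) => return Sum.inr ((lo, e), (s, hi))
      | none => return Sum.inl (a, b)
  else return Sum.inl (a, b)

/-- The loop of `Gaussian1DPartition`: the interval `[lo, hi)` is clustered, or split and the two
parts are treated in turn; the nonempty clusters are put on the list `acc`. The first argument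
only bounds the depth of the splitting; since parts are strictly smaller, `hi - lo` is enough. -/
def splitLoop (c : MultifilterConsts) (Y : Array ℝ) (nv α β R Δ : ℝ) :
    ℕ → ℕ → ℕ → List (ℕ × ℕ) → RAM (List (ℕ × ℕ))
  | 0, _, _, acc => ret acc
  | f + 1, lo, hi, acc => do
      let res ← gaussianSplitOrCluster c Y nv α β R Δ lo hi
      match res with
      | Sum.inl (a, b) => do
          let nonempty ← ltN a b
          if nonempty then op ((a, b) :: acc) else return acc
      | Sum.inr ((a, b), (a', b')) => do
          let acc' ← splitLoop c Y nv α β R Δ f a b acc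
          splitLoop c Y nv α β R Δ f a' b' acc'

/-- `Gaussian1DPartition` of the set `T` in the direction `v`; `N` is the size of the full data
set, and `Δ = 1 / (C N)`. -/
def gaussian1DPartition (c : MultifilterConsts) (X : Fin n → Fin d → ℝ) (N : ℕ)
    (T : List (Fin n)) (α : ℝ) (v : Fin d → ℝ) (β C R : ℝ) : RAM (List (List (Fin n))) := do
  let ys ← collect T (fun i => do
    let y ← dot v (X i)
    return (y, i))
  let sorted ← mergeSort ys
  let Y ← toArr (sorted.map Prod.fst)
  let I ← toArr (sorted.map Prod.snd)
  let nv ← len v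
  let NR ← castN N
  let t ← mulR C NR
  let Δ ← divR 1 t
  let m ← size T
  let ivs ← splitLoop c Y nv α β R Δ m 0 m []
  collect ivs (fun ab => do
    charge (ab.2 - ab.1)
    return (I.extract ab.1 ab.2).toList)

/-- `GaussianPartition` of the set `Tp`: the directions are `v_j = M ^ ⌈log d⌉ u_j` with random
sign vectors `u_j`, where `M` is the unnormalized covariance matrix of `Tp` with weights `1 / N`. -/
def gaussianPartition (c : MultifilterConsts) (X : Fin n → Fin d → ℝ) (N : ℕ)
    (Tp : List (Fin n)) (α β C R : ℝ) : RAM (List (List (Fin n))) := do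
  let dR ← castN d
  let ld ← logR dR
  let p ← ceilR ld
  let t ← mulR c.dir ld
  let Ndir ← ceilR t
  let μ ← empMean X Tp
  let vs ← collect (List.range Ndir) (fun _ => do
    let u ← tabulate (fun _ => sign)
    forEach (List.range p) u (fun w _ => covApply X N Tp μ w))
  let NdirR ← castN Ndir
  let C' ← mulR C NdirR
  forEach vs [Tp] (fun Ss v =>
    forEach Ss [] (fun acc T' => do
      let Ts ← gaussian1DPartition c X N T' α v β C' R
      append Ts acc))

/-- The members of a list of sets that have at least `θ` elements. -/
def keepLarge (θ : ℝ) (Ts : List (List (Fin n))) : RAM (List (List (Fin n))) :=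
  forEach Ts [] (fun acc T => do
    let m ← size T
    let mR ← castN m
    let big ← leR θ mR
    if big then op (T :: acc) else return acc)

/-- `FastGaussianMultifilterBoundedDiameter`. -/
def fastGaussianMultifilterBoundedDiameter (c : MultifilterConsts) (X : Fin n → Fin d → ℝ)
    (T : List (Fin n)) (α : ℝ) : RAM (List (Fin d → ℝ)) := do
  let N ← size T
  let NR ← castN N
  let dR ← castN d
  let ld ← logR dR
  let lld ← logR ld
  let s ← powR lld (3 / 2)
  let t ← mulR c.rad ld
  let R ← mulR t s
  let ld2 ← mulR ld ld
  let C ← mulR c.loss ld2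
  let t ← mulR c.depth ld2
  let D ← ceilR t
  let β ← divR 1 ld
  let t ← mulR α NR
  let θ ← divR t 2
  let L ← forEach (List.range D) [T] (fun L _ =>
    forEach L [] (fun acc T' => do
      let Ts ← gaussianPartition c X N T' α β C R
      let Ts ← keepLarge θ Ts
      append Ts acc))
  collect L (fun T' => empMean X T')

/-- `FastGaussianMultifilter`. -/
def fastGaussianMultifilter (c : MultifilterConsts) (X : Fin n → Fin d → ℝ) (α : ℝ) :
    RAM (List (Fin d → ℝ)) := do
  let clusters ← naiveCluster X
  let nR ← castN n
  forEach clusters [] (fun acc T => do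
    let m ← size T
    let mR ← castN m
    let t ← divR nR mR
    let αT ← mulR t α
    let L ← fastGaussianMultifilterBoundedDiameter c X T αT
    append L acc)

end Algorithm

/-! ### The assumptions on the data -/

/-- `|S|⁻¹ ∑ i ∈ S, (X i - μ) (X i - μ)ᵀ ⪯ I`. -/
def BoundedSecondMoment {n d : ℕ} (X : Fin n → EuclideanSpace ℝ (Fin d)) (S : Finset (Fin n))
    (μ : EuclideanSpace ℝ (Fin d)) : Prop :=
  ((1 : Matrix (Fin d) (Fin d) ℝ) - (S.card : ℝ)⁻¹ •
    ∑ i ∈ S, Matrix.vecMulVec (fun j => X i j - μ j) (fun j => X i j - μ j)).PosSemidef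

/-- Gaussian-type tails of the uniform distribution on `S` around `μ`, in every direction `v`:
`Pr [⟨X i - μ, v⟩ > t] ≤ exp (-c₁ t²) + 1 / (c₂ (log d)³)` for all `t ≥ 0`. -/
def GaussianTails (c₁ c₂ : ℝ) {n d : ℕ} (X : Fin n → EuclideanSpace ℝ (Fin d))
    (S : Finset (Fin n)) (μ : EuclideanSpace ℝ (Fin d)) : Prop :=
  ∀ v : EuclideanSpace ℝ (Fin d), ‖v‖ = 1 → ∀ t : ℝ, 0 ≤ t →
    ((S.filter (fun i => t < inner ℝ (X i - μ) v)).card : ℝ) / S.card ≤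
      Real.exp (-(c₁ * t ^ 2)) + 1 / (c₂ * Real.log d ^ 3)

end

/-! Two quantities are followed: a potential that controls cost and list size, and a trace that
controls accuracy.

Potential. Put `β = 1 / log d`. The two parts of a split overlap, so the sum of the set sizes may
grow. A split is accepted only if it decreases `∑ |T| ^ (1 + β)`, hence this sum never grows,
neither within a one-dimensional partition nor over directions and layers. Since `n ≤ d ^ 5`, the
factor `n ^ β` is at most `e ^ 5`, and the total potential is `O(n)`. Every operation on a set is
charged to its potential (`Sat.splitLoop`, `Sat.gaussianPartition`, `Sat.boundedDiameter`). As the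
surviving sets have at least `α N / 2` points, the potential also bounds their number.

Splits. If no threshold is valid, the fraction of values beyond the threshold is raised to the power
`1 + β` every two thresholds (`tail_decay`). After `O(log log (1 / (α Δ)) / β)` thresholds it is
below `1 / m`, thus zero, and the values lie in an interval of length `R ‖v‖`
(`spread_le_of_no_split`). So every cluster is short and nothing is trimmed. The overlap of width `2
r ‖v‖` ensures that all values within `r ‖v‖` of a given point stay together in some cluster. Since
`S` has Gaussian tails, a suitable cluster loses only few points of `S`.

Trace. Let `M` be the covariance of the current set with the fixed weights `1 / N`, `p = ⌈log d⌉`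
and `Φ = tr M ^ (2 p + 1)`. For random signs `u` the direction `v = M ^ p u` satisfies, with
constant probability, `⟨v, x⟩² ≥ ‖M ^ p x‖² / 4` and `‖v‖² ≤ 16 τ` for any `τ ≥ tr M ^ (2 p)`
(`whp_tabulate_sign`). With `O(log d)` directions every difference `x = X i - X j` meets such a `v`.
A set that is short in all directions thus has diameter at most `8 R √τ` after applying `M ^ p`,
which gives `tr M' ^ (2 p + 1) ≤ 64 R² τ` (`trace_setCov_pow_le`). Estimating `tr M ^ (2 p)` by `Φ /
t + d t ^ (2 p)` with `t = B R²` yields `Φ' ≤ (64 / B) (Φ + d (B R²) ^ (2 p + 1))`, so `Φ` decays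
geometrically to the order of the last term (`whp_layer`).

Conclusion. A trace of that size bounds the largest eigenvalue of `M` by `e² B R²`. A set with this
covariance that contains half of `S` has its mean within `O(R / √α)` of `μ`
(`dotProduct_self_setMean_sub_le`). `O(log² d)` layers suffice because the initial clustering never
separates `S` and, with high probability, yields clusters of diameter polynomial in `d`
(`Sat.clusterAlong`, `whp_naiveCluster`). Only one chain of sets through the layers has to behave
well, so the union bound runs over layers and pairs of points, not over the sets. -/

noncomputable section

namespace RAM

variable {β γ ι σ : Type}

/-! ### Program logic -/

/-- Every execution of `c` ends with a result in `Q`. -/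
def All : RAM β → (β → Prop) → Prop
  | ret b, Q => Q b
  | step c, Q => c.All Q
  | flip k, Q => (k true).All Q ∧ (k false).All Q

/-- Every execution of `c` takes at most `t` steps and ends with a result in `Q`. -/
def Sat (c : RAM β) (t : ℝ) (Q : β → Prop) : Prop := (c.time : ℝ) ≤ t ∧ c.All Q

theorem All.mono {c : RAM β} {P Q : β → Prop} (h : c.All P) (hPQ : ∀ b, P b → Q b) : c.All Q := by
  induction c with
  | ret b => exact hPQ b h
  | step c ih => exact ih h
  | flip k ih => exact ⟨ih _ h.1, ih _ h.2⟩

theorem All.bind {c : RAM β} {f : β → RAM γ} {P : β → Prop} {Q : γ → Prop} (h : c.All P)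
    (hf : ∀ b, P b → (f b).All Q) : (c >>= f).All Q := by
  induction c with
  | ret b => exact hf b h
  | step c ih => exact ih h
  | flip k ih => exact ⟨ih _ h.1, ih _ h.2⟩

theorem time_bind_le {c : RAM β} {f : β → RAM γ} {P : β → Prop} {t : ℕ} (h : c.All P)
    (hf : ∀ b, P b → (f b).time ≤ t) : (c >>= f).time ≤ c.time + t := by
  induction c with
  | ret b => exact (hf b h).trans (Nat.le_add_left _ _)
  | step c ih =>
    have := ih h
    change (c >>= f).time + 1 ≤ c.time + 1 + t
    omega
  | flip k ih =>
    have h1 := ih true h.1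
    have h2 := ih false h.2
    change max (k true >>= f).time (k false >>= f).time + 1
      ≤ max (k true).time (k false).time + 1 + t
    omega

theorem Sat.mono {c : RAM β} {t t' : ℝ} {P Q : β → Prop} (h : c.Sat t P) (ht : t ≤ t')
    (hPQ : ∀ b, P b → Q b) : c.Sat t' Q := ⟨h.1.trans ht, h.2.mono hPQ⟩

theorem All.exists {c : RAM β} {P : β → Prop} (h : c.All P) : ∃ b, P b := by
  induction c with
  | ret b => exact ⟨b, h⟩
  | step c ih => exact ih h
  | flip k ih => exact ih _ h.1

theorem Sat.bind {c : RAM β} {f : β → RAM γ} {t₁ t₂ t : ℝ} {P : β → Prop} {Q : γ → Prop}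
    (h : c.Sat t₁ P) (hf : ∀ b, P b → (f b).Sat t₂ Q) (ht : t₁ + t₂ ≤ t) :
    (c >>= f).Sat t Q := by
  refine ⟨?_, h.2.bind fun b hb => (hf b hb).2⟩
  obtain ⟨b₀, hb₀⟩ := h.2.exists
  -- Some execution of `c` reaches a result in `P`, so `t₂` bounds an actual running time. It is
  -- therefore nonnegative and may be rounded down to a natural number.
  have ht₂ : 0 ≤ t₂ := (Nat.cast_nonneg _).trans (hf b₀ hb₀).1
  have := time_bind_le (f := f) (t := ⌊t₂⌋₊) h.2 fun b hb => Nat.le_floor (hf b hb).1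
  have h2 := Nat.floor_le ht₂
  have h3 : ((c >>= f).time : ℝ) ≤ c.time + ⌊t₂⌋₊ := by exact_mod_cast this
  have := h.1
  linarith

theorem Sat.pure {b : β} {t : ℝ} {Q : β → Prop} (ht : 0 ≤ t) (hb : Q b) :
    (Pure.pure b : RAM β).Sat t Q := ⟨by simpa [Pure.pure, time] using ht, hb⟩

theorem Sat.ret {b : β} {t : ℝ} {Q : β → Prop} (ht : 0 ≤ t) (hb : Q b) :
    (RAM.ret b : RAM β).Sat t Q := Sat.pure ht hb

theorem Sat.step {c : RAM β} {t : ℝ} {Q : β → Prop} (h : c.Sat (t - 1) Q) :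
    (RAM.step c).Sat t Q := by
  refine ⟨?_, h.2⟩
  have := h.1
  simp only [time, Nat.cast_add, Nat.cast_one]
  linarith

theorem sat_step {c : RAM β} {t : ℝ} {Q : β → Prop} :
    (RAM.step c).Sat t Q ↔ c.Sat (t - 1) Q := by
  refine ⟨fun h => ⟨?_, h.2⟩, Sat.step⟩
  have := h.1
  simp only [time, Nat.cast_add, Nat.cast_one] at this
  linarith

theorem sat_op_bind {b : β} {f : β → RAM γ} {t : ℝ} {Q : γ → Prop} :
    (op b >>= f).Sat t Q ↔ (f b).Sat (t - 1) Q := sat_step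

theorem Sat.op {b : β} {t : ℝ} {Q : β → Prop} (ht : 1 ≤ t) (hb : Q b) :
    (RAM.op b).Sat t Q := Sat.step (Sat.ret (by linarith) hb)

theorem Sat.flip {k : Bool → RAM β} {t : ℝ} {Q : β → Prop} (h : ∀ b, (k b).Sat (t - 1) Q) :
    (RAM.flip k).Sat t Q := by
  refine ⟨?_, (h true).2, (h false).2⟩
  have h1 := (h true).1
  have h2 := (h false).1
  have : ((max (k true).time (k false).time : ℕ) : ℝ) ≤ t - 1 := by
    rw [Nat.cast_max]; exact max_le h1 h2
  simp only [time, Nat.cast_add, Nat.cast_one]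
  linarith

theorem Sat.charge (k : ℕ) : (charge k).Sat k (fun _ => True) := by
  induction k with
  | zero => exact Sat.ret (by simp) trivial
  | succ k ih => exact Sat.step (ih.mono (by simp) (by simp))

/-- The invariant depends on the part of the list still to be processed. It can thus speak of a
remaining sum, of the directions already used or of the number of rounds left. -/
theorem Sat.forEach {I : List ι → σ → Prop} {w : ι → ℝ} {f : σ → ι → RAM σ}
    (hf : ∀ i l s, I (i :: l) s → (f s i).Sat (w i) (I l)) (l : List ι) (s : σ) (hs : I l s) :
    (forEach l s f).Sat (l.map fun i => w i + 1).sum (I []) := by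
  induction l generalizing s with
  | nil => exact Sat.ret (by simp) hs
  | cons i l ih =>
    refine Sat.step (Sat.bind (hf i l s hs) (fun s' hs' => ih s' hs') ?_)
    simp only [List.map_cons, List.sum_cons]
    linarith

theorem Sat.collect {w : ι → ℝ} {Q : ι → β → Prop} {f : ι → RAM β} (l : List ι)
    (hf : ∀ i ∈ l, (f i).Sat (w i) (Q i)) :
    (collect l f).Sat (l.map fun i => w i + 1).sum (List.Forall₂ Q l) := by
  induction l with
  | nil => exact Sat.ret (by simp) List.Forall₂.nil
  | cons i l ih =>
    refine Sat.step (Sat.bind (hf i (by simp)) (fun b hb =>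
      Sat.bind (ih fun j hj => hf j (by simp [hj]))
        (fun bs hbs => Sat.ret le_rfl (List.Forall₂.cons hb hbs)) le_rfl) ?_)
    simp only [List.map_cons, List.sum_cons]
    linarith

theorem Sat.size (l : List ι) : (size l).Sat (2 * l.length) (· = l.length) := by
  have := Sat.forEach (I := fun l' k => k + l'.length = l.length) (w := fun _ => 1)
    (f := fun k (_ : ι) => addN k 1)
    (fun i l' s h => Sat.op le_rfl (by simp at h; omega)) l 0 (by simp)
  refine this.mono ?_ (by simp)
  simp only [List.map_const', List.sum_replicate, nsmul_eq_mul]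
  linarith

theorem Sat.append (l l' : List ι) : (append l l').Sat l.length (· = l ++ l') :=
  Sat.bind (Sat.charge _) (fun _ _ => Sat.pure le_rfl rfl) (by simp)

theorem Sat.toArr (l : List ι) : (toArr l).Sat l.length (· = l.toArray) :=
  Sat.bind (Sat.charge _) (fun _ _ => Sat.pure le_rfl rfl) (by simp)

/-! ### Vectors -/

theorem Sat.tabulate {d : ℕ} {f : Fin d → RAM ℝ} {w : ℝ} {P : Fin d → ℝ → Prop}
    (hf : ∀ j, (f j).Sat w (P j)) :
    (tabulate f).Sat ((w + 2) * d) (fun v => ∀ j, P j (v j)) := by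
  have := Sat.forEach (I := fun (l : List (Fin d)) (v : Fin d → ℝ) => ∀ j, j ∉ l → P j (v j))
    (w := fun _ => w + 1)
    (f := fun v j => do
      let x ← f j
      store v j x) (by
    intro j l v hv
    refine Sat.bind (hf j) (fun x hx => Sat.op le_rfl ?_) le_rfl
    intro k hk
    by_cases hkj : k = j
    · subst hkj; simpa using hx
    · rw [Function.update_of_ne hkj]
      exact hv k (by simp [hk, hkj])) (List.finRange d) (fun _ => 0) (by simp)
  refine this.mono ?_ (by simp)
  simp only [List.map_const', List.sum_replicate, nsmul_eq_mul, List.length_finRange]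
  linarith

theorem Sat.tabulate_eq {d : ℕ} {f : Fin d → RAM ℝ} {w : ℝ} {g : Fin d → ℝ}
    (hf : ∀ j, (f j).Sat w (· = g j)) : (RAM.tabulate f).Sat ((w + 2) * d) (· = g) :=
  (Sat.tabulate hf).mono le_rfl (fun _ h => funext h)

theorem Sat.dot {d : ℕ} (x y : Fin d → ℝ) : (dot x y).Sat (5 * d) (· = x ⬝ᵥ y) := by
  have := Sat.forEach
    (I := fun (l : List (Fin d)) (s : ℝ) => s + (l.map fun j => x j * y j).sum = x ⬝ᵥ y)
    (w := fun _ => 4)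
    (f := fun s j => do
      let a ← load x j
      let b ← load y j
      let c ← mulR a b
      addR s c) (by
    intro j l s hs
    simp only [load, mulR, addR, sat_op_bind]
    refine Sat.op (by norm_num) ?_
    rw [← hs]
    simp only [List.map_cons, List.sum_cons]
    ring) (List.finRange d) 0 (by simp [dotProduct, Fin.sum_univ_def])
  refine this.mono ?_ (by simp)
  simp only [List.map_const', List.sum_replicate, nsmul_eq_mul, List.length_finRange]
  linarith

theorem Sat.len {d : ℕ} (x : Fin d → ℝ) : (len x).Sat (5 * d + 1) (· = √(x ⬝ᵥ x)) :=
  Sat.bind (Sat.dot x x) (by rintro _ rfl; exact Sat.op le_rfl rfl) le_rfl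

theorem Sat.vsub {d : ℕ} (x y : Fin d → ℝ) : (vsub x y).Sat (5 * d) (· = x - y) := by
  refine (Sat.tabulate_eq (w := 3) (g := x - y) fun j => ?_).mono (by linarith) (fun _ h => h)
  simp only [load, subR, sat_op_bind]
  exact Sat.op (by norm_num) rfl

theorem Sat.vaxpy {d : ℕ} (x : Fin d → ℝ) (s : ℝ) (y : Fin d → ℝ) :
    (vaxpy x s y).Sat (6 * d) (· = x + s • y) := by
  refine (Sat.tabulate_eq (w := 4) (g := x + s • y) fun j => ?_).mono (by linarith) (fun _ h => h)
  simp only [load, mulR, addR, sat_op_bind]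
  exact Sat.op (by norm_num) rfl

theorem Sat.vdiv {d : ℕ} (x : Fin d → ℝ) (s : ℝ) : (vdiv x s).Sat (4 * d) (· = s⁻¹ • x) := by
  refine (Sat.tabulate_eq (w := 2) (g := s⁻¹ • x) fun j => ?_).mono (by linarith) (fun _ h => h)
  simp only [load, divR, sat_op_bind]
  exact Sat.op (by norm_num) (by simp [div_eq_inv_mul])

theorem Sat.vzero (d : ℕ) : (vzero d).Sat (3 * d) (· = 0) :=
  (Sat.tabulate_eq (w := 1) (g := 0) fun _ => Sat.op le_rfl rfl).mono (by linarith) (fun _ h => h)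

/-! ### Expectations -/

/-- Expectation of `g` of the result. -/
def ev : RAM β → (β → ℝ) → ℝ
  | ret b, g => g b
  | step c, g => c.ev g
  | flip k, g => ((k true).ev g + (k false).ev g) / 2

theorem ev_bind (c : RAM β) (f : β → RAM γ) (g : γ → ℝ) :
    (c >>= f).ev g = c.ev (fun b => (f b).ev g) := by
  induction c with
  | ret b => rfl
  | step c ih => exact ih
  | flip k ih =>
    change ((k true >>= f).ev g + (k false >>= f).ev g) / 2 = _
    rw [ih, ih]; rfl

theorem All.ev_le {c : RAM β} {P : β → Prop} {g h : β → ℝ} (hc : c.All P)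
    (hgh : ∀ b, P b → g b ≤ h b) : c.ev g ≤ c.ev h := by
  induction c with
  | ret b => exact hgh b hc
  | step c ih => exact ih hc
  | flip k ih =>
    have h1 := ih _ hc.1
    have h2 := ih _ hc.2
    simp only [ev]
    linarith

theorem all_true (c : RAM β) : c.All (fun _ => True) := by
  induction c with
  | ret b => trivial
  | step c ih => exact ih
  | flip k ih => exact ⟨ih _, ih _⟩

theorem ev_mono (c : RAM β) {g h : β → ℝ} (hgh : ∀ b, g b ≤ h b) : c.ev g ≤ c.ev h :=
  c.all_true.ev_le fun b _ => hgh b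

theorem ev_const (c : RAM β) (x : ℝ) : c.ev (fun _ => x) = x := by
  induction c with
  | ret b => rfl
  | step c ih => exact ih
  | flip k ih => simp only [ev, ih]; ring

theorem ev_add (c : RAM β) (g h : β → ℝ) : c.ev (fun b => g b + h b) = c.ev g + c.ev h := by
  induction c with
  | ret b => rfl
  | step c ih => exact ih
  | flip k ih => simp only [ev, ih]; ring

theorem ev_mul (c : RAM β) (x : ℝ) (g : β → ℝ) : c.ev (fun b => x * g b) = x * c.ev g := by
  induction c with
  | ret b => rfl
  | step c ih => exact ih
  | flip k ih => simp only [ev, ih]; ring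

theorem ev_sum (c : RAM β) (s : Finset ι) (g : ι → β → ℝ) :
    c.ev (fun b => ∑ i ∈ s, g i b) = ∑ i ∈ s, c.ev (g i) := by
  classical
  induction s using Finset.induction_on with
  | empty => simp [ev_const]
  | insert i s hi ih => simp only [Finset.sum_insert hi, ev_add, ih]

/-- Fubini for independent coins. It allows a single random coordinate to be studied with all the
later ones fixed. -/
theorem ev_comm (c : RAM β) (c' : RAM γ) (g : β → γ → ℝ) :
    c.ev (fun x => c'.ev (fun y => g x y)) = c'.ev (fun y => c.ev (fun x => g x y)) := by
  induction c with
  | ret b => rfl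
  | step c ih => exact ih
  | flip k ih =>
    simp only [ev, ih]
    rw [← ev_add, div_eq_inv_mul, ← ev_mul]
    congr 1; ext y; ring

open Classical in
/-- The result is in `Q` with probability at least `1 - δ`. -/
def Whp (c : RAM β) (δ : ℝ) (Q : β → Prop) : Prop := c.ev (fun b => if Q b then 0 else 1) ≤ δ

theorem All.whp {c : RAM β} {Q : β → Prop} (h : c.All Q) : c.Whp 0 Q := by
  refine (h.ev_le (h := fun _ => 0) fun b hb => ?_).trans (ev_const _ _).le
  simp [hb]

theorem Whp.bind {c : RAM β} {f : β → RAM γ} {δ₁ δ₂ δ : ℝ} {P : β → Prop} {Q : γ → Prop}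
    (h : c.Whp δ₁ P) (hf : ∀ b, P b → (f b).Whp δ₂ Q) (hδ₂ : 0 ≤ δ₂) (hδ : δ₁ + δ₂ ≤ δ) :
    (c >>= f).Whp δ Q := by
  classical
  unfold Whp at *
  rw [ev_bind]
  refine (c.ev_mono (h := fun b => (if P b then 0 else 1) + δ₂) fun b => ?_).trans ?_
  · by_cases hb : P b
    · simpa [hb] using hf b hb
    · have : (f b).ev (fun b => if Q b then 0 else 1) ≤ (f b).ev (fun _ => 1) :=
        ev_mono _ fun b => by split_ifs <;> norm_num
      rw [ev_const] at this
      simp only [hb, if_false]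
      linarith
  · rw [ev_add, ev_const]; linarith

theorem Whp.mono {c : RAM β} {δ δ' : ℝ} {P Q : β → Prop} (h : c.Whp δ P) (hδ : δ ≤ δ')
    (hPQ : ∀ b, P b → Q b) : c.Whp δ' Q := by
  classical
  refine (c.ev_mono fun b => ?_).trans (h.trans hδ)
  by_cases hb : P b
  · simp [hb, hPQ b hb]
  · simp only [hb, if_false]; split_ifs <;> norm_num

theorem Whp.and_all {c : RAM β} {δ : ℝ} {P Q : β → Prop} (h : c.Whp δ P) (h' : c.All Q) :
    c.Whp δ (fun b => P b ∧ Q b) := by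
  classical
  refine (h'.ev_le fun b hb => ?_).trans h
  simp [hb]

/-- Probabilities are handled as the finite averages `ev`, which recurse along the execution tree;
this is the bridge to `PMF`, crossed only at the very end. -/
theorem toOuterMeasure_dist (c : RAM β) (s : Set β) :
    c.dist.toOuterMeasure s = ENNReal.ofReal (c.ev (s.indicator 1)) := by
  have hnn : ∀ c : RAM β, 0 ≤ c.ev (s.indicator 1) := fun c => by
    refine (c.ev_const 0).symm.le.trans (c.ev_mono fun b => Set.indicator_nonneg (by simp) b)
  induction c with
  | ret b =>
    classical
    simp only [dist, PMF.toOuterMeasure_pure_apply, ev, Set.indicator_apply]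
    split_ifs <;> simp
  | step c ih => exact ih
  | flip k ih =>
    simp only [dist, PMF.toOuterMeasure_bind_apply, tsum_bool, PMF.uniformOfFintype_apply, ih, ev]
    have h2 : ((Fintype.card Bool : ℕ) : ENNReal)⁻¹ = ENNReal.ofReal 2⁻¹ := by
      rw [Fintype.card_bool, ENNReal.ofReal_inv_of_pos (by norm_num)]; norm_num
    rw [h2, ← ENNReal.ofReal_mul (by norm_num), ← ENNReal.ofReal_mul (by norm_num),
      ← ENNReal.ofReal_add (mul_nonneg (by norm_num) (hnn _)) (mul_nonneg (by norm_num) (hnn _))]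
    congr 1; ring

theorem Whp.le_toOuterMeasure {c : RAM β} {δ : ℝ} {Q : β → Prop} (h : c.Whp δ Q) :
    1 - ENNReal.ofReal δ ≤ c.dist.toOuterMeasure {b | Q b} := by
  classical
  have h1 : c.ev (fun b => if Q b then 0 else 1) + c.ev ({b | Q b}.indicator 1) = 1 := by
    rw [← ev_add]
    refine Eq.trans ?_ (ev_const c 1)
    congr 1; ext b
    by_cases hb : Q b <;> simp [hb]
  have h0 : 0 ≤ c.ev (fun b => if Q b then (0:ℝ) else 1) :=
    (c.ev_const 0).symm.le.trans (c.ev_mono fun b => by split_ifs <;> norm_num)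
  have h' : c.ev (fun b => if Q b then (0:ℝ) else 1) ≤ δ := h
  rw [toOuterMeasure_dist, ← ENNReal.ofReal_one, ← ENNReal.ofReal_sub _ (h0.trans h')]
  exact ENNReal.ofReal_le_ofReal (by linarith)

end RAM
end

noncomputable section

namespace RAM

variable {ι : Type}

/-! ### Sorting and searching -/

/-- The first components are nondecreasing. -/
def Sorted (l : List (ℝ × ι)) : Prop := l.Pairwise fun x y => x.1 ≤ y.1

theorem Sat.merge (l l' : List (ℝ × ι)) : (merge l l').Sat (2 * (l.length + l'.length) + 1)
    (fun r => r.Perm (l ++ l') ∧ (Sorted l → Sorted l' → Sorted r)) := by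
  induction hk : l.length + l'.length generalizing l l' with
  | zero =>
    obtain rfl : l = [] := List.length_eq_zero_iff.1 (by omega)
    obtain rfl : l' = [] := List.length_eq_zero_iff.1 (by omega)
    rw [RAM.merge]
    exact Sat.step (Sat.ret (by simp) ⟨by simp, fun h _ => h⟩)
  | succ k ih =>
    cases l with
    | nil =>
      rw [RAM.merge]
      exact Sat.step (Sat.ret (by simp) ⟨by simp, fun _ h => h⟩)
    | cons x xs =>
      cases l' with
      | nil =>
        rw [RAM.merge]
        · exact Sat.step (Sat.ret (by simp; positivity) ⟨by simp, fun h _ => h⟩)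
        · simp
      | cons y ys =>
        simp only [List.length_cons] at hk
        have hk' : (((x :: xs).length : ℝ) + ((y :: ys).length : ℝ)) = k + 1 := by
          simp only [List.length_cons]; exact_mod_cast hk
        rw [RAM.merge, hk']
        simp only [leR, sat_op_bind, decide_eq_true_eq]
        split_ifs with hxy
        · have h1 := ih xs (y :: ys) (by simp only [List.length_cons]; omega)
          have h2 : ((xs.length : ℝ) + ((y :: ys).length : ℝ)) = k := by
            simp only [List.length_cons]; norm_cast; omega
          rw [h2] at h1
          refine Sat.bind h1 (fun r hr => Sat.op le_rfl ⟨?_, fun h h' => ?_⟩) (by linarith)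
          · exact (hr.1.cons x).trans (by simp)
          · refine List.pairwise_cons.2 ⟨fun z hz => ?_, hr.2 (List.pairwise_cons.1 h).2 h'⟩
            rcases List.mem_append.1 (hr.1.mem_iff.1 hz) with hz | hz
            · exact (List.pairwise_cons.1 h).1 z hz
            · rcases List.mem_cons.1 hz with rfl | hz
              · exact hxy
              · exact hxy.trans ((List.pairwise_cons.1 h').1 z hz)
        · have h1 := ih (x :: xs) ys (by simp only [List.length_cons]; omega)
          have h2 : (((x :: xs).length : ℝ) + (ys.length : ℝ)) = k := by
            simp only [List.length_cons]; norm_cast; omega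
          rw [h2] at h1
          refine Sat.bind h1 (fun r hr => Sat.op le_rfl ⟨?_, fun h h' => ?_⟩) (by linarith)
          · exact (hr.1.cons y).trans (List.perm_middle (l₁ := x :: xs)).symm
          · push Not at hxy
            refine List.pairwise_cons.2 ⟨fun z hz => ?_, hr.2 h (List.pairwise_cons.1 h').2⟩
            rcases List.mem_append.1 (hr.1.mem_iff.1 hz) with hz | hz
            · rcases List.mem_cons.1 hz with rfl | hz
              · exact hxy.le
              · exact hxy.le.trans ((List.pairwise_cons.1 h).1 z hz)
            · exact (List.pairwise_cons.1 h').1 z hz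

/-- There are `k` levels of recursion. On `m` elements a level costs `m` for copying and at most `2
m + 1` for merging, together at most `4 m`. -/
theorem Sat.mergeSort (k : ℕ) (l : List (ℝ × ι)) (hl : 1 ≤ l.length) (hk : l.length ≤ 2 ^ k) :
    (mergeSort l).Sat (4 * l.length * k + l.length) (fun r => r.Perm l ∧ Sorted r) := by
  induction k generalizing l with
  | zero =>
    have h1 : l.length = 1 := by simp at hk; omega
    rw [RAM.mergeSort, dif_neg (by omega)]
    obtain ⟨x, rfl⟩ := List.length_eq_one_iff.1 h1
    exact Sat.step (Sat.ret (by simp) ⟨List.Perm.refl _, List.pairwise_singleton _ _⟩)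
  | succ k ih =>
    rw [RAM.mergeSort]
    have hl' : (1 : ℝ) ≤ l.length := by exact_mod_cast hl
    split_ifs with h2
    · rw [pow_succ] at hk
      have e1 : (l.take (l.length / 2)).length = l.length / 2 := by simp; omega
      have e2 : (l.drop (l.length / 2)).length = l.length - l.length / 2 := by simp
      have e3 : ((l.take (l.length / 2)).length : ℝ) + ((l.drop (l.length / 2)).length : ℝ)
          = l.length := by
        rw [e1, e2]; norm_cast; omega
      refine Sat.bind (Sat.charge _) (fun _ _ => Sat.bind (ih _ (by omega) (by omega))
        (fun l₁ h₁ => Sat.bind (ih _ (by omega) (by omega)) (fun l₂ h₂ =>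
          (Sat.merge l₁ l₂).mono (t' := 2 * l.length + 1) ?_ ?_) le_rfl) le_rfl) ?_
      · rw [h₁.1.length_eq, h₂.1.length_eq, e3]
      · rintro r ⟨hr, hs⟩
        refine ⟨hr.trans ?_, hs h₁.2 h₂.2⟩
        exact (h₁.1.append h₂.1).trans (by rw [List.take_append_drop])
      · push_cast
        rw [← e3]
        rw [← e3] at hl'
        generalize ((l.take (l.length / 2)).length : ℝ) = x at *
        generalize ((l.drop (l.length / 2)).length : ℝ) = y at *
        nlinarith
    · obtain ⟨x, rfl⟩ := List.length_eq_one_iff.1 (by omega : l.length = 1)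
      exact Sat.step (Sat.ret (by simp; positivity) ⟨List.Perm.refl _, List.pairwise_singleton _ _⟩)

/-- `r` is the first position of `[lo, hi)` at which `y` satisfies `p`, and all later ones do. -/
def IsCut (y : ℕ → ℝ) (lo hi : ℕ) (p : ℝ → Prop) (r : ℕ) : Prop :=
  lo ≤ r ∧ r ≤ hi ∧ (∀ i, lo ≤ i → i < r → ¬ p (y i)) ∧ ∀ i, r ≤ i → i < hi → p (y i)

theorem Sat.binSearch {Y : Array ℝ} {P : ℝ → RAM Bool} {p : ℝ → Prop}
    (hP : ∀ y, (P y).Sat 1 (fun b => b = true ↔ p y)) (k f lo hi : ℕ) (hf : hi - lo ≤ f)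
    (hlo : lo ≤ hi) (hk : hi - lo < 2 ^ k)
    (hp : ∀ i j, lo ≤ i → i ≤ j → j < hi → p (Y.getD i 0) → p (Y.getD j 0)) :
    (binSearch Y P f lo hi).Sat (6 * k + 1) (IsCut (fun i => Y.getD i 0) lo hi p) := by
  induction f generalizing lo hi k with
  | zero =>
    have : lo = hi := by omega
    subst this
    exact Sat.ret (by positivity) ⟨le_rfl, le_rfl, fun i _ _ => by omega, fun i _ _ => by omega⟩
  | succ f ih =>
    rw [RAM.binSearch]
    simp only [ltN, sat_op_bind, decide_eq_true_eq]
    split_ifs with h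
    · simp only [addN, halfN, get, sat_op_bind]
      obtain _ | k := k
      · simp at hk; omega
      rw [pow_succ] at hk
      refine Sat.bind (t₂ := 6 * k + 2) (hP _) (fun b hb => ?_) (by push_cast; linarith)
      split_ifs with hbt
      · have hpm := hb.1 hbt
        refine (ih k lo ((lo + hi) / 2) (by omega) (by omega) (by omega) fun i j h1 h2 h3 =>
          hp i j h1 h2 (by omega)).mono (by linarith) ?_
        rintro r ⟨h1, h2, h3, h4⟩
        refine ⟨h1, by omega, h3, fun i hi1 hi2 => ?_⟩
        by_cases him : i < (lo + hi) / 2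
        · exact h4 i hi1 him
        · exact hp _ i (by omega) (by omega) hi2 hpm
      · have hpm : ¬ p _ := fun hh => hbt (hb.2 hh)
        rw [sat_op_bind]
        refine (ih k ((lo + hi) / 2 + 1) hi (by omega) (by omega) (by omega) fun i j h1 h2 h3 =>
          hp i j (by omega) h2 h3).mono (by linarith) ?_
        rintro r ⟨h1, h2, h3, h4⟩
        refine ⟨by omega, h2, fun i hi1 hi2 hpi => ?_, h4⟩
        by_cases him : (lo + hi) / 2 < i
        · exact h3 i (by omega) hi2 hpi
        · exact hpm (hp i _ hi1 (by omega) (by omega) hpi)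
    · have : lo = hi := by omega
      subst this
      exact Sat.pure (by simp)
        ⟨le_rfl, le_rfl, fun i _ _ => by omega, fun i _ _ => by omega⟩

end RAM
end

noncomputable section
open RAM

/-! ### Existence of a valid split -/

/-- If no threshold splits a set of `m` values, the numbers `F k` of values beyond the
thresholds decay doubly exponentially. -/
theorem tail_decay {m β : ℝ} (hm : 0 < m) (hβ : 0 ≤ β) {K : ℕ} {F G : ℕ → ℝ}
    (hF : ∀ k ≤ K, 0 ≤ F k ∧ F k ≤ m) (hF0 : F 0 ≤ m / 2) (hG : ∀ k ≤ K, 0 ≤ G k)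
    (hGF : ∀ k, k + 2 ≤ K → G (k + 2) ≤ F k)
    (hsplit : ∀ k ≤ K, m ^ (1 + β) ≤ (m - F k) ^ (1 + β) + G k ^ (1 + β)) (j : ℕ)
    (hj : 2 * j ≤ K) : F (2 * j) ≤ m * (1 / 2 : ℝ) ^ ((1 + β) ^ j) := by
  have hmβ : 0 < m ^ β := Real.rpow_pos_of_pos hm β
  induction j with
  | zero => simp at hF0 ⊢; linarith
  | succ j ih =>
    have hK : 2 * j + 2 ≤ K := by omega
    obtain ⟨h0, h1⟩ := hF (2 * j + 2) hK
    have h2 := hsplit (2 * j + 2) hK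
    -- Bounding one factor `(m - F) ^ β` by `m ^ β` turns the failure of the split into `F * m ^ β ≤
    -- G ^ (1 + β)`. With `G (2 j + 2) ≤ F (2 j)` this says that `F / m` is at most the power `1 +
    -- β` of its value two thresholds earlier.
    have h3 : (m - F (2 * j + 2)) ^ (1 + β) ≤ (m - F (2 * j + 2)) * m ^ β := by
      rcases (sub_nonneg.2 h1).eq_or_lt with h | h
      · rw [← h, Real.zero_rpow (by linarith)]; simp
      · rw [Real.rpow_add h, Real.rpow_one]
        exact mul_le_mul_of_nonneg_left (Real.rpow_le_rpow h.le (by linarith) hβ) h.le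
    have h4 : G (2 * j + 2) ^ (1 + β) ≤ F (2 * j) ^ (1 + β) :=
      Real.rpow_le_rpow (hG _ hK) (hGF _ hK) (by linarith)
    have h5 : F (2 * j) ^ (1 + β) ≤ (m * (1 / 2 : ℝ) ^ ((1 + β) ^ j)) ^ (1 + β) :=
      Real.rpow_le_rpow (hF _ (by omega)).1 (ih (by omega)) (by linarith)
    rw [Real.mul_rpow hm.le (by positivity), ← Real.rpow_mul (by norm_num),
      ← pow_succ, Real.rpow_add hm, Real.rpow_one] at h5
    rw [Real.rpow_add hm, Real.rpow_one] at h2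
    have h6 : F (2 * j + 2) * m ^ β ≤ m * (1 / 2 : ℝ) ^ ((1 + β) ^ (j + 1)) * m ^ β := by
      nlinarith
    exact le_of_mul_le_mul_right h6 hmβ

/-- If none of the thresholds `med + 2 k ρ`, `|k| ≤ K`, splits the values `y lo ≤ … ≤ y (hi - 1)`,
then these lie in an interval of length `4 K ρ`. -/
theorem spread_le_of_no_split {y : ℕ → ℝ} {lo hi K : ℕ} {β ρ : ℝ} (hlo : lo < hi)
    (hβ : 0 ≤ β) (hρ : 0 < ρ) (hK : 1 ≤ K)
    (hm : ((hi - lo : ℕ) : ℝ) < 2 ^ ((1 + β) ^ ((K - 1) / 2)))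
    (h : ∀ i < 2 * K + 1, ∃ e s : ℕ,
      IsCut y lo hi (fun x => y (lo + (hi - lo) / 2) + 2 * ((i : ℝ) - K) * ρ + ρ < x) e ∧
      IsCut y lo hi (fun x => y (lo + (hi - lo) / 2) + 2 * ((i : ℝ) - K) * ρ - ρ ≤ x) s ∧
      ((hi - lo : ℕ) : ℝ) ^ (1 + β) ≤
        ((e - lo : ℕ) : ℝ) ^ (1 + β) + ((hi - s : ℕ) : ℝ) ^ (1 + β)) :
    y (hi - 1) - y lo ≤ 4 * K * ρ := by
  set med := y (lo + (hi - lo) / 2) with hmed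
  -- With `2 j ≤ K - 1`, the outer end `med + (4 j + 1) ρ` of the last threshold used still lies
  -- within `2 K ρ` of the median. Halving `K` itself could overshoot.
  set j := (K - 1) / 2 with hj
  have hjK : 2 * j ≤ K - 1 := by omega
  have hm0 : (0 : ℝ) < ((hi - lo : ℕ) : ℝ) := by exact_mod_cast (by omega : 0 < hi - lo)
  have hlt : ((hi - lo : ℕ) : ℝ) * (1 / 2 : ℝ) ^ ((1 + β) ^ j) < 1 := by
    rw [one_div, Real.inv_rpow (by norm_num), ← div_eq_mul_inv, div_lt_one (by positivity)]
    exact hm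
  have hjr : (4 * (j : ℝ) + 1) * ρ ≤ 2 * K * ρ := by
    have : 4 * j + 1 ≤ 2 * K := by omega
    have : (4 * (j : ℝ) + 1) ≤ 2 * K := by exact_mod_cast this
    nlinarith
  choose! e s he hs hes using h
  have hright : y (hi - 1) ≤ med + 2 * K * ρ := by
    have := tail_decay hm0 hβ (K := K) (F := fun k => ((hi - e (K + k) : ℕ) : ℝ))
      (G := fun k => ((hi - s (K + k) : ℕ) : ℝ)) ?_ ?_ (fun k _ => by positivity) ?_ ?_ j (by omega)
    -- The number of values beyond the threshold is an integer below one, hence zero.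
    · have h1 := this.trans_lt hlt
      have h2 : hi - e (K + 2 * j) = 0 := by
        have : hi - e (K + 2 * j) < 1 := by exact_mod_cast h1
        omega
      obtain ⟨c1, c2, c3, c4⟩ := he (K + 2 * j) (by omega)
      have := c3 (hi - 1) (by omega) (by omega)
      push Not at this
      push_cast at this
      linarith
    · intro k hk
      obtain ⟨c1, c2, c3, c4⟩ := he (K + k) (by omega)
      refine ⟨by positivity, ?_⟩
      exact_mod_cast (by omega : hi - e (K + k) ≤ hi - lo)
    · obtain ⟨c1, c2, c3, c4⟩ := he (K + 0) (by omega)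
      have : 2 * (hi - e (K + 0)) ≤ hi - lo := by
        by_contra hcon
        have h1 := c4 (lo + (hi - lo) / 2) (by omega) (by omega)
        rw [← hmed] at h1
        push_cast at h1
        linarith
      have : 2 * ((hi - e (K + 0) : ℕ) : ℝ) ≤ ((hi - lo : ℕ) : ℝ) := by exact_mod_cast this
      linarith
    -- The lower end of the overlap at threshold `k + 1` coincides with the upper end at `k`, where
    -- one cut is weak and the other strict. Going two thresholds further makes the comparison
    -- immune to ties.
    · intro k hk
      obtain ⟨c1, c2, c3, c4⟩ := he (K + k) (by omega)
      obtain ⟨b1, b2, b3, b4⟩ := hs (K + (k + 2)) (by omega)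
      have : e (K + k) ≤ s (K + (k + 2)) := by
        by_contra hcon
        push Not at hcon
        have h1 := c3 (s (K + (k + 2))) b1 hcon
        have h2 := b4 (s (K + (k + 2))) le_rfl (by omega)
        push_cast at h1 h2
        push Not at h1
        linarith
      exact_mod_cast (by omega : hi - s (K + (k + 2)) ≤ hi - e (K + k))
    · intro k hk
      obtain ⟨c1, c2, c3, c4⟩ := he (K + k) (by omega)
      have h1 := hes (K + k) (by omega)
      have h2 : (((hi - lo : ℕ) : ℝ) - ((hi - e (K + k) : ℕ) : ℝ)) = ((e (K + k) - lo : ℕ) : ℝ) := by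
        rw [sub_eq_iff_eq_add]; norm_cast; omega
      rw [h2]; exact h1
  -- The mirror image below the median: `s` and `e` exchange their roles.
  have hleft : med - 2 * K * ρ ≤ y lo := by
    have := tail_decay hm0 hβ (K := K) (F := fun k => ((s (K - k) - lo : ℕ) : ℝ))
      (G := fun k => ((e (K - k) - lo : ℕ) : ℝ)) ?_ ?_ (fun k _ => by positivity) ?_ ?_ j (by omega)
    · have h1 := this.trans_lt hlt
      have h2 : s (K - 2 * j) - lo = 0 := by
        have : s (K - 2 * j) - lo < 1 := by exact_mod_cast h1
        omega
      obtain ⟨c1, c2, c3, c4⟩ := hs (K - 2 * j) (by omega)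
      have := c4 lo (by omega) (by omega)
      rw [Nat.cast_sub (by omega)] at this
      push_cast at this
      linarith
    · intro k hk
      obtain ⟨c1, c2, c3, c4⟩ := hs (K - k) (by omega)
      refine ⟨by positivity, ?_⟩
      exact_mod_cast (by omega : s (K - k) - lo ≤ hi - lo)
    · obtain ⟨c1, c2, c3, c4⟩ := hs (K - 0) (by omega)
      have : 2 * (s (K - 0) - lo) ≤ hi - lo := by
        by_contra hcon
        have h1 := c3 (lo + (hi - lo) / 2) (by omega) (by omega)
        rw [← hmed] at h1
        simp at h1
        linarith
      have : 2 * ((s (K - 0) - lo : ℕ) : ℝ) ≤ ((hi - lo : ℕ) : ℝ) := by exact_mod_cast this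
      linarith
    · intro k hk
      obtain ⟨c1, c2, c3, c4⟩ := hs (K - k) (by omega)
      obtain ⟨b1, b2, b3, b4⟩ := he (K - (k + 2)) (by omega)
      have : e (K - (k + 2)) ≤ s (K - k) := by
        by_contra hcon
        push Not at hcon
        have h1 := b3 (s (K - k)) c1 hcon
        have h2 := c4 (s (K - k)) le_rfl (by omega)
        rw [Nat.cast_sub (by omega)] at h1 h2
        push_cast at h1 h2
        push Not at h1
        linarith
      exact_mod_cast (by omega : e (K - (k + 2)) - lo ≤ s (K - k) - lo)
    · intro k hk
      obtain ⟨c1, c2, c3, c4⟩ := hs (K - k) (by omega)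
      have h1 := hes (K - k) (by omega)
      have h2 : (((hi - lo : ℕ) : ℝ) - ((s (K - k) - lo : ℕ) : ℝ)) = ((hi - s (K - k) : ℕ) : ℝ) := by
        rw [sub_eq_iff_eq_add]; norm_cast; omega
      rw [h2]; linarith
  linarith

end

noncomputable section
open RAM

/-! ### One-dimensional partitioning -/

/-- The pair `(e, s)` is a valid split of `[lo, hi)`: both parts are nonempty, the parts overlap
in an interval of length `2 ρ`, and the potential decreases. -/
def ValidSplit (y : ℕ → ℝ) (β ρ : ℝ) (lo hi e s : ℕ) : Prop :=
  lo < e ∧ e < hi ∧ lo < s ∧ s < hi ∧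
    ((e - lo : ℕ) : ℝ) ^ (1 + β) + ((hi - s : ℕ) : ℝ) ^ (1 + β) ≤ ((hi - lo : ℕ) : ℝ) ^ (1 + β) ∧
    ∃ τ : ℝ, (∀ i, lo ≤ i → i < hi → y i ≤ τ + ρ → i < e) ∧
      ∀ i, lo ≤ i → i < hi → τ - ρ ≤ y i → s ≤ i

/-- The strict decrease of the potential excludes trivial splits, since a part equal to the whole
interval already has the full potential. If the search fails, the cuts at each threshold are
recorded together with the violated inequality, which is the input of `spread_le_of_no_split`. -/
theorem Sat.findSplit {Y : Array ℝ} {β ρ med : ℝ} {kmax lo hi κ : ℕ} (hlo : lo < hi)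
    (hκ : hi - lo < 2 ^ κ) (hβ : 0 ≤ β) (hρ : 0 ≤ ρ)
    (hY : ∀ i j, lo ≤ i → i ≤ j → j < hi → Y.getD i 0 ≤ Y.getD j 0) (l : List ℕ) :
    (findSplit Y β ρ med kmax lo hi l).Sat (l.length * (12 * κ + 25)) (fun o => match o with
      | some (e, s) => ValidSplit (fun i => Y.getD i 0) β ρ lo hi e s
      | none => ∀ i ∈ l, ∃ e s : ℕ,
          IsCut (fun i => Y.getD i 0) lo hi (fun x => med + 2 * ((i : ℝ) - kmax) * ρ + ρ < x) e ∧
          IsCut (fun i => Y.getD i 0) lo hi (fun x => med + 2 * ((i : ℝ) - kmax) * ρ - ρ ≤ x) s ∧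
          ((hi - lo : ℕ) : ℝ) ^ (1 + β) ≤
            ((e - lo : ℕ) : ℝ) ^ (1 + β) + ((hi - s : ℕ) : ℝ) ^ (1 + β)) := by
  induction l with
  | nil => exact Sat.ret (by simp) (by simp)
  | cons i l ih =>
    simp only [_root_.findSplit, castN, addR, subR, mulR, sat_op_bind]
    refine Sat.bind (Sat.binSearch (p := fun x => med + 2 * ((i : ℝ) - kmax) * ρ + ρ < x)
      (fun y => Sat.op le_rfl (by simp)) κ _ lo hi le_rfl hlo.le hκ
      fun i j h1 h2 h3 h => h.trans_le (hY i j h1 h2 h3)) (fun e he => ?_)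
      (t₂ := l.length * (12 * κ + 25) + 6 * κ + 16)
      (by simp only [List.length_cons]; push_cast; linarith)
    refine Sat.bind (Sat.binSearch (p := fun x => med + 2 * ((i : ℝ) - kmax) * ρ - ρ ≤ x)
      (fun y => Sat.op le_rfl (by simp)) κ _ lo hi le_rfl hlo.le hκ
      fun i j h1 h2 h3 h => h.trans (hY i j h1 h2 h3)) (fun s hs => ?_)
      (t₂ := l.length * (12 * κ + 25) + 15) (by linarith)
    simp only [subN, powR, ltR, sat_op_bind, decide_eq_true_eq]
    have hl : (0 : ℝ) ≤ l.length * (12 * κ + 25) := by positivity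
    split_ifs with hok
    · refine Sat.op (by linarith) ?_
      obtain ⟨e1, e2, e3, e4⟩ := he
      obtain ⟨s1, s2, s3, s4⟩ := hs
      have hse : lo < s → s < hi → lo < e := fun h h' => by
        by_contra hcon
        have := s3 lo le_rfl h
        have := e4 lo (by omega) (by omega)
        linarith
      have hes : e < hi → s < hi := fun h => by
        by_contra hcon
        have := e4 e le_rfl h
        have := s3 e (by omega) (by omega)
        linarith
      have h1β : 0 ≤ 1 + β := by linarith
      have hehi : e < hi := by
        by_contra hcon
        obtain rfl : e = hi := by omega
        have : (0:ℝ) ≤ ((e - s : ℕ) : ℝ) ^ (1 + β) := by positivity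
        linarith
      have hlos : lo < s := by
        by_contra hcon
        obtain rfl : s = lo := by omega
        have : (0:ℝ) ≤ ((e - s : ℕ) : ℝ) ^ (1 + β) := by positivity
        linarith
      refine ⟨hse hlos (hes hehi), hehi, hlos, hes hehi, hok.le,
        med + 2 * ((i : ℝ) - kmax) * ρ, fun k h1 h2 h3 => ?_, fun k h1 h2 h3 => ?_⟩
      · by_contra hcon
        have := e4 k (by omega) h2
        linarith
      · by_contra hcon
        exact s3 k h1 (by omega) h3
    · refine ih.mono (by linarith) ?_
      rintro (_ | ⟨e', s'⟩) h
      · intro k hk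
        rcases List.mem_cons.1 hk with rfl | hk
        · exact ⟨e, s, he, hs, not_lt.1 hok⟩
        · exact h k hk
      · exact h

/-- Number of thresholds on each side of the median. -/
def numSplits (c : MultifilterConsts) (α β Δ : ℝ) : ℕ :=
  ⌈c.split * Real.log (Real.log (1 / (α * Δ))) / β⌉₊

/-- The conditions on the parameters under which sets of at most `N` points lose nothing when
clustered, and are split unless they are short. -/
structure Tight (c : MultifilterConsts) (α β Δ : ℝ) (N : ℕ) : Prop where
  nonneg : 0 ≤ α * Δ
  trim : α * Δ * N < 2
  pos : 1 ≤ numSplits c α β Δ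
  lt : (N : ℝ) < 2 ^ ((1 + β) ^ ((numSplits c α β Δ - 1) / 2))

/-- The cost bound has to hold for every cluster, even a tiny one whose rescaled `α` is large. The
statement that nothing is lost is therefore conditional on `Tight`. Under `Tight` no value is
trimmed, and the fallback for a failed search is unreachable because the failure would make the
interval short. -/
theorem Sat.gaussianSplitOrCluster {c : MultifilterConsts} {Y : Array ℝ} {nv α β R Δ kb : ℝ}
    {lo hi κ N : ℕ} (hlo : lo < hi) (hN : hi - lo ≤ N)
    (hκ : hi - lo < 2 ^ κ) (hβ : 0 ≤ β) (hR : 0 < R) (hnv : 0 ≤ nv)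
    (hkb : (numSplits c α β Δ : ℝ) ≤ kb)
    (hY : ∀ i j, lo ≤ i → i ≤ j → j < hi → Y.getD i 0 ≤ Y.getD j 0)
    (hY0 : nv = 0 → ∀ i, lo ≤ i → i < hi → Y.getD i 0 = 0) :
    (gaussianSplitOrCluster c Y nv α β R Δ lo hi).Sat ((2 * kb + 1) * (12 * κ + 25) + 30)
      (fun o => match o with
        | Sum.inl (a, b) => lo ≤ a ∧ b ≤ hi ∧
            (Tight c α β Δ N → a = lo ∧ b = hi ∧ Y.getD (hi - 1) 0 - Y.getD lo 0 ≤ R * nv)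
        | Sum.inr ((a, b), (a', b')) => a = lo ∧ b' = hi ∧
            ValidSplit (fun i => Y.getD i 0) β (R / (4 * numSplits c α β Δ) * nv) lo hi b a') := by
  have hkb0 : 0 ≤ kb := (Nat.cast_nonneg _).trans hkb
  have hcost : 0 ≤ (2 * kb + 1) * (12 * κ + 25) := by positivity
  have hq : Tight c α β Δ N → ⌊α * Δ * ((hi - lo : ℕ) : ℝ) / 2⌋₊ = 0 := fun h => by
    rw [Nat.floor_eq_zero]
    have : ((hi - lo : ℕ) : ℝ) ≤ N := by exact_mod_cast hN
    nlinarith [h.trim, h.nonneg]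
  simp only [_root_.gaussianSplitOrCluster, subN, castN, mulR, divR, floorR, addN, ltN, sat_op_bind,
    decide_eq_true_eq]
  generalize hqq : ⌊α * Δ * ((hi - lo : ℕ) : ℝ) / 2⌋₊ = q at *
  split_ifs with hab
  · simp only [RAM.get, subR, leR, sat_op_bind, decide_eq_true_eq]
    split_ifs with hshort
    · refine Sat.pure (by linarith) ⟨by omega, by omega, fun h => ?_⟩
      have hq0 := hq h
      subst hq0
      exact ⟨by omega, by omega, by simpa using hshort⟩
    · simp only [logR, ceilR, halfN, sat_op_bind]
      refine Sat.bind (Sat.findSplit hlo hκ hβ (by positivity) hY _)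
        (t₂ := 0) ?_ ?_
      · rintro (_ | ⟨e, s⟩) ho
        · refine Sat.pure le_rfl ⟨by omega, by omega, fun h => ?_⟩
          have hq0 := hq h
          subst hq0
          refine ⟨by omega, by omega, ?_⟩
          exfalso
          -- In the direction zero all values vanish, so the interval has already passed the test
          -- for being short.
          have hnv' : 0 < nv := by
            refine lt_of_le_of_ne hnv fun h0 => hshort ?_
            rw [hY0 h0.symm _ (by omega) (by omega), hY0 h0.symm _ (by omega) (by omega), ← h0]
            simp
          have hk : (0 : ℝ) < numSplits c α β Δ := by exact_mod_cast h.pos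
          have := spread_le_of_no_split (y := fun i => Y.getD i 0) (K := numSplits c α β Δ)
            (ρ := R / (4 * numSplits c α β Δ) * nv) hlo hβ
            (by positivity) h.pos
            (lt_of_le_of_lt (by exact_mod_cast hN) h.lt)
            (fun i hi => ho i (by
              rw [List.mem_range]
              change i < numSplits c α β Δ + numSplits c α β Δ + 1
              omega))
          refine hshort ?_
          have e2 : 4 * (numSplits c α β Δ : ℝ) * (R / (4 * numSplits c α β Δ) * nv) = R * nv := by
            field_simp
          rw [e2] at this
          simpa using this
        · exact Sat.pure le_rfl ⟨rfl, rfl, ho⟩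
      · rw [List.length_range]
        have : (((numSplits c α β Δ + numSplits c α β Δ + 1 : ℕ) : ℝ)) * (12 * κ + 25)
            ≤ (2 * kb + 1) * (12 * κ + 25) := by
          refine mul_le_mul_of_nonneg_right ?_ (by positivity)
          push_cast; linarith
        unfold numSplits at this
        linarith
  · refine Sat.pure (by linarith) ⟨by omega, by omega, fun h => ?_⟩
    have hq0 := hq h
    subst hq0
    omega

end

noncomputable section
open RAM

/-- The recursion tree is binary, and each leaf has potential at least one. With `P` the potential
of the current interval, the bound `W (2 P - 1)` covers the cost `W` of a leaf. It is also inherited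
at a split, as `W + W (2 P₁ - 1) + W (2 P₂ - 1) = W (2 (P₁ + P₂) - 1)` and `P₁ + P₂ ≤ P`.

Values close to `ν` are never separated: at a split around `τ` they all lie in the left part if `ν ≤
τ` and in the right part if `ν ≥ τ`. Following these choices leads to one cluster containing them
all. -/
theorem Sat.splitLoop {c : MultifilterConsts} {Y : Array ℝ} {nv α β R Δ kb W : ℝ} {κ N M : ℕ}
    (hM : M ≤ N) (hκ : M < 2 ^ κ) (hβ : 0 ≤ β) (hR : 0 < R) (hnv : 0 ≤ nv)
    (hkb : (numSplits c α β Δ : ℝ) ≤ kb) (hW : (2 * kb + 1) * (12 * κ + 25) + 32 ≤ W)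
    (hY : ∀ i j, i ≤ j → j < M → Y.getD i 0 ≤ Y.getD j 0)
    (hY0 : nv = 0 → ∀ i, i < M → Y.getD i 0 = 0) (f lo hi : ℕ) (acc : List (ℕ × ℕ))
    (hlo : lo < hi) (hhi : hi ≤ M) (hf : hi - lo ≤ f) :
    (splitLoop c Y nv α β R Δ f lo hi acc).Sat (W * (2 * ((hi - lo : ℕ) : ℝ) ^ (1 + β) - 1))
      (fun r => ∃ out, r = out ++ acc ∧
        (∀ ab ∈ out, lo ≤ ab.1 ∧ ab.1 < ab.2 ∧ ab.2 ≤ hi) ∧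
        (out.map fun ab => ((ab.2 - ab.1 : ℕ) : ℝ) ^ (1 + β)).sum
          ≤ ((hi - lo : ℕ) : ℝ) ^ (1 + β) ∧
        (Tight c α β Δ N → (∀ ab ∈ out, Y.getD (ab.2 - 1) 0 - Y.getD ab.1 0 ≤ R * nv) ∧
          ∀ ν, ∃ ab ∈ out, ∀ i, lo ≤ i → i < hi →
            |Y.getD i 0 - ν| ≤ R / (4 * numSplits c α β Δ) * nv → ab.1 ≤ i ∧ i < ab.2)) := by
  have hkb0 : 0 ≤ kb := (Nat.cast_nonneg _).trans hkb
  have hW32 : 32 ≤ W := le_trans (by have : 0 ≤ (2 * kb + 1) * (12 * κ + 25) := by positivity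
                                     linarith) hW
  induction f generalizing lo hi acc with
  | zero => omega
  | succ f ih =>
    rw [_root_.splitLoop]
    have hm1 : (1 : ℝ) ≤ ((hi - lo : ℕ) : ℝ) := by exact_mod_cast (by omega : 1 ≤ hi - lo)
    have hP1 : 1 ≤ ((hi - lo : ℕ) : ℝ) ^ (1 + β) := Real.one_le_rpow hm1 (by linarith)
    refine Sat.bind (Sat.gaussianSplitOrCluster (N := N) (κ := κ) hlo (by omega) (by omega) hβ hR
      hnv hkb (fun i j _ h2 h3 => hY i j h2 (by omega)) (fun h i _ h2 => hY0 h i (by omega)))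
      (t₂ := 2 + W * (2 * ((hi - lo : ℕ) : ℝ) ^ (1 + β) - 2)) ?_ (by linarith)
    rintro (⟨a, b⟩ | ⟨⟨a, b⟩, a', b'⟩) ho
    · obtain ⟨h1, h2, h3⟩ := ho
      have hc : 0 ≤ W * (2 * ((hi - lo : ℕ) : ℝ) ^ (1 + β) - 2) :=
        mul_nonneg (by linarith) (by linarith)
      simp only [ltN, sat_op_bind, decide_eq_true_eq]
      split_ifs with hab
      · refine Sat.op (by linarith) ⟨[(a, b)], by simp, by simpa using ⟨h1, hab, h2⟩, ?_, ?_⟩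
        · simp only [List.map_cons, List.map_nil, List.sum_cons, List.sum_nil, add_zero]
          exact Real.rpow_le_rpow (by positivity)
            (by exact_mod_cast (by omega : b - a ≤ hi - lo)) (by linarith)
        · intro ht
          obtain ⟨rfl, rfl, h4⟩ := h3 ht
          exact ⟨by simpa using h4, fun ν => ⟨(a, b), by simp, fun i hi1 hi2 _ => ⟨hi1, hi2⟩⟩⟩
      · refine Sat.pure (by linarith) ⟨[], by simp, by simp, by simp; positivity, fun ht => ?_⟩
        obtain ⟨rfl, rfl, h4⟩ := h3 ht
        exact absurd hlo hab
    · obtain ⟨rfl, rfl, h1, h2, h3, h4, h5, τ, h6, h7⟩ := ho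
      refine Sat.bind (ih a b acc h1 (by omega) (by omega)) (fun acc' hacc' => ?_)
        (t₂ := W * (2 * ((b' - a' : ℕ) : ℝ) ^ (1 + β) - 1)) (by nlinarith)
      refine (ih a' b' acc' h4 hhi (by omega)).mono le_rfl ?_
      rintro r ⟨out', rfl, g1, g2, g3⟩
      obtain ⟨out, rfl, k1, k2, k3⟩ := hacc'
      refine ⟨out' ++ out, by simp, ?_, ?_, fun ht => ⟨?_, fun ν => ?_⟩⟩
      · intro ab hab
        rcases List.mem_append.1 hab with hab | hab
        · have := g1 ab hab
          omega
        · have := k1 ab hab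
          omega
      · rw [List.map_append, List.sum_append]; linarith
      · intro ab hab
        rcases List.mem_append.1 hab with hab | hab
        · exact (g3 ht).1 ab hab
        · exact (k3 ht).1 ab hab
      · rcases le_total ν τ with hν | hν
        · obtain ⟨ab, hab, h⟩ := (k3 ht).2 ν
          refine ⟨ab, by simp [hab], fun i hi1 hi2 hi3 => h i hi1 (h6 i hi1 hi2 ?_) hi3⟩
          have := (abs_le.1 hi3).2
          simp only
          linarith
        · obtain ⟨ab, hab, h⟩ := (g3 ht).2 ν
          refine ⟨ab, by simp [hab], fun i hi1 hi2 hi3 => h i (h7 i hi1 hi2 ?_) hi2 hi3⟩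
          have := (abs_le.1 hi3).1
          simp only
          linarith

/-- The potential `∑ |T| ^ (1 + β)` of a list of sets. -/
def potential {ι : Type} (β : ℝ) (L : List (List ι)) : ℝ :=
  (L.map fun T => (T.length : ℝ) ^ (1 + β)).sum

theorem forall₂_eq_map {ι γ : Type} {g : ι → γ} {l : List ι} {bs : List γ}
    (h : List.Forall₂ (fun i b => b = g i) l bs) : bs = l.map g := by
  induction h with
  | nil => rfl
  | cons h _ ih => simp [h, ih]

/-- The properties of intervals of positions are carried over to sets of indices along the sorting
permutation. All costs linear in `|T|` are absorbed by `|T| ≤ |T| ^ (1 + β)`. -/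
theorem Sat.gaussian1DPartition {n d κ N : ℕ} {c : MultifilterConsts} {X : Fin n → Fin d → ℝ}
    {T : List (Fin n)} {α β C R kb W : ℝ} {v : Fin d → ℝ} (hT : T ≠ []) (hTN : T.length ≤ N)
    (hκ : T.length < 2 ^ κ) (hβ : 0 ≤ β) (hR : 0 < R)
    (hkb : (numSplits c α β (1 / (C * N)) : ℝ) ≤ kb)
    (hW : (2 * kb + 1) * (12 * κ + 25) + 32 ≤ W) :
    (gaussian1DPartition c X N T α v β C R).Sat
      ((T.length : ℝ) ^ (1 + β) * (10 * d + 4 * κ + 2 * W + 12)) (fun Ts =>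
        (∀ T' ∈ Ts, T' ≠ [] ∧ T'.Subperm T) ∧
        potential β Ts ≤ (T.length : ℝ) ^ (1 + β) ∧
        (Tight c α β (1 / (C * N)) N →
          (∀ T' ∈ Ts, ∀ i ∈ T', ∀ j ∈ T', v ⬝ᵥ X i - v ⬝ᵥ X j ≤ R * √(v ⬝ᵥ v)) ∧
          ∀ ν, ∃ T' ∈ Ts, ∀ i ∈ T,
            |v ⬝ᵥ X i - ν| ≤ R / (4 * numSplits c α β (1 / (C * N))) * √(v ⬝ᵥ v) → i ∈ T')) := by
  unfold _root_.gaussian1DPartition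
  have hm : 1 ≤ T.length := List.length_pos_iff.2 hT
  have hm1 : (1 : ℝ) ≤ (T.length : ℝ) := by exact_mod_cast hm
  set P := (T.length : ℝ) ^ (1 + β) with hP
  have hmP : (T.length : ℝ) ≤ P := by
    conv_lhs => rw [← Real.rpow_one (T.length : ℝ)]
    exact Real.rpow_le_rpow_of_exponent_le hm1 (by linarith)
  have hkb0 : 0 ≤ kb := (Nat.cast_nonneg _).trans hkb
  have hW32 : 32 ≤ W := le_trans (by have : 0 ≤ (2 * kb + 1) * (12 * κ + 25) := by positivity
                                     linarith) hW
  refine Sat.bind (Sat.collect (w := fun _ => 5 * d) (Q := fun i y => y = (v ⬝ᵥ X i, i)) T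
    fun i _ => Sat.bind (Sat.dot v (X i)) (t₂ := 0) (by rintro _ rfl; exact Sat.pure le_rfl rfl)
      (by simp)) (fun ys hys => ?_) (t₂ := T.length * (4 * κ + 5) + 5 * d + 4 + 2 * W * P + 2 * P) ?_
  swap
  · simp only [List.map_const', List.sum_replicate, nsmul_eq_mul]
    have hd : (0 : ℝ) ≤ d := by positivity
    have hk : (0 : ℝ) ≤ κ := by positivity
    nlinarith [mul_le_mul_of_nonneg_right hmP hd, mul_le_mul_of_nonneg_right hmP hk,
      mul_le_mul_of_nonneg_right hm1 hd]
  obtain rfl := forall₂_eq_map hys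
  refine Sat.bind (Sat.mergeSort κ _ (by simpa using hm) (by simpa using hκ.le))
    (fun sorted hs => ?_) (t₂ := T.length * 4 + 5 * d + 4 + 2 * W * P + 2 * P)
    (by simp only [List.length_map]; linarith)
  obtain ⟨hperm, hsort⟩ := hs
  have hlen : sorted.length = T.length := by simpa using hperm.length_eq
  have hmem : ∀ x ∈ sorted, x.1 = v ⬝ᵥ X x.2 := fun x hx => by
    obtain ⟨i, _, rfl⟩ := List.mem_map.1 (hperm.mem_iff.1 hx); rfl
  have hpermI : (sorted.map Prod.snd).Perm T := by
    simpa [Function.comp_def] using hperm.map Prod.snd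
  refine Sat.bind (Sat.toArr _) (t₂ := T.length * 3 + 5 * d + 4 + 2 * W * P + 2 * P) ?_
    (by simp only [List.length_map, hlen]; linarith)
  rintro _ rfl
  refine Sat.bind (Sat.toArr _) (t₂ := T.length * 2 + 5 * d + 4 + 2 * W * P + 2 * P) ?_
    (by simp only [List.length_map, hlen]; linarith)
  rintro _ rfl
  refine Sat.bind (Sat.len _) (t₂ := T.length * 2 + 3 + 2 * W * P + 2 * P) ?_ (by linarith)
  rintro _ rfl
  simp only [castN, mulR, divR, sat_op_bind]
  refine Sat.bind (Sat.size _) (t₂ := 2 * W * P + 2 * P) ?_ (by linarith)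
  rintro _ rfl
  have hget : ∀ i (hi : i < T.length),
      (sorted.map Prod.fst).toArray.getD i 0 = v ⬝ᵥ X (sorted[i]'(by omega)).2 := fun i hi => by
    rw [← hmem _ (List.getElem_mem _)]
    simp [Array.getD, hlen, hi]
  refine Sat.bind (Sat.splitLoop (N := N) (M := T.length) (kb := kb) (W := W) hTN hκ hβ hR
    (Real.sqrt_nonneg _) hkb hW ?_ ?_ T.length 0 T.length [] hm le_rfl (by simp))
    (fun ivs hivs => ?_) (t₂ := 2 * P) (by simp only [Nat.sub_zero]; nlinarith)
  · intro i j hij hj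
    rw [hget i (by omega), hget j hj, ← hmem _ (List.getElem_mem _), ← hmem _ (List.getElem_mem _)]
    rcases hij.eq_or_lt with rfl | hij
    · exact le_rfl
    · exact List.pairwise_iff_getElem.1 hsort i j (by omega) (by omega) hij
  · intro h0 i hi
    have hv : v = 0 := by
      rw [Real.sqrt_eq_zero (by simpa using dotProduct_star_self_nonneg v)] at h0
      exact dotProduct_self_eq_zero.1 h0
    rw [hget i hi, hv]; simp
  · obtain ⟨out, rfl, h1, h2, h3⟩ := hivs
    rw [List.append_nil]
    simp only [Nat.sub_zero] at h2
    refine (Sat.collect (w := fun ab : ℕ × ℕ => ((ab.2 - ab.1 : ℕ) : ℝ))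
      (Q := fun ab T' => T' = ((sorted.map Prod.snd).toArray.extract ab.1 ab.2).toList)
      out fun ab _ => Sat.bind (Sat.charge _) (t₂ := 0) (fun _ _ => Sat.pure le_rfl rfl)
        (by simp)).mono ?_ ?_
    · refine (List.sum_le_sum (g := fun ab => 2 * ((ab.2 - ab.1 : ℕ) : ℝ) ^ (1 + β)) ?_).trans ?_
      · intro ab hab
        have := h1 ab hab
        have h1' : (1 : ℝ) ≤ ((ab.2 - ab.1 : ℕ) : ℝ) := by
          exact_mod_cast (by omega : 1 ≤ ab.2 - ab.1)
        have : ((ab.2 - ab.1 : ℕ) : ℝ) ≤ ((ab.2 - ab.1 : ℕ) : ℝ) ^ (1 + β) := by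
          conv_lhs => rw [← Real.rpow_one ((ab.2 - ab.1 : ℕ) : ℝ)]
          exact Real.rpow_le_rpow_of_exponent_le h1' (by linarith)
        linarith
      · rw [List.sum_map_mul_left]; linarith
    · intro Ts hTs
      obtain rfl := forall₂_eq_map hTs
      have hex : ∀ ab : ℕ × ℕ, ((sorted.map Prod.snd).toArray.extract ab.1 ab.2).toList
          = ((sorted.map Prod.snd).drop ab.1).take (ab.2 - ab.1) := fun ab => by
        simp [List.extract_eq_take_drop]
      simp only [hex]
      have hmemT : ∀ ab ∈ out, ∀ i, (i ∈ ((sorted.map Prod.snd).drop ab.1).take (ab.2 - ab.1) ↔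
          ∃ k, ∃ hk : k < sorted.length, ab.1 ≤ k ∧ k < ab.2 ∧ sorted[k].2 = i) := by
        intro ab hab i
        have hab' := h1 ab hab
        rw [List.mem_iff_getElem]
        constructor
        · rintro ⟨k, hk, rfl⟩
          simp only [List.length_take, List.length_drop, List.length_map] at hk
          exact ⟨ab.1 + k, by omega, by omega, by omega, by simp⟩
        · rintro ⟨k, hk, hk1, hk2, rfl⟩
          refine ⟨k - ab.1, ?_, ?_⟩
          · simp only [List.length_take, List.length_drop, List.length_map]; omega
          · simp only [List.getElem_take, List.getElem_drop, List.getElem_map]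
            congr 2; omega
      have hlenT : ∀ ab ∈ out, (((sorted.map Prod.snd).drop ab.1).take (ab.2 - ab.1)).length
          = ab.2 - ab.1 := by
        intro ab hab
        have hab' := h1 ab hab
        simp only [List.length_take, List.length_drop, List.length_map]; omega
      refine ⟨?_, ?_, fun ht => ⟨?_, fun ν => ?_⟩⟩
      · intro T' hT'
        obtain ⟨ab, hab, rfl⟩ := List.mem_map.1 hT'
        refine ⟨fun h => ?_, ?_⟩
        · have h4 := hlenT ab hab
          have := h1 ab hab
          rw [h] at h4
          simp at h4
          omega
        · exact ((List.take_sublist _ _).trans (List.drop_sublist _ _)).subperm.trans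
            hpermI.subperm
      · unfold potential
        rw [List.map_map]
        refine le_trans (le_of_eq ?_) h2
        congr 1
        refine List.map_congr_left fun ab hab => ?_
        simp only [Function.comp_apply, hlenT ab hab]
      · intro T' hT' i hi j hj
        obtain ⟨ab, hab, rfl⟩ := List.mem_map.1 hT'
        obtain ⟨k, hk, k1, k2, rfl⟩ := (hmemT ab hab i).1 hi
        obtain ⟨l, hl, l1, l2, rfl⟩ := (hmemT ab hab j).1 hj
        have hab' := h1 ab hab
        have := (h3 ht).1 ab hab
        rw [hget _ (by omega), hget _ (by omega)] at this
        refine le_trans ?_ this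
        have hmono : ∀ i j (hi : i < sorted.length) (hj : j < sorted.length), i ≤ j →
            v ⬝ᵥ X sorted[i].2 ≤ v ⬝ᵥ X sorted[j].2 := by
          intro i j hi hj hij
          rw [← hmem _ (List.getElem_mem _), ← hmem _ (List.getElem_mem _)]
          rcases hij.eq_or_lt with rfl | hij
          · exact le_rfl
          · exact List.pairwise_iff_getElem.1 hsort i j (by omega) (by omega) hij
        exact sub_le_sub (hmono _ _ _ _ (by omega)) (hmono _ _ _ _ (by omega))
      · obtain ⟨ab, hab, h⟩ := (h3 ht).2 ν
        refine ⟨_, List.mem_map.2 ⟨ab, hab, rfl⟩, fun i hi hν => ?_⟩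
        rw [hmemT ab hab]
        obtain ⟨x, hx, hxi⟩ := List.mem_map.1 (hpermI.mem_iff.2 hi)
        obtain ⟨k, hk, rfl⟩ := List.mem_iff_getElem.1 hx
        have := h k (by omega) (by omega) (by rw [hget k (by omega), hxi]; exact hν)
        exact ⟨k, hk, this.1, this.2, hxi⟩

end

noncomputable section
open Matrix

/-! ### Powers of positive semidefinite matrices -/

section Spectral

variable {d : ℕ}

/-- The eigenbasis in coordinates. The trace formula allows an arbitrary second factor `B`, because
powers of one covariance matrix are compared with another one that need not commute with it. -/
theorem Matrix.PosSemidef.exists_spectral {A : Matrix (Fin d) (Fin d) ℝ} (hA : A.PosSemidef) :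
    ∃ (a : Fin d → ℝ) (w : Fin d → Fin d → ℝ), (∀ j, 0 ≤ a j) ∧ (∀ j, w j ⬝ᵥ w j = 1) ∧
      (∀ j, w j ⬝ᵥ (A *ᵥ w j) = a j) ∧ (∀ x, ∑ j, (w j ⬝ᵥ x) ^ 2 = x ⬝ᵥ x) ∧
      (∀ (k : ℕ) x, x ⬝ᵥ (A ^ k *ᵥ x) = ∑ j, a j ^ k * (w j ⬝ᵥ x) ^ 2) ∧
      ∀ (k : ℕ) (B : Matrix (Fin d) (Fin d) ℝ),
        (A ^ k * B).trace = ∑ j, a j ^ k * (w j ⬝ᵥ (B *ᵥ w j)) := by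
  set U : Matrix (Fin d) (Fin d) ℝ := (hA.1.eigenvectorUnitary).1 with hU
  set a := hA.1.eigenvalues with ha
  have hUU : Uᵀ * U = 1 := by
    have := Unitary.coe_star_mul_self hA.1.eigenvectorUnitary
    simpa [star_eq_conjTranspose, conjTranspose_eq_transpose_of_trivial] using this
  have hUU' : U * Uᵀ = 1 := mul_eq_one_comm.1 hUU
  have hspec : A = U * diagonal a * Uᵀ := by
    have := hA.1.spectral_theorem
    rw [Unitary.conjStarAlgAut_apply] at this
    simpa [star_eq_conjTranspose, conjTranspose_eq_transpose_of_trivial, Function.comp_def] using this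
  have hpow : ∀ k : ℕ, A ^ k = U * diagonal (fun j => a j ^ k) * Uᵀ := by
    intro k
    induction k with
    | zero => simp [hUU']
    | succ k ih =>
      rw [pow_succ, ih]
      conv_lhs => rw [hspec]
      calc U * diagonal (fun j => a j ^ k) * Uᵀ * (U * diagonal a * Uᵀ)
          = U * diagonal (fun j => a j ^ k) * (Uᵀ * U) * diagonal a * Uᵀ := by noncomm_ring
        _ = _ := by
          rw [hUU, mul_one, mul_assoc U, diagonal_mul_diagonal]; simp [pow_succ]
  have hquad : ∀ (k : ℕ) x, x ⬝ᵥ (A ^ k *ᵥ x) = ∑ j, a j ^ k * (Uᵀ j ⬝ᵥ x) ^ 2 := by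
    intro k x
    rw [hpow, ← mulVec_mulVec, ← mulVec_mulVec, dotProduct_mulVec, ← mulVec_transpose]
    simp only [dotProduct, mulVec_diagonal]
    refine Finset.sum_congr rfl fun j _ => ?_
    change (Uᵀ j ⬝ᵥ x) * (a j ^ k * (Uᵀ j ⬝ᵥ x)) = _
    simp only [dotProduct]
    ring
  have hone : ∀ j, Uᵀ j ⬝ᵥ Uᵀ j = 1 := fun j => by
    have := congrFun (congrFun hUU j) j
    rw [mul_apply, one_apply_eq] at this
    exact this
  refine ⟨a, fun j => Uᵀ j, hA.eigenvalues_nonneg, hone, fun j => ?_, fun x => ?_, hquad, fun k B => ?_⟩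
  · have : A *ᵥ Uᵀ j = a j • Uᵀ j := hA.1.mulVec_eigenvectorBasis j
    rw [this, dotProduct_smul, hone, smul_eq_mul, mul_one]
  · simpa using (hquad 0 x).symm
  · rw [hpow, mul_assoc, trace_mul_comm, ← mul_assoc, trace_mul_comm, trace]
    refine Finset.sum_congr rfl fun j _ => ?_
    rw [diag_apply, diagonal_mul]
    congr 1
    rw [mul_assoc, mul_apply]
    refine Finset.sum_congr rfl fun l _ => ?_
    rfl

variable {A B : Matrix (Fin d) (Fin d) ℝ}

/-- Jensen's inequality for the `k`-th power: the squared coordinates of a unit vector in the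
eigenbasis are weights with sum one. -/
theorem Matrix.PosSemidef.pow_quadForm_le (hA : A.PosSemidef) (k : ℕ) {x : Fin d → ℝ}
    (hx : x ⬝ᵥ x = 1) : (x ⬝ᵥ (A *ᵥ x)) ^ k ≤ x ⬝ᵥ (A ^ k *ᵥ x) := by
  obtain ⟨a, w, ha, -, -, hw, hq, -⟩ := hA.exists_spectral
  have h1 := hq 1 x
  rw [pow_one] at h1
  rw [h1, hq]
  have := Real.pow_arith_mean_le_arith_mean_pow Finset.univ (fun j => (w j ⬝ᵥ x) ^ 2) a
    (fun j _ => sq_nonneg _) (by rw [hw, hx]) (fun j _ => ha j) k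
  simpa [mul_comm] using this

/-- If `B ⪯ A` then `tr B ^ (k + 1) ≤ tr (A ^ k B)`. -/
theorem Matrix.PosSemidef.trace_pow_succ_le (hA : A.PosSemidef) (hB : B.PosSemidef)
    (hBA : ∀ x, x ⬝ᵥ (B *ᵥ x) ≤ x ⬝ᵥ (A *ᵥ x)) (k : ℕ) :
    (B ^ (k + 1)).trace ≤ (A ^ k * B).trace := by
  obtain ⟨b, w, hb, hw1, hwB, hw, hq, ht⟩ := hB.exists_spectral
  have h1 := ht 1 (A ^ k)
  have h2 := ht (k + 1) 1
  rw [mul_one] at h2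
  rw [pow_one, trace_mul_comm] at h1
  rw [h1, h2]
  -- In the eigenbasis `w j` of `B` the right side is the sum of `b j * ⟨w j, A ^ k w j⟩`. By Jensen
  -- the second factor is at least `⟨w j, A w j⟩ ^ k`, hence at least `b j ^ k`. No operator
  -- monotonicity of powers is needed.
  refine Finset.sum_le_sum fun j _ => ?_
  rw [one_mulVec, hw1, mul_one, pow_one, pow_succ, mul_comm]
  refine mul_le_mul_of_nonneg_left ?_ (hb j)
  refine le_trans ?_ (hA.pow_quadForm_le k (hw1 j))
  refine pow_le_pow_left₀ (hb j) ?_ k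
  rw [← hwB]
  exact hBA _

/-- An eigenvalue above `t` gains at least a factor `t` when the exponent grows by one; each of the
others contributes at most `t ^ k`. -/
theorem Matrix.PosSemidef.trace_pow_le (hA : A.PosSemidef) (k : ℕ) {t : ℝ} (ht : 0 < t) :
    (A ^ k).trace ≤ (A ^ (k + 1)).trace / t + d * t ^ k := by
  obtain ⟨a, w, ha, hw1, hwA, hw, hq, htr⟩ := hA.exists_spectral
  have h1 := htr k 1
  have h2 := htr (k + 1) 1
  simp only [mul_one, one_mulVec, hw1] at h1 h2
  rw [h1, h2, Finset.sum_div]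
  have : (d : ℝ) * t ^ k = ∑ _j : Fin d, t ^ k := by simp
  rw [this, ← Finset.sum_add_distrib]
  refine Finset.sum_le_sum fun j _ => ?_
  have h3 : 0 ≤ a j ^ (k + 1) / t := div_nonneg (pow_nonneg (ha j) _) ht.le
  rcases le_total (a j) t with h | h
  · have := pow_le_pow_left₀ (ha j) h k
    linarith
  · have h4 : a j ^ k ≤ a j ^ (k + 1) / t := by
      rw [le_div_iff₀ ht, pow_succ]
      exact mul_le_mul_of_nonneg_left h (pow_nonneg (ha j) _)
    have := pow_nonneg ht.le k
    linarith

theorem Matrix.PosSemidef.pow_quadForm_le_trace (hA : A.PosSemidef) (k : ℕ) {x : Fin d → ℝ}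
    (hx : x ⬝ᵥ x = 1) : (x ⬝ᵥ (A *ᵥ x)) ^ k ≤ (A ^ k).trace := by
  refine (hA.pow_quadForm_le k hx).trans ?_
  obtain ⟨a, w, ha, hw1, hwA, hw, hq, htr⟩ := hA.exists_spectral
  have h1 := htr k 1
  simp only [mul_one, one_mulVec, hw1] at h1
  rw [h1, hq]
  refine Finset.sum_le_sum fun j _ => mul_le_of_le_one_right (pow_nonneg (ha j) _) ?_
  rw [← hx, ← hw x]
  exact Finset.single_le_sum (f := fun j => (w j ⬝ᵥ x) ^ 2) (fun j _ => sq_nonneg _)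
    (Finset.mem_univ j)

theorem Matrix.PosSemidef.trace_pow_nonneg (hA : A.PosSemidef) (k : ℕ) : 0 ≤ (A ^ k).trace := by
  obtain ⟨a, w, ha, hw1, hwA, hw, hq, htr⟩ := hA.exists_spectral
  have h1 := htr k 1
  simp only [mul_one, one_mulVec, hw1] at h1
  rw [h1]
  exact Finset.sum_nonneg fun j _ => pow_nonneg (ha j) _

theorem Matrix.PosSemidef.trace_pow_le_of_quadForm_le (hA : A.PosSemidef) {t : ℝ}
    (h : ∀ x, x ⬝ᵥ x = 1 → x ⬝ᵥ (A *ᵥ x) ≤ t) (k : ℕ) : (A ^ k).trace ≤ d * t ^ k := by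
  obtain ⟨a, w, ha, hw1, hwA, hw, hq, htr⟩ := hA.exists_spectral
  have h1 := htr k 1
  simp only [mul_one, one_mulVec, hw1] at h1
  rw [h1]
  refine (Finset.sum_le_sum fun j _ => pow_le_pow_left₀ (ha j) ?_ k).trans
    (b := ∑ _j : Fin d, t ^ k) (by simp)
  rw [← hwA]
  exact h _ (hw1 j)

end Spectral

/-! ### Empirical means and covariances -/

section Cov

variable {n d : ℕ} (X : Fin n → Fin d → ℝ)

/-- Empirical mean of the points with indices in `s`. -/
def setMean (s : Finset (Fin n)) : Fin d → ℝ := (s.card : ℝ)⁻¹ • ∑ i ∈ s, X i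

/-- Covariance matrix of the points with indices in `s`, with weights `1 / N`. -/
def setCov (N : ℕ) (s : Finset (Fin n)) : Matrix (Fin d) (Fin d) ℝ :=
  (N : ℝ)⁻¹ • ∑ i ∈ s, vecMulVec (X i - setMean X s) (X i - setMean X s)

theorem setCov_mulVec (N : ℕ) (s : Finset (Fin n)) (w : Fin d → ℝ) :
    setCov X N s *ᵥ w =
      (N : ℝ)⁻¹ • ∑ i ∈ s, ((X i - setMean X s) ⬝ᵥ w) • (X i - setMean X s) := by
  rw [setCov, smul_mulVec, sum_mulVec]
  simp only [vecMulVec_mulVec, op_smul_eq_smul]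

theorem quadForm_setCov (N : ℕ) (s : Finset (Fin n)) (w : Fin d → ℝ) :
    w ⬝ᵥ (setCov X N s *ᵥ w) = (N : ℝ)⁻¹ * ∑ i ∈ s, ((X i - setMean X s) ⬝ᵥ w) ^ 2 := by
  rw [setCov_mulVec, dotProduct_smul, dotProduct_sum, smul_eq_mul]
  congr 1
  refine Finset.sum_congr rfl fun i _ => ?_
  rw [dotProduct_smul, smul_eq_mul, dotProduct_comm w, sq]

theorem posSemidef_setCov (N : ℕ) (s : Finset (Fin n)) : (setCov X N s).PosSemidef := by
  refine PosSemidef.of_dotProduct_mulVec_nonneg ?_ fun x => ?_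
  · rw [IsHermitian, setCov, conjTranspose_eq_transpose_of_trivial, transpose_smul, transpose_sum]
    simp [transpose_vecMulVec]
  · rw [star_trivial, quadForm_setCov]
    exact mul_nonneg (by positivity) (Finset.sum_nonneg fun i _ => sq_nonneg _)

variable {X}

theorem sum_sub_setMean {s : Finset (Fin n)} (hs : s.Nonempty) :
    ∑ i ∈ s, (X i - setMean X s) = 0 := by
  have : (s.card : ℝ) ≠ 0 := by simpa using hs.card_pos.ne'
  rw [Finset.sum_sub_distrib, Finset.sum_const, setMean, ← Nat.cast_smul_eq_nsmul ℝ, smul_smul,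
    mul_inv_cancel₀ this, one_smul, sub_self]

theorem sum_sq_sub_setMean_le {s : Finset (Fin n)} (m w : Fin d → ℝ) :
    ∑ i ∈ s, ((X i - setMean X s) ⬝ᵥ w) ^ 2 ≤ ∑ i ∈ s, ((X i - m) ⬝ᵥ w) ^ 2 := by
  rcases s.eq_empty_or_nonempty with rfl | hs
  · simp
  set μ := setMean X s
  have h0 : ∑ i ∈ s, (X i - μ) ⬝ᵥ w = 0 := by
    rw [← sum_dotProduct, sum_sub_setMean hs, zero_dotProduct]
  have : ∑ i ∈ s, ((X i - m) ⬝ᵥ w) ^ 2 = ∑ i ∈ s, ((X i - μ) ⬝ᵥ w) ^ 2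
      + s.card * ((μ - m) ⬝ᵥ w) ^ 2 + 2 * ((μ - m) ⬝ᵥ w) * ∑ i ∈ s, (X i - μ) ⬝ᵥ w := by
    rw [Finset.mul_sum, ← nsmul_eq_mul, ← Finset.sum_const, ← Finset.sum_add_distrib,
      ← Finset.sum_add_distrib]
    refine Finset.sum_congr rfl fun i _ => ?_
    have : X i - m = (X i - μ) + (μ - m) := by abel
    rw [this, add_dotProduct]; ring
  rw [this, h0]
  have : 0 ≤ (s.card : ℝ) * ((μ - m) ⬝ᵥ w) ^ 2 := by positivity
  linarith

/-- The weights `1 / N` do not depend on the set, so removing points only removes squares, and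
recentring at the new mean decreases the sum further. With weights adapted to the subset this would
fail. -/
theorem quadForm_setCov_mono (N : ℕ) {s' s : Finset (Fin n)} (h : s' ⊆ s) (w : Fin d → ℝ) :
    w ⬝ᵥ (setCov X N s' *ᵥ w) ≤ w ⬝ᵥ (setCov X N s *ᵥ w) := by
  rw [quadForm_setCov, quadForm_setCov]
  refine mul_le_mul_of_nonneg_left ?_ (by positivity)
  exact (sum_sq_sub_setMean_le _ w).trans
    (Finset.sum_le_sum_of_subset_of_nonneg h fun i _ _ => sq_nonneg _)

/-- If a linear map moves the points of `s` to within distance `√ρ` of each other, it moves them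
to within `√ρ` of the image of their mean. -/
theorem dotProduct_self_mulVec_sub_setMean_le {s : Finset (Fin n)} {Q : Matrix (Fin d) (Fin d) ℝ}
    {ρ : ℝ} (h : ∀ i ∈ s, ∀ j ∈ s, (Q *ᵥ (X i - X j)) ⬝ᵥ (Q *ᵥ (X i - X j)) ≤ ρ) {i : Fin n}
    (hi : i ∈ s) :
    (Q *ᵥ (X i - setMean X s)) ⬝ᵥ (Q *ᵥ (X i - setMean X s)) ≤ ρ := by
  have hc : (0 : ℝ) < s.card := by exact_mod_cast Finset.card_pos.2 ⟨i, hi⟩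
  set y : Fin n → Fin d → ℝ := fun j => Q *ᵥ (X i - X j) with hy
  have h1 : Q *ᵥ (X i - setMean X s) = (s.card : ℝ)⁻¹ • ∑ j ∈ s, y j := by
    have : X i - setMean X s = (s.card : ℝ)⁻¹ • ∑ j ∈ s, (X i - X j) := by
      rw [Finset.sum_sub_distrib, Finset.sum_const, smul_sub, setMean, ← Nat.cast_smul_eq_nsmul ℝ,
        smul_smul, inv_mul_cancel₀ hc.ne', one_smul]
    rw [this, mulVec_smul, mulVec_sum]
  rw [h1, dotProduct]
  calc ∑ k, ((s.card : ℝ)⁻¹ • ∑ j ∈ s, y j) k * ((s.card : ℝ)⁻¹ • ∑ j ∈ s, y j) k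
      ≤ ∑ k, (s.card : ℝ)⁻¹ * ∑ j ∈ s, y j k ^ 2 := by
        refine Finset.sum_le_sum fun k _ => ?_
        have h3 : (∑ j ∈ s, y j k) ^ 2 ≤ s.card * ∑ j ∈ s, y j k ^ 2 := sq_sum_le_card_mul_sum_sq
        simp only [Pi.smul_apply, Finset.sum_apply, smul_eq_mul]
        calc (s.card : ℝ)⁻¹ * (∑ j ∈ s, y j k) * ((s.card : ℝ)⁻¹ * ∑ j ∈ s, y j k)
            = (s.card : ℝ)⁻¹ * ((s.card : ℝ)⁻¹ * (∑ j ∈ s, y j k) ^ 2) := by ring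
          _ ≤ _ := by
            refine mul_le_mul_of_nonneg_left ?_ (by positivity)
            rw [inv_mul_le_iff₀ hc]; exact h3
    _ = (s.card : ℝ)⁻¹ * ∑ j ∈ s, y j ⬝ᵥ y j := by
        rw [← Finset.mul_sum, Finset.sum_comm]
        simp only [dotProduct, sq]
    _ ≤ (s.card : ℝ)⁻¹ * ∑ j ∈ s, ρ := by
        refine mul_le_mul_of_nonneg_left (Finset.sum_le_sum fun j hj => h i hi j hj) (by positivity)
    _ = ρ := by rw [Finset.sum_const, nsmul_eq_mul, ← mul_assoc, inv_mul_cancel₀ hc.ne', one_mul]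

/-- If `M ^ q` moves the points of `s'` to within distance `√ρ` of each other, then
`tr M' ^ (2 q + 1) ≤ ρ` for the covariance matrix `M'` of `s'`. -/
theorem trace_setCov_pow_le {N q : ℕ} {s' s : Finset (Fin n)} (hs : s' ⊆ s) (hN : s'.card ≤ N)
    {ρ : ℝ} (hρ : 0 ≤ ρ)
    (h : ∀ i ∈ s', ∀ j ∈ s', (setCov X N s ^ q *ᵥ (X i - X j)) ⬝ᵥ
      (setCov X N s ^ q *ᵥ (X i - X j)) ≤ ρ) :
    (setCov X N s' ^ (2 * q + 1)).trace ≤ ρ := by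
  -- It remains to bound `tr (M ^ (2 q) M')`, which is the sum of `‖M ^ q (X i - μ')‖²` over `s'`
  -- divided by `N`. Each summand is at most `ρ`, and there are at most `N` of them.
  refine ((posSemidef_setCov X N s).trace_pow_succ_le (posSemidef_setCov X N s')
    (quadForm_setCov_mono N hs) (2 * q)).trans ?_
  set M := setCov X N s with hM
  have hsymm : (M ^ q)ᵀ = M ^ q := by
    have := (posSemidef_setCov X N s).1.pow q
    rwa [IsHermitian, conjTranspose_eq_transpose_of_trivial] at this
  have h1 : ∀ x : Fin d → ℝ, (M ^ (2 * q) * vecMulVec x x).trace = (M ^ q *ᵥ x) ⬝ᵥ (M ^ q *ᵥ x) := by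
    intro x
    rw [mul_vecMulVec, trace_vecMulVec, two_mul, pow_add, ← mulVec_mulVec, dotProduct_comm,
      dotProduct_mulVec, ← mulVec_transpose, hsymm]
  rw [setCov, Matrix.mul_smul, trace_smul, Finset.mul_sum, trace_sum, smul_eq_mul]
  rw [inv_mul_eq_div]
  rcases N.eq_zero_or_pos with rfl | hN0
  · simpa using hρ
  rw [div_le_iff₀ (by exact_mod_cast hN0)]
  refine (Finset.sum_le_sum (g := fun _ => ρ) fun i hi => ?_).trans ?_
  · rw [h1]
    exact dotProduct_self_mulVec_sub_setMean_le h hi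
  · rw [Finset.sum_const, nsmul_eq_mul, mul_comm]
    exact mul_le_mul_of_nonneg_left (by exact_mod_cast hN) hρ

end Cov

end

/-! ### Independent repetition, and loops that concatenate the results of their bodies. -/

noncomputable section
open Matrix RAM

namespace RAM

variable {β γ ι σ : Type}

theorem bind_assoc (c : RAM β) (f : β → RAM γ) (g : γ → RAM σ) :
    (c >>= f) >>= g = c >>= fun b => f b >>= g := by
  induction c with
  | ret b => rfl
  | step c ih => exact congrArg RAM.step ih
  | flip k ih => exact congrArg RAM.flip (funext fun b => ih b)

/-- Independent repetition: the probability that all the results miss `G`. -/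
theorem Whp.collect_exists {f : ι → RAM β} {G : β → Prop} {q : ℝ} (hq : 0 ≤ q) (l : List ι)
    (hf : ∀ i ∈ l, (f i).Whp q G) :
    (collect l f).Whp (q ^ l.length) (fun bs => ∃ b ∈ bs, G b) := by
  classical
  induction l with
  | nil => simp [Whp, RAM.collect, ev]
  | cons i l ih =>
    have ih := ih fun j hj => hf j (by simp [hj])
    change (f i >>= fun b => collect l f >>= fun bs => ret (b :: bs)).ev _ ≤ _
    rw [ev_bind]
    refine ((f i).ev_mono (h := fun b => q ^ l.length * if G b then 0 else 1) fun b => ?_).trans ?_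
    · rw [ev_bind]
      by_cases hb : G b
      · simp [ev, hb, ev_const]
      · rw [if_neg hb, mul_one]
        refine le_trans (ev_mono _ fun bs => ?_) ih
        by_cases h : ∃ x ∈ bs, G x
        · have h' : ∃ x ∈ b :: bs, G x := by simpa [hb] using h
          simp only [ev, if_pos h, if_pos h', le_refl]
        · have h' : ¬ ∃ x ∈ b :: bs, G x := by simpa [hb] using h
          simp only [ev, if_neg h, if_neg h', le_refl]
    · rw [ev_mul, List.length_cons, pow_succ]
      exact mul_le_mul_of_nonneg_left (hf i (by simp)) (by positivity)

theorem Whp.forall_mem {c : RAM β} {Q : ι → β → Prop} {δ : ℝ} (s : Finset ι)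
    (h : ∀ i ∈ s, c.Whp δ (Q i)) : c.Whp (s.card * δ) (fun b => ∀ i ∈ s, Q i b) := by
  classical
  unfold Whp at *
  refine (c.ev_mono (h := fun b => ∑ i ∈ s, if Q i b then 0 else 1) fun b => ?_).trans ?_
  · have hnn : ∀ i ∈ s, (0 : ℝ) ≤ if Q i b then 0 else 1 := fun i _ => by
      split_ifs <;> norm_num
    split_ifs with hall
    · exact Finset.sum_nonneg hnn
    · push Not at hall
      obtain ⟨i, hi, hQ⟩ := hall
      refine le_trans ?_ (Finset.single_le_sum hnn hi)
      simp [hQ]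
  · rw [ev_sum]
    refine (Finset.sum_le_sum h).trans ?_
    simp

/-- New results are put in front of the accumulator, so the outcome is known up to order only, which
suffices for membership and for potentials. The list `P` retains which results come from which item.
-/
theorem Sat.forEach_append {F : ι → RAM (List γ)} {w : ι → ℝ} {Q : ι → List γ → Prop}
    (L : List ι) (acc : List γ)
    (hF : ∀ T ∈ L, (F T).Sat (w T) (Q T)) (ℓ : ι → ℝ)
    (hℓ : ∀ T ∈ L, ∀ Ts, Q T Ts → (Ts.length : ℝ) ≤ ℓ T) :
    (RAM.forEach L acc fun acc T => do
      let Ts ← F T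
      RAM.append Ts acc).Sat (L.map fun T => w T + ℓ T + 1).sum
      (fun r => ∃ P, List.Forall₂ Q L P ∧ r.Perm (P.flatten ++ acc)) := by
  induction L generalizing acc with
  | nil => exact Sat.ret (by simp) ⟨[], .nil, by simp⟩
  | cons T L ih =>
    refine Sat.step (Sat.bind (t₁ := w T + ℓ T) (Sat.bind (hF T (by simp))
      (Q := fun r => ∃ Ts, Q T Ts ∧ r = Ts ++ acc) (fun Ts hTs =>
        (Sat.append Ts acc).mono (hℓ T (by simp) Ts hTs) fun r hr => ⟨Ts, hTs, hr⟩) le_rfl)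
      (fun acc' hacc' => ?_) (t₂ := (L.map fun T => w T + ℓ T + 1).sum) ?_)
    · obtain ⟨Ts, hTs, rfl⟩ := hacc'
      refine (ih (Ts ++ acc) (fun T hT => hF T (by simp [hT]))
        fun T hT => hℓ T (by simp [hT])).mono le_rfl ?_
      rintro r ⟨P, hP, hr⟩
      refine ⟨Ts :: P, .cons hTs hP, hr.trans ?_⟩
      rw [List.flatten_cons, ← List.append_assoc]
      exact List.Perm.append_right _ List.perm_append_comm
    · simp only [List.map_cons, List.sum_cons]; linarith

theorem All.forEach_append_mem {F : ι → RAM (List γ)} (L : List ι) (acc : List γ) {x : γ}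
    (hx : x ∈ acc) : (RAM.forEach L acc fun acc T => do
      let Ts ← F T
      RAM.append Ts acc).All (fun r => x ∈ r) := by
  induction L generalizing acc with
  | nil => exact hx
  | cons T L ih =>
    refine All.bind (c := F T >>= fun Ts => RAM.append Ts acc) (P := fun r => x ∈ r)
      ((all_true _).bind fun Ts _ => ?_) fun acc' h => ih acc' h
    refine (Sat.append Ts acc).2.mono ?_
    rintro _ rfl
    simp [hx]

/-- A single good item suffices: nothing is ever removed from the accumulator, so the other items
are harmless. The failure probability is therefore not multiplied by the number of sets in the list.
-/
theorem Whp.forEach_append_exists {F : ι → RAM (List γ)} {G : γ → Prop} {δ : ℝ} (hδ : 0 ≤ δ)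
    {T : ι} (hT : (F T).Whp δ (fun Ts => ∃ x ∈ Ts, G x)) (L : List ι) (acc : List γ)
    (hTL : T ∈ L) : (RAM.forEach L acc fun acc T => do
      let Ts ← F T
      RAM.append Ts acc).Whp δ (fun r => ∃ x ∈ r, G x) := by
  induction L generalizing acc with
  | nil => simp at hTL
  | cons T' L ih =>
    by_cases h : T = T'
    · subst h
      refine Whp.bind (c := F T >>= fun Ts => RAM.append Ts acc) (P := fun r => ∃ x ∈ r, G x)
        (hT.bind (δ₂ := 0) (fun Ts hTs => ?_) le_rfl (add_zero _).le) (δ₂ := 0)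
        (fun acc' h => ?_) le_rfl (add_zero _).le
      · refine All.whp ((Sat.append Ts acc).2.mono ?_)
        rintro _ rfl
        obtain ⟨x, hx, hG⟩ := hTs
        exact ⟨x, by simp [hx], hG⟩
      · obtain ⟨x, hx, hG⟩ := h
        exact ((All.forEach_append_mem L acc' hx).mono fun r hr => ⟨x, hr, hG⟩).whp
    · refine Whp.bind (c := F T' >>= fun Ts => RAM.append Ts acc) (all_true _).whp
        (fun acc' _ => ih acc' ?_) hδ (zero_add _).le
      simpa [h] using hTL

end RAM

/-! ### Random signs -/

section Signs

variable {d : ℕ}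

theorem update_dotProduct {v z : Fin d → ℝ} {j : Fin d} (hv : v j = 0) (x : ℝ) :
    Function.update v j x ⬝ᵥ z = v ⬝ᵥ z + x * z j := by
  have : Function.update v j x = v + Pi.single j x := by
    ext k
    by_cases h : k = j
    · subst h; simp [hv]
    · simp [h]
  rw [this, add_dotProduct, single_dotProduct]

theorem ev_sign_store (v : Fin d → ℝ) (j : Fin d) (g : (Fin d → ℝ) → ℝ) :
    (do let x ← sign; store v j x : RAM (Fin d → ℝ)).ev g
      = (g (Function.update v j 1) + g (Function.update v j (-1))) / 2 := rfl

theorem ev_signs_sq (z : Fin d → ℝ) (l : List (Fin d)) (hl : l.Nodup) (v : Fin d → ℝ)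
    (hv : ∀ j ∈ l, v j = 0) :
    (forEach l v fun v j => do let x ← sign; store v j x).ev (fun u => (u ⬝ᵥ z) ^ 2)
      = (v ⬝ᵥ z) ^ 2 + (l.map fun j => z j ^ 2).sum := by
  induction l generalizing v with
  | nil => simp [forEach, ev]
  | cons j l ih =>
    have hl' := List.nodup_cons.1 hl
    have hupd : ∀ x : ℝ, ∀ k ∈ l, Function.update v j x k = 0 := fun x k hk => by
      rw [Function.update_of_ne (by rintro rfl; exact hl'.1 hk)]
      exact hv k (by simp [hk])
    change ((do let x ← sign; store v j x : RAM (Fin d → ℝ)) >>= fun v' => forEach l v' _).ev _ = _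
    rw [ev_bind, ev_sign_store, ih hl'.2 _ (hupd _), ih hl'.2 _ (hupd _),
      update_dotProduct (hv j (by simp)), update_dotProduct (hv j (by simp))]
    simp only [List.map_cons, List.sum_cons]
    ring

/-- The bound is the fourth moment of a Gaussian with mean `⟨v, z⟩` and variance the remaining sum
of squares. Averaging over one more sign leaves a slack of `2 (z j) ^ 4`. -/
theorem ev_signs_pow_four_le (z : Fin d → ℝ) (l : List (Fin d)) (hl : l.Nodup) (v : Fin d → ℝ)
    (hv : ∀ j ∈ l, v j = 0) :
    (forEach l v fun v j => do let x ← sign; store v j x).ev (fun u => (u ⬝ᵥ z) ^ 4)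
      ≤ (v ⬝ᵥ z) ^ 4 + 6 * (v ⬝ᵥ z) ^ 2 * (l.map fun j => z j ^ 2).sum
        + 3 * (l.map fun j => z j ^ 2).sum ^ 2 := by
  induction l generalizing v with
  | nil => simp [forEach, ev]
  | cons j l ih =>
    have hl' := List.nodup_cons.1 hl
    have hupd : ∀ x : ℝ, ∀ k ∈ l, Function.update v j x k = 0 := fun x k hk => by
      rw [Function.update_of_ne (by rintro rfl; exact hl'.1 hk)]
      exact hv k (by simp [hk])
    change ((do let x ← sign; store v j x : RAM (Fin d → ℝ)) >>= fun v' => forEach l v' _).ev _ ≤ _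
    have h1 := ih hl'.2 _ (hupd 1)
    have h2 := ih hl'.2 _ (hupd (-1))
    rw [update_dotProduct (hv j (by simp))] at h1 h2
    rw [ev_bind, ev_sign_store]
    simp only [List.map_cons, List.sum_cons]
    nlinarith [sq_nonneg (z j ^ 2)]

theorem ev_tabulate_sign_sq (z : Fin d → ℝ) :
    (tabulate fun _ : Fin d => sign).ev (fun u => (u ⬝ᵥ z) ^ 2) = z ⬝ᵥ z := by
  have := ev_signs_sq z (List.finRange d) (List.nodup_finRange d) (fun _ => 0) (by simp)
  refine this.trans ?_
  rw [show (fun _ : Fin d => (0 : ℝ)) = 0 from rfl, zero_dotProduct, ← Fin.sum_univ_def]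
  simp [dotProduct, sq]

theorem ev_tabulate_sign_pow_four_le (z : Fin d → ℝ) :
    (tabulate fun _ : Fin d => sign).ev (fun u => (u ⬝ᵥ z) ^ 4) ≤ 3 * (z ⬝ᵥ z) ^ 2 := by
  have := ev_signs_pow_four_le z (List.finRange d) (List.nodup_finRange d) (fun _ => 0) (by simp)
  refine this.trans (le_of_eq ?_)
  rw [show (fun _ : Fin d => (0 : ℝ)) = 0 from rfl, zero_dotProduct, ← Fin.sum_univ_def]
  simp [dotProduct, sq]

/-- A random sign vector `u` satisfies both `⟨u, Q x⟩² ≥ ‖Q x‖² / 4` and `‖Q u‖² ≤ 16 τ`, for a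
symmetric matrix with `tr Q² ≤ τ`, with probability at least `1 / 8`. -/
theorem whp_tabulate_sign {Q : Matrix (Fin d) (Fin d) ℝ} (hQ : Qᵀ = Q) {τ : ℝ} (hτ : 0 < τ)
    (hQτ : (Q * Q).trace ≤ τ) (x : Fin d → ℝ) :
    (tabulate fun _ : Fin d => sign).Whp (7 / 8) (fun u =>
      (Q *ᵥ x) ⬝ᵥ (Q *ᵥ x) / 4 ≤ ((Q *ᵥ u) ⬝ᵥ x) ^ 2 ∧ (Q *ᵥ u) ⬝ᵥ (Q *ᵥ u) ≤ 16 * τ) := by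
  classical
  set z := Q *ᵥ x with hz
  have hux : ∀ u, (Q *ᵥ u) ⬝ᵥ x = u ⬝ᵥ z := fun u => by
    rw [hz, dotProduct_mulVec, ← mulVec_transpose, hQ]
  -- By the second moment of signs, applied to each row of `Q`, the expectation of `‖Q u‖²` equals
  -- `tr Q²`.
  have huu : (tabulate fun _ : Fin d => sign).ev (fun u => (Q *ᵥ u) ⬝ᵥ (Q *ᵥ u)) ≤ τ := by
    have h1 : ∀ u, (Q *ᵥ u) ⬝ᵥ (Q *ᵥ u) = ∑ k, (u ⬝ᵥ Q k) ^ 2 := fun u => by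
      simp only [dotProduct_comm u]
      simp only [dotProduct, mulVec, sq]
    simp only [h1]
    rw [ev_sum]
    simp only [ev_tabulate_sign_sq]
    refine le_trans (le_of_eq ?_) hQτ
    rw [trace]
    refine Finset.sum_congr rfl fun k _ => ?_
    rw [diag_apply, mul_apply, dotProduct]
    refine Finset.sum_congr rfl fun l _ => ?_
    rw [← congrFun (congrFun hQ l) k, transpose_apply]
  have hζ0 : 0 ≤ z ⬝ᵥ z := by simpa using dotProduct_star_self_nonneg z
  unfold Whp
  have hvv : ∀ u, 0 ≤ (Q *ᵥ u) ⬝ᵥ (Q *ᵥ u) := fun u => by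
    simpa using dotProduct_star_self_nonneg (Q *ᵥ u)
  -- If `Q x = 0`, the first condition is void and Markov's inequality for `‖Q u‖²` is enough.
  rcases hζ0.eq_or_lt with h0 | hζ
  · refine (ev_mono _ (h := fun u => 1 / (16 * τ) * ((Q *ᵥ u) ⬝ᵥ (Q *ᵥ u))) fun u => ?_).trans ?_
    · have h3 := hvv u
      rw [← h0, zero_div, one_div, inv_mul_eq_div]
      split_ifs with h
      · positivity
      · rw [le_div_iff₀ (by positivity)]
        by_contra hcon
        exact h ⟨sq_nonneg _, by linarith⟩
    · rw [ev_mul, one_div, inv_mul_eq_div, div_le_iff₀ (by positivity)]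
      linarith
  · set ζ := z ⬝ᵥ z with hζdef
    -- With `s = ⟨u, z⟩² / ζ`, the indicator of failure is at most `(s - 17/4)² / 16 + ‖Q u‖² / (16
    -- τ)`: the square is nonnegative and at least `1` for `s ≤ 1/4`. As `s` has mean `1` and second
    -- moment at most `3`, the expectation is at most `289/256 - 17/32 + 3/16 + 1/16 < 7/8`.
    refine (ev_mono _ (h := fun u => 289 / 256 + ((-17 / (32 * ζ)) * (u ⬝ᵥ z) ^ 2 +
      (1 / (16 * ζ ^ 2) * (u ⬝ᵥ z) ^ 4 + 1 / (16 * τ) * ((Q *ᵥ u) ⬝ᵥ (Q *ᵥ u))))) fun u => ?_).trans ?_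
    · have h3 := hvv u
      beta_reduce
      rw [hux]
      set s := (u ⬝ᵥ z) ^ 2 / ζ with hs
      have hs0 : 0 ≤ s := by positivity
      have e1 : 289 / 256 + ((-17 / (32 * ζ)) * (u ⬝ᵥ z) ^ 2 + (1 / (16 * ζ ^ 2) * (u ⬝ᵥ z) ^ 4 +
          1 / (16 * τ) * ((Q *ᵥ u) ⬝ᵥ (Q *ᵥ u))))
          = 1 - ((s - 1 / 4) / 2 - (s - 1 / 4) ^ 2 / 16) + ((Q *ᵥ u) ⬝ᵥ (Q *ᵥ u)) / (16 * τ) := by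
        rw [hs]; field_simp; ring
      rw [e1]
      have h4 : 0 ≤ ((Q *ᵥ u) ⬝ᵥ (Q *ᵥ u)) / (16 * τ) := by positivity
      split_ifs with h
      · nlinarith [sq_nonneg ((s - 1 / 4) / 4 - 1)]
      · by_cases h5 : ζ / 4 ≤ (u ⬝ᵥ z) ^ 2
        · have h6 : 16 * τ < (Q *ᵥ u) ⬝ᵥ (Q *ᵥ u) := by
            by_contra hcon
            exact h ⟨h5, by linarith⟩
          have h7 : 1 ≤ ((Q *ᵥ u) ⬝ᵥ (Q *ᵥ u)) / (16 * τ) := by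
            rw [le_div_iff₀ (by positivity)]; linarith
          nlinarith [sq_nonneg ((s - 1 / 4) / 4 - 1)]
        · have h6 : s < 1 / 4 := by
            rw [hs, div_lt_iff₀ hζ]; linarith
          nlinarith [sq_nonneg (s - 1 / 4)]
    · rw [ev_add, ev_const, ev_add, ev_mul, ev_add, ev_mul, ev_mul, ev_tabulate_sign_sq]
      have h4 := ev_tabulate_sign_pow_four_le z
      rw [← hζdef] at h4 ⊢
      have e1 : -17 / (32 * ζ) * ζ = -17 / 32 := by field_simp
      have e2 : 1 / (16 * ζ ^ 2) * (tabulate fun _ : Fin d => sign).ev (fun u => (u ⬝ᵥ z) ^ 4)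
          ≤ 3 / 16 := by
        rw [one_div, inv_mul_eq_div, div_le_iff₀ (by positivity)]; linarith
      have e3 : 1 / (16 * τ) * (tabulate fun _ : Fin d => sign).ev
          (fun u => (Q *ᵥ u) ⬝ᵥ (Q *ᵥ u)) ≤ 1 / 16 := by
        rw [one_div, inv_mul_eq_div, div_le_iff₀ (by positivity)]; linarith
      linarith

end Signs
end

/-! ### Partitioning a set along random directions. -/

noncomputable section
open Matrix RAM

section Partition

variable {n d : ℕ} {X : Fin n → Fin d → ℝ}

theorem Sat.empMean {T : List (Fin n)} (hT : T.Nodup) :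
    (empMean X T).Sat (7 * d + T.length * (6 * d + 3) + 1) (· = setMean X T.toFinset) := by
  unfold _root_.empMean
  refine Sat.bind (Sat.vzero d) (t₂ := 4 * d + T.length * (6 * d + 3) + 1) ?_ (by linarith)
  rintro _ rfl
  refine Sat.bind (Sat.forEach (I := fun l acc => acc + (l.map X).sum = (T.map X).sum)
    (w := fun _ => 6 * d) ?_ T 0 (by simp)) (fun s hs => ?_) (t₂ := 4 * d + T.length * 2 + 1) ?_
  · intro i l s hs
    refine (Sat.vaxpy s 1 (X i)).mono le_rfl ?_
    rintro _ rfl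
    rw [← hs, List.map_cons, List.sum_cons, one_smul, add_assoc]
  · refine Sat.bind (Sat.size T) (t₂ := 4 * d + 1) ?_ (by linarith)
    rintro _ rfl
    simp only [castN, sat_op_bind]
    refine (Sat.vdiv s T.length).mono (by linarith) ?_
    rintro _ rfl
    simp only [List.map_nil, List.sum_nil, add_zero] at hs
    rw [setMean, hs, List.toFinset_card_of_nodup hT, List.sum_toFinset _ hT]
  · simp only [List.map_const', List.sum_replicate, nsmul_eq_mul]; linarith

theorem Sat.covApply {T : List (Fin n)} (hT : T.Nodup) (N : ℕ) (w : Fin d → ℝ) :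
    (covApply X N T (setMean X T.toFinset) w).Sat (7 * d + T.length * (16 * d + 1) + 1)
      (· = setCov X N T.toFinset *ᵥ w) := by
  unfold _root_.covApply
  set μ := setMean X T.toFinset with hμ
  refine Sat.bind (Sat.vzero d) (t₂ := 4 * d + T.length * (16 * d + 1) + 1) ?_ (by linarith)
  rintro _ rfl
  refine Sat.bind (Sat.forEach
    (I := fun l acc => acc + (l.map fun i => ((X i - μ) ⬝ᵥ w) • (X i - μ)).sum
      = (T.map fun i => ((X i - μ) ⬝ᵥ w) • (X i - μ)).sum)
    (w := fun _ => 16 * d) ?_ T 0 (by simp)) (fun s hs => ?_) (t₂ := 4 * d + 1) ?_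
  · intro i l s hs
    refine Sat.bind (Sat.vsub (X i) μ) (t₂ := 11 * d) ?_ (by linarith)
    rintro _ rfl
    refine Sat.bind (Sat.dot _ w) (t₂ := 6 * d) ?_ (by linarith)
    rintro _ rfl
    refine (Sat.vaxpy s _ (X i - μ)).mono le_rfl ?_
    rintro _ rfl
    rw [← hs, List.map_cons, List.sum_cons, add_assoc]
  · simp only [castN, sat_op_bind]
    refine (Sat.vdiv s N).mono (by linarith) ?_
    rintro _ rfl
    simp only [List.map_nil, List.sum_nil, add_zero] at hs
    rw [setCov_mulVec, hs, List.sum_toFinset _ hT]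
  · simp only [List.map_const', List.sum_replicate, nsmul_eq_mul]; linarith

/-- A random direction `M ^ p u`. -/
def randomDirection (X : Fin n → Fin d → ℝ) (N : ℕ) (T : List (Fin n)) (μ : Fin d → ℝ) (p : ℕ) :
    RAM (Fin d → ℝ) := do
  let u ← tabulate (fun _ => sign)
  forEach (List.range p) u (fun w _ => covApply X N T μ w)

theorem Sat.covApply_iter {T : List (Fin n)} (hT : T.Nodup) (N p : ℕ) (u : Fin d → ℝ) :
    (forEach (List.range p) u fun w _ => _root_.covApply X N T (setMean X T.toFinset) w).Sat
      (p * (7 * d + T.length * (16 * d + 1) + 2)) (· = setCov X N T.toFinset ^ p *ᵥ u) := by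
  have := Sat.forEach
    (I := fun (l : List ℕ) w => setCov X N T.toFinset ^ l.length *ᵥ w
      = setCov X N T.toFinset ^ p *ᵥ u)
    (w := fun _ => 7 * (d : ℝ) + T.length * (16 * d + 1) + 1)
    (f := fun w _ => _root_.covApply X N T (setMean X T.toFinset) w) (by
      intro i l s hs
      refine (Sat.covApply hT N s).mono le_rfl ?_
      rintro _ rfl
      rw [← hs, List.length_cons, pow_succ, mulVec_mulVec]) (List.range p) u (by simp)
  refine this.mono ?_ (by simp)
  simp only [List.map_const', List.sum_replicate, nsmul_eq_mul, List.length_range]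
  linarith

theorem Sat.randomDirection {T : List (Fin n)} (hT : T.Nodup) (N p : ℕ) :
    (randomDirection X N T (setMean X T.toFinset) p).Sat
      (3 * d + p * (7 * d + T.length * (16 * d + 1) + 2)) (fun _ => True) := by
  refine Sat.bind (t₁ := 3 * d) ((Sat.tabulate (w := 1) (P := fun _ _ => True)
    fun j => Sat.flip fun b => Sat.ret (by norm_num) trivial).mono (by linarith) fun _ h => h)
    (fun u _ => (Sat.covApply_iter hT N p u).mono le_rfl fun _ _ => trivial) le_rfl

theorem whp_randomDirection {T : List (Fin n)} (hT : T.Nodup) (N p : ℕ) {τ : ℝ} (hτ : 0 < τ)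
    (hMτ : (setCov X N T.toFinset ^ (2 * p)).trace ≤ τ) (x : Fin d → ℝ) :
    (randomDirection X N T (setMean X T.toFinset) p).Whp (7 / 8) (fun v =>
      (setCov X N T.toFinset ^ p *ᵥ x) ⬝ᵥ (setCov X N T.toFinset ^ p *ᵥ x) / 4 ≤ (v ⬝ᵥ x) ^ 2 ∧
        v ⬝ᵥ v ≤ 16 * τ) := by
  have hsymm : (setCov X N T.toFinset ^ p)ᵀ = setCov X N T.toFinset ^ p := by
    have := (posSemidef_setCov X N T.toFinset).1.pow p
    rwa [IsHermitian, conjTranspose_eq_transpose_of_trivial] at this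
  refine Whp.bind (whp_tabulate_sign hsymm hτ (by rwa [← pow_add, ← two_mul]) x) (δ₂ := 0)
    (fun u hu => ?_) le_rfl (add_zero _).le
  refine ((Sat.covApply_iter hT N p u).2.mono ?_).whp
  rintro _ rfl
  exact hu

/-- The successful direction may depend on the pair of points, so constant probability per direction
suffices: `k` independent trials all fail with probability at most `(7 / 8) ^ k`, and there are `n ^
2` pairs. -/
theorem whp_randomDirections {T : List (Fin n)} (hT : T.Nodup) (N p k : ℕ) {τ : ℝ} (hτ : 0 < τ)
    (hMτ : (setCov X N T.toFinset ^ (2 * p)).trace ≤ τ) :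
    (collect (List.range k) fun _ => randomDirection X N T (setMean X T.toFinset) p).Whp
      ((n : ℝ) ^ 2 * (7 / 8) ^ k) (fun vs => ∀ i j, ∃ v ∈ vs,
      (setCov X N T.toFinset ^ p *ᵥ (X i - X j)) ⬝ᵥ (setCov X N T.toFinset ^ p *ᵥ (X i - X j)) / 4
        ≤ (v ⬝ᵥ (X i - X j)) ^ 2 ∧ v ⬝ᵥ v ≤ 16 * τ) := by
  refine (Whp.forall_mem (Finset.univ : Finset (Fin n × Fin n)) (δ := (7 / 8) ^ k)
    (Q := fun ij vs => ∃ v ∈ vs, (setCov X N T.toFinset ^ p *ᵥ (X ij.1 - X ij.2)) ⬝ᵥ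
      (setCov X N T.toFinset ^ p *ᵥ (X ij.1 - X ij.2)) / 4
        ≤ (v ⬝ᵥ (X ij.1 - X ij.2)) ^ 2 ∧ v ⬝ᵥ v ≤ 16 * τ) fun ij _ => ?_).mono (le_of_eq ?_) ?_
  · have := Whp.collect_exists (q := 7 / 8) (by norm_num) (List.range k)
      (fun i _ => whp_randomDirection hT N p hτ hMτ (X ij.1 - X ij.2))
    rwa [List.length_range] at this
  · simp [sq]
  · intro vs h i j
    exact h (i, j) (Finset.mem_univ _)

/-- The standing conditions on the parameters: `kb` bounds the number of thresholds and `W` the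
cost of a splitting step. -/
structure Bounds (c : MultifilterConsts) (N κ : ℕ) (α β C R kb W : ℝ) : Prop where
  β_nonneg : 0 ≤ β
  R_pos : 0 < R
  lt_two_pow : N < 2 ^ κ
  splits_le : (numSplits c α β (1 / (C * N)) : ℝ) ≤ kb
  cost_le : (2 * kb + 1) * (12 * κ + 25) + 32 ≤ W

theorem Bounds.W_nonneg {c : MultifilterConsts} {N κ : ℕ} {α β C R kb W : ℝ}
    (h : Bounds c N κ α β C R kb W) : 0 ≤ W := by
  have h1 := h.splits_le
  have : 0 ≤ kb := le_trans (Nat.cast_nonneg _) h1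
  refine le_trans ?_ h.cost_le
  positivity

/-- At most `ε` points of `S` are farther than `ρ ‖v‖` from some value in the direction `v`. -/
def Concentrated (X : Fin n → Fin d → ℝ) (S : Finset (Fin n)) (ρ ε : ℝ) : Prop :=
  ∀ v : Fin d → ℝ, ∃ ν : ℝ,
    ((S.filter fun i => ρ * √(v ⬝ᵥ v) < |v ⬝ᵥ X i - ν|).card : ℝ) ≤ ε

theorem length_le_potential {ι : Type} {β : ℝ} (hβ : 0 ≤ β) {L : List (List ι)}
    (hL : ∀ T ∈ L, T ≠ []) : (L.length : ℝ) ≤ potential β L := by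
  have : (L.length : ℝ) = (L.map fun _ => (1 : ℝ)).sum := by simp
  rw [this]
  refine List.sum_le_sum fun T hT => Real.one_le_rpow ?_ (by linarith)
  exact_mod_cast List.length_pos_iff.2 (hL T hT)

theorem length_le_rpow {ι : Type} {β : ℝ} (hβ : 0 ≤ β) {T : List ι} (hT : T ≠ []) :
    (T.length : ℝ) ≤ (T.length : ℝ) ^ (1 + β) := by
  have h1 : (1 : ℝ) ≤ T.length := by exact_mod_cast List.length_pos_iff.2 hT
  conv_lhs => rw [← Real.rpow_one (T.length : ℝ)]
  exact Real.rpow_le_rpow_of_exponent_le h1 (by linarith)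

theorem potential_flatten_le {ι κ : Type} {β : ℝ} {Q : κ → List (List ι) → Prop} {f : κ → ℝ}
    {L : List κ} {P : List (List (List ι))} (h : List.Forall₂ Q L P)
    (hQ : ∀ T ∈ L, ∀ Ts, Q T Ts → potential β Ts ≤ f T) :
    potential β P.flatten ≤ (L.map f).sum := by
  induction h with
  | nil => simp [potential]
  | @cons T Ts L P h _ ih =>
    have h1 := ih fun T hT => hQ T (by simp [hT])
    have h2 := hQ T (by simp) Ts h
    simp only [potential, List.flatten_cons, List.map_append, List.sum_append, List.map_cons,
      List.sum_cons] at *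
    linarith

theorem mem_flatten_of_forall₂ {ι κ : Type} {Q : κ → List ι → Prop} {L : List κ}
    {P : List (List ι)} (h : List.Forall₂ Q L P) {x : ι} (hx : x ∈ P.flatten) :
    ∃ T ∈ L, ∃ Ts, Q T Ts ∧ x ∈ Ts := by
  induction h with
  | nil => simp at hx
  | @cons T Ts L P h _ ih =>
    rw [List.flatten_cons, List.mem_append] at hx
    rcases hx with hx | hx
    · exact ⟨T, by simp, Ts, h, hx⟩
    · obtain ⟨T', h1, h2⟩ := ih hx
      exact ⟨T', by simp [h1], h2⟩

theorem exists_of_forall₂_mem {ι κ : Type} {Q : κ → List ι → Prop} {L : List κ}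
    {P : List (List ι)} (h : List.Forall₂ Q L P) {T : κ} (hT : T ∈ L) :
    ∃ Ts, Q T Ts ∧ ∀ x ∈ Ts, x ∈ P.flatten := by
  induction h with
  | nil => simp at hT
  | @cons T' Ts L P h _ ih =>
    rcases List.mem_cons.1 hT with rfl | hT
    · exact ⟨Ts, h, fun x hx => by simp [hx]⟩
    · obtain ⟨Ts', h1, h2⟩ := ih hT
      exact ⟨Ts', h1, fun x hx => by simp [h2 x hx]⟩

/-- The cost of a one-dimensional partition per unit of potential. -/
def lineCost (d κ : ℕ) (W : ℝ) : ℝ := 10 * d + 4 * κ + 2 * W + 12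

-- The loop maintains three facts: all sets come from `Tp`, the potential has not grown, and one
-- distinguished set is short in every direction used so far and has lost at most `ε` points of `S`
-- per direction. Shortness persists because later sets are subsets. This part is deterministic;
-- `vs` is arbitrary.
open Classical in
theorem Sat.partitionLoop {c : MultifilterConsts} {N κ : ℕ} {α β C R kb W ε : ℝ}
    (hb : Bounds c N κ α β C R kb W) {Tp : List (Fin n)} (hTp : Tp ≠ []) (hTN : Tp.length ≤ N)
    (S : Finset (Fin n)) (vs : List (Fin d → ℝ)) :
    (forEach vs [Tp] (fun Ss v =>
      forEach Ss [] (fun acc T' => do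
        let Ts ← _root_.gaussian1DPartition c X N T' α v β C R
        append Ts acc))).Sat
      (vs.length * ((Tp.length : ℝ) ^ (1 + β) * (lineCost d κ W + 3))) (fun Ts =>
        (∀ T' ∈ Ts, T' ≠ [] ∧ T'.Subperm Tp) ∧ potential β Ts ≤ (Tp.length : ℝ) ^ (1 + β) ∧
        (Tight c α β (1 / (C * N)) N →
          Concentrated X S (R / (4 * numSplits c α β (1 / (C * N)))) ε →
          ∃ T' ∈ Ts, ((S ∩ Tp.toFinset).card : ℝ) ≤ (S ∩ T'.toFinset).card + vs.length * ε ∧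
            ∀ v ∈ vs, ∀ i ∈ T', ∀ j ∈ T', v ⬝ᵥ X i - v ⬝ᵥ X j ≤ R * √(v ⬝ᵥ v))) := by
  set P := (Tp.length : ℝ) ^ (1 + β) with hP
  have hβ := hb.β_nonneg
  have hW := hb.W_nonneg
  have hU : 0 ≤ lineCost d κ W := by unfold lineCost; positivity
  have hP1 : 1 ≤ P := Real.one_le_rpow (by exact_mod_cast List.length_pos_iff.2 hTp) (by linarith)
  have := Sat.forEach (w := fun _ => P * (lineCost d κ W + 2))
    (I := fun l (Ss : List (List (Fin n))) => (∀ T' ∈ Ss, T' ≠ [] ∧ T'.Subperm Tp) ∧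
      potential β Ss ≤ P ∧ (Tight c α β (1 / (C * N)) N →
          Concentrated X S (R / (4 * numSplits c α β (1 / (C * N)))) ε →
          ∃ pre, vs = pre ++ l ∧ ∃ T' ∈ Ss,
          ((S ∩ Tp.toFinset).card : ℝ) ≤ (S ∩ T'.toFinset).card + pre.length * ε ∧
            ∀ v ∈ pre, ∀ i ∈ T', ∀ j ∈ T', v ⬝ᵥ X i - v ⬝ᵥ X j ≤ R * √(v ⬝ᵥ v)))
    (f := fun Ss v => forEach Ss [] (fun acc T' => do
        let Ts ← _root_.gaussian1DPartition c X N T' α v β C R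
        append Ts acc)) ?_ vs [Tp] ?_
  · refine this.mono ?_ ?_
    · simp only [List.map_const', List.sum_replicate, nsmul_eq_mul]
      refine mul_le_mul_of_nonneg_left ?_ (by positivity)
      linarith
    · rintro Ts ⟨h1, h2, h3⟩
      refine ⟨h1, h2, fun ht hc => ?_⟩
      obtain ⟨pre, rfl, T', hT', h4, h5⟩ := h3 ht hc
      exact ⟨T', hT', by simpa using h4, by simpa using h5⟩
  · rintro v l Ss ⟨h1, h2, h3⟩
    refine (Sat.forEach_append
      (w := fun T' => (T'.length : ℝ) ^ (1 + β) * lineCost d κ W) Ss []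
      (fun T' hT' => Sat.gaussian1DPartition (h1 T' hT').1
        ((h1 T' hT').2.length_le.trans hTN)
        (((h1 T' hT').2.length_le.trans hTN).trans_lt hb.lt_two_pow) hβ hb.R_pos hb.splits_le
        hb.cost_le) (fun T' => (T'.length : ℝ) ^ (1 + β)) ?_).mono ?_ ?_
    · rintro T' hT' Ts ⟨g1, g2, -⟩
      exact (length_le_potential hβ fun T hT => (g1 T hT).1).trans g2
    · calc _ ≤ (Ss.map fun T' => (T'.length : ℝ) ^ (1 + β) * (lineCost d κ W + 2)).sum := by
            refine List.sum_le_sum fun T' hT' => ?_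
            have : (1 : ℝ) ≤ (T'.length : ℝ) ^ (1 + β) := Real.one_le_rpow
              (by exact_mod_cast List.length_pos_iff.2 (h1 T' hT').1) (by linarith)
            linarith
        _ = potential β Ss * (lineCost d κ W + 2) := by rw [List.sum_map_mul_right]; rfl
        _ ≤ _ := mul_le_mul_of_nonneg_right h2 (by linarith)
    · rintro r ⟨L, hL, hr⟩
      rw [List.append_nil] at hr
      refine ⟨fun T'' hT'' => ?_, ?_, fun ht hc => ?_⟩
      · obtain ⟨T', hT', Ts, ⟨g1, -, -⟩, hx⟩ := mem_flatten_of_forall₂ hL (hr.mem_iff.1 hT'')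
        exact ⟨(g1 _ hx).1, (g1 _ hx).2.trans (h1 T' hT').2⟩
      · have e : potential β r = potential β L.flatten := (hr.map _).sum_eq
        rw [e]
        exact (potential_flatten_le hL fun T' _ Ts hTs => hTs.2.1).trans h2
      · obtain ⟨pre, hpre, T', hT', h4, h5⟩ := h3 ht hc
        obtain ⟨Ts, ⟨g1, g2, g3⟩, g4⟩ := exists_of_forall₂_mem hL hT'
        obtain ⟨ν, hν⟩ := hc v
        obtain ⟨T'', hT'', hcap⟩ := (g3 ht).2 ν
        refine ⟨pre ++ [v], by simp [hpre], T'', hr.mem_iff.2 (g4 _ hT''), ?_, ?_⟩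
        -- The cluster chosen around the center `ν` of `S` can only miss points of `S` whose value
        -- is far from `ν`.
        · have hsub : S ∩ T'.toFinset ⊆ (S ∩ T''.toFinset) ∪ (S.filter fun i =>
              R / (4 * numSplits c α β (1 / (C * N))) * √(v ⬝ᵥ v) < |v ⬝ᵥ X i - ν|) := by
            intro i hi
            rw [Finset.mem_inter, List.mem_toFinset] at hi
            rw [Finset.mem_union, Finset.mem_inter, List.mem_toFinset, Finset.mem_filter]
            by_cases h : |v ⬝ᵥ X i - ν| ≤ R / (4 * numSplits c α β (1 / (C * N))) * √(v ⬝ᵥ v)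
            · exact Or.inl ⟨hi.1, hcap i hi.2 h⟩
            · exact Or.inr ⟨hi.1, not_le.1 h⟩
          have hcard := (Finset.card_le_card hsub).trans (Finset.card_union_le _ _)
          have hcard' : ((S ∩ T'.toFinset).card : ℝ) ≤ (S ∩ T''.toFinset).card + ε := by
            have : ((S ∩ T'.toFinset).card : ℝ) ≤ (S ∩ T''.toFinset).card + ((S.filter fun i =>
              R / (4 * numSplits c α β (1 / (C * N))) * √(v ⬝ᵥ v) < |v ⬝ᵥ X i - ν|).card : ℝ) := by
              exact_mod_cast hcard
            linarith
          rw [List.length_append, List.length_singleton]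
          push_cast
          linarith
        · intro w hw i hi j hj
          rcases List.mem_append.1 hw with hw | hw
          · exact h5 w hw i ((g1 _ hT'').2.subset hi) j ((g1 _ hT'').2.subset hj)
          · rw [List.mem_singleton] at hw
            subst hw
            exact (g3 ht).1 T'' hT'' i hi j hj
  · refine ⟨by simpa using ⟨hTp, List.Subperm.refl _⟩, by simp [potential, hP], fun _ _ => ?_⟩
    exact ⟨[], by simp, Tp, by simp, by simp, by simp⟩

end Partition
end

noncomputable section
open Matrix RAM

namespace RAM

variable {β γ ι σ : Type}

theorem whp_op_bind {b : β} {f : β → RAM γ} {δ : ℝ} {Q : γ → Prop} :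
    (op b >>= f).Whp δ Q ↔ (f b).Whp δ Q := Iff.rfl

theorem Whp.forEach {I : List ι → σ → Prop} {f : σ → ι → RAM σ} {δ : ℝ} (hδ : 0 ≤ δ)
    (hf : ∀ i l s, I (i :: l) s → (f s i).Whp δ (I l)) (l : List ι) (s : σ) (hs : I l s) :
    (forEach l s f).Whp (l.length * δ) (I []) := by
  induction l generalizing s with
  | nil => simpa [RAM.forEach] using All.whp (c := RAM.ret s) hs
  | cons i l ih =>
    refine Whp.bind (c := f s i) (hf i l s hs) (fun s' hs' => ih s' hs') (by positivity) ?_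
    rw [List.length_cons]
    push_cast
    linarith

end RAM

section Partition

variable {n d : ℕ} {X : Fin n → Fin d → ℝ}

/-- The cost of a partitioning step per unit of potential. -/
def partCost (d κ p k : ℕ) (W : ℝ) : ℝ := 30 * d + k * (4 * d + 27 * p * d + lineCost d κ W + 3)

theorem Sat.gaussianPartition {c : MultifilterConsts} {N κ : ℕ} {α β C R kb W : ℝ} (hd : 1 ≤ d)
    (hb : Bounds c N κ α β (C * ⌈c.dir * Real.log d⌉₊) R kb W) {Tp : List (Fin n)}
    (hTp : Tp ≠ []) (hnd : Tp.Nodup) (hTN : Tp.length ≤ N) :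
    (gaussianPartition c X N Tp α β C R).Sat
      ((Tp.length : ℝ) ^ (1 + β) * partCost d κ ⌈Real.log d⌉₊ ⌈c.dir * Real.log d⌉₊ W) (fun Ts =>
        (∀ T' ∈ Ts, T' ≠ [] ∧ T'.Subperm Tp) ∧
          potential β Ts ≤ (Tp.length : ℝ) ^ (1 + β)) := by
  unfold _root_.gaussianPartition
  set p := ⌈Real.log d⌉₊ with hp
  set k := ⌈c.dir * Real.log d⌉₊ with hk
  set P := (Tp.length : ℝ) ^ (1 + β) with hP
  set m : ℝ := (Tp.length : ℝ) with hm
  have hm1 : 1 ≤ m := Nat.one_le_cast.2 (List.length_pos_iff.2 hTp)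
  have hmP : m ≤ P := length_le_rpow hb.β_nonneg hTp
  have hd1 : (1 : ℝ) ≤ d := by exact_mod_cast hd
  have hmd : 1 ≤ m * d := by nlinarith
  have hmd1 : m ≤ m * d := by nlinarith
  have hmd2 : (d : ℝ) ≤ m * d := by nlinarith
  have hmPd : m * d ≤ P * d := by nlinarith
  simp only [castN, logR, ceilR, mulR, sat_op_bind]
  refine Sat.bind (Sat.empMean hnd) (t₂ := k * (4 * (P * d) + 27 * p * (P * d)) + 2 +
    k * (P * (lineCost d κ W + 3))) ?_ ?_
  · rintro _ rfl
    refine Sat.bind (Sat.collect (w := fun _ => 3 * d + p * (7 * d + m * (16 * d + 1) + 2))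
      (Q := fun _ _ => True) (List.range k) fun _ _ => Sat.randomDirection hnd N p)
      (t₂ := 2 + k * (P * (lineCost d κ W + 3))) (fun vs hvs => ?_) ?_
    · have hlen : vs.length = k := by simpa using hvs.length_eq.symm
      simp only [sat_op_bind]
      have := Sat.partitionLoop (X := X) (ε := 0) hb hTp hTN ∅ vs
      rw [hlen] at this
      exact this.mono (by linarith) fun Ts h => ⟨h.1, h.2.1⟩
    · simp only [List.map_const', List.sum_replicate, nsmul_eq_mul, List.length_range]
      have h1 : 3 * (d : ℝ) + p * (7 * d + m * (16 * d + 1) + 2) + 1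
          ≤ 4 * (P * d) + 27 * p * (P * d) := by
        have : (p : ℝ) * (7 * d + m * (16 * d + 1) + 2) ≤ p * (27 * (P * d)) :=
          mul_le_mul_of_nonneg_left (by linarith) (by positivity)
        linarith
      have := mul_le_mul_of_nonneg_left h1 (Nat.cast_nonneg (α := ℝ) k)
      linarith
  · have : P * partCost d κ p k W = 30 * (P * d) + k * (4 * (P * d) + 27 * p * (P * d)) +
      k * (P * (lineCost d κ W + 3)) := by unfold partCost; ring
    rw [this]
    linarith

-- Here `τ` denotes the bracket on the right, an upper bound for `tr M ^ (2 p)`. For two points of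
-- the distinguished part take the direction `v` that suits the pair: `‖M ^ p (X i - X j)‖² ≤ 4 ⟨v,
-- X i - X j⟩² ≤ 4 R² ‖v‖² ≤ 64 R² τ`. Then `trace_setCov_pow_le` applies.
open Classical in
theorem whp_gaussianPartition {c : MultifilterConsts} {N κ : ℕ} {α β C R kb W ε t : ℝ} (hd : 1 ≤ d)
    (hb : Bounds c N κ α β (C * ⌈c.dir * Real.log d⌉₊) R kb W) {Tp : List (Fin n)}
    (hTp : Tp ≠ []) (hnd : Tp.Nodup) (hTN : Tp.length ≤ N) {S : Finset (Fin n)}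
    (ht : Tight c α β (1 / (C * ⌈c.dir * Real.log d⌉₊ * N)) N)
    (hS : Concentrated X S
      (R / (4 * numSplits c α β (1 / (C * ⌈c.dir * Real.log d⌉₊ * N)))) ε)
    (ht0 : 0 < t) :
    (gaussianPartition c X N Tp α β C R).Whp ((n : ℝ) ^ 2 * (7 / 8) ^ ⌈c.dir * Real.log d⌉₊)
      (fun Ts => ∃ T' ∈ Ts, (T' ≠ [] ∧ T'.Subperm Tp) ∧
        ((S ∩ Tp.toFinset).card : ℝ) ≤ (S ∩ T'.toFinset).card + ⌈c.dir * Real.log d⌉₊ * ε ∧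
        (setCov X N T'.toFinset ^ (2 * ⌈Real.log d⌉₊ + 1)).trace ≤ 64 * R ^ 2 *
          ((setCov X N Tp.toFinset ^ (2 * ⌈Real.log d⌉₊ + 1)).trace / t
            + d * t ^ (2 * ⌈Real.log d⌉₊))) := by
  unfold _root_.gaussianPartition
  set p := ⌈Real.log d⌉₊ with hp
  set k := ⌈c.dir * Real.log d⌉₊ with hk
  set τ := (setCov X N Tp.toFinset ^ (2 * p + 1)).trace / t + d * t ^ (2 * p) with hτ
  have hd1 : (1 : ℝ) ≤ d := by exact_mod_cast hd
  have hpsd := posSemidef_setCov X N Tp.toFinset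
  have hτ0 : 0 < τ := by
    have := hpsd.trace_pow_nonneg (2 * p + 1)
    positivity
  simp only [castN, logR, ceilR, mulR, whp_op_bind]
  refine Whp.bind (Sat.empMean hnd).2.whp (δ₂ := (n : ℝ) ^ 2 * (7 / 8) ^ k) ?_ (by positivity)
    (zero_add _).le
  rintro _ rfl
  refine Whp.bind ((whp_randomDirections hnd N p k hτ0 (hpsd.trace_pow_le (2 * p) ht0)).and_all
    (Sat.collect (List.range k) fun _ _ => Sat.randomDirection hnd N p).2) (δ₂ := 0)
    (fun vs hvs => ?_) le_rfl (add_zero _).le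
  obtain ⟨hvs, hlen⟩ := hvs
  have hlen : vs.length = k := by simpa using hlen.length_eq.symm
  simp only [whp_op_bind]
  refine ((Sat.partitionLoop (X := X) (ε := ε) hb hTp hTN S vs).2.mono ?_).whp
  rintro Ts ⟨h1, h2, h3⟩
  obtain ⟨T', hT', h4, h5⟩ := h3 ht hS
  rw [hlen] at h4
  refine ⟨T', hT', h1 T' hT', h4, ?_⟩
  have hsub : T'.toFinset ⊆ Tp.toFinset := fun i hi => by
    rw [List.mem_toFinset] at hi ⊢
    exact (h1 T' hT').2.subset hi
  refine trace_setCov_pow_le hsub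
    ((List.toFinset_card_le _).trans ((h1 T' hT').2.length_le.trans hTN)) (by positivity) ?_
  intro i hi j hj
  rw [List.mem_toFinset] at hi hj
  obtain ⟨v, hv, hv1, hv2⟩ := hvs i j
  have h6 := h5 v hv i hi j hj
  have h7 := h5 v hv j hj i hi
  have hvv : 0 ≤ v ⬝ᵥ v := by simpa using dotProduct_star_self_nonneg v
  have h8 : (v ⬝ᵥ (X i - X j)) ^ 2 ≤ R ^ 2 * (v ⬝ᵥ v) := by
    rw [dotProduct_sub, ← Real.sq_sqrt hvv, ← mul_pow]
    exact sq_le_sq' (by linarith) h6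
  have h9 : R ^ 2 * (v ⬝ᵥ v) ≤ R ^ 2 * (16 * τ) := mul_le_mul_of_nonneg_left hv2 (by positivity)
  linarith

theorem Sat.keepLarge (θ : ℝ) (Ts : List (List (Fin n))) :
    (keepLarge θ Ts).Sat (Ts.map fun T => 2 * (T.length : ℝ) + 4).sum
      (fun r => r.Perm (Ts.filter fun T => decide (θ ≤ T.length))) := by
  have := Sat.forEach
    (I := fun (l : List (List (Fin n))) acc => (acc ++ l.filter fun T => decide (θ ≤ T.length)).Perm
      (Ts.filter fun T => decide (θ ≤ T.length)))
    (w := fun T => 2 * (T.length : ℝ) + 3) (f := fun acc T => do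
      let m ← size T
      let mR ← castN m
      let big ← leR θ mR
      if big then op (T :: acc) else return acc) ?_ Ts [] (by simp)
  · refine this.mono (le_of_eq ?_) (by simp)
    congr 1
    refine List.map_congr_left fun T _ => ?_
    ring
  · intro T l acc h
    refine Sat.bind (Sat.size T) (t₂ := 3) ?_ (by linarith)
    rintro _ rfl
    simp only [castN, leR, sat_op_bind, decide_eq_true_eq]
    split_ifs with hb
    · refine Sat.op (by norm_num) (.trans ?_ h)
      simp only [List.filter_cons, hb, decide_true, if_true, List.cons_append]
      exact List.perm_middle.symm
    · refine Sat.pure (by norm_num) ?_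
      simpa [List.filter_cons, hb] using h

end Partition
end

/-! ### Iterated partitioning of one cluster. -/

noncomputable section
open Matrix RAM

section BoundedDiameter

variable {n d : ℕ} {X : Fin n → Fin d → ℝ}

theorem nodup_of_subperm {ι : Type} {l l' : List ι} (h : l.Subperm l') (h' : l'.Nodup) :
    l.Nodup := by
  obtain ⟨m, hm, hs⟩ := h
  exact hm.nodup_iff.1 (h'.sublist hs)

theorem potential_filter_le {ι : Type} {β : ℝ} (L : List (List ι)) (q : List ι → Bool) :
    potential β (L.filter q) ≤ potential β L := by
  refine (List.filter_sublist.map _).sum_le_sum fun x hx => ?_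
  obtain ⟨T, _, rfl⟩ := List.mem_map.1 hx
  positivity

/-- One round of partitioning of all the sets in a list, keeping the large parts. -/
def layer (c : MultifilterConsts) (X : Fin n → Fin d → ℝ) (N : ℕ) (α β C R θ : ℝ)
    (L : List (List (Fin n))) : RAM (List (List (Fin n))) :=
  forEach L [] (fun acc T' => do
    let Ts ← gaussianPartition c X N T' α β C R
    let Ts ← keepLarge θ Ts
    append Ts acc)

/-- Reassociation gives the body the shape required by the lemmas on `forEach` with `append`. -/
theorem layer_eq (c : MultifilterConsts) (N : ℕ) (α β C R θ : ℝ) (L : List (List (Fin n))) :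
    layer c X N α β C R θ L = forEach L [] (fun acc T' => do
      let Ts ← gaussianPartition c X N T' α β C R >>= keepLarge θ
      append Ts acc) := by
  unfold layer
  congr 1
  funext acc T'
  rw [RAM.bind_assoc]

theorem Sat.layer {c : MultifilterConsts} {N κ : ℕ} {α β C R kb W θ : ℝ} (hd : 1 ≤ d)
    (hb : Bounds c N κ α β (C * ⌈c.dir * Real.log d⌉₊) R kb W) {T : List (Fin n)}
    (hnd : T.Nodup) (hTN : T.length ≤ N) {L : List (List (Fin n))}
    (hL : ∀ T' ∈ L, T' ≠ [] ∧ T'.Subperm T) :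
    (layer c X N α β C R θ L).Sat
      (potential β L * (partCost d κ ⌈Real.log d⌉₊ ⌈c.dir * Real.log d⌉₊ W + 8)) (fun L' =>
        (∀ T' ∈ L', (T' ≠ [] ∧ T'.Subperm T) ∧ θ ≤ T'.length) ∧
          potential β L' ≤ potential β L) := by
  rw [layer_eq]
  set U := partCost d κ ⌈Real.log d⌉₊ ⌈c.dir * Real.log d⌉₊ W with hU
  have hβ := hb.β_nonneg
  refine (Sat.forEach_append (w := fun T' => (T'.length : ℝ) ^ (1 + β) * (U + 6)) L []
    (Q := fun T' Ts => (∀ T'' ∈ Ts, (T'' ≠ [] ∧ T''.Subperm T') ∧ θ ≤ T''.length) ∧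
      potential β Ts ≤ (T'.length : ℝ) ^ (1 + β)) (fun T' hT' => ?_)
      (fun T' => (T'.length : ℝ) ^ (1 + β)) ?_).mono ?_ ?_
  · refine Sat.bind (Sat.gaussianPartition hd hb (hL T' hT').1
      (nodup_of_subperm (hL T' hT').2 hnd) ((hL T' hT').2.length_le.trans hTN))
      (t₂ := (T'.length : ℝ) ^ (1 + β) * 6) (fun Ts hTs => ?_) (by linarith)
    refine (Sat.keepLarge θ Ts).mono ?_ ?_
    · calc _ ≤ (Ts.map fun T'' => (T''.length : ℝ) ^ (1 + β) * 6).sum := by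
            refine List.sum_le_sum fun T'' hT'' => ?_
            have h1 := length_le_rpow hβ (hTs.1 T'' hT'').1
            have : (1 : ℝ) ≤ (T''.length : ℝ) :=
              Nat.one_le_cast.2 (List.length_pos_iff.2 (hTs.1 T'' hT'').1)
            linarith
        _ = potential β Ts * 6 := by rw [List.sum_map_mul_right]; rfl
        _ ≤ _ := mul_le_mul_of_nonneg_right hTs.2 (by norm_num)
    · intro r hr
      refine ⟨fun T'' hT'' => ?_, ?_⟩
      · have := hr.mem_iff.1 hT''
        rw [List.mem_filter, decide_eq_true_eq] at this
        exact ⟨hTs.1 T'' this.1, this.2⟩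
      · have e : potential β r = _ := (hr.map _).sum_eq
        rw [e]
        exact (potential_filter_le _ _).trans hTs.2
  · rintro T' hT' Ts ⟨g1, g2⟩
    exact (length_le_potential hβ fun T hT => (g1 T hT).1.1).trans g2
  · calc _ ≤ (L.map fun T' => (T'.length : ℝ) ^ (1 + β) * (U + 8)).sum := by
          refine List.sum_le_sum fun T' hT' => ?_
          have : (1 : ℝ) ≤ (T'.length : ℝ) ^ (1 + β) := Real.one_le_rpow
            (Nat.one_le_cast.2 (List.length_pos_iff.2 (hL T' hT').1)) (by linarith)
          linarith
      _ = potential β L * (U + 8) := by rw [List.sum_map_mul_right]; rfl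
      _ ≤ _ := le_rfl
  · rintro r ⟨P, hP, hr⟩
    rw [List.append_nil] at hr
    refine ⟨fun T'' hT'' => ?_, ?_⟩
    · obtain ⟨T', hT', Ts, ⟨g1, -⟩, hx⟩ := mem_flatten_of_forall₂ hP (hr.mem_iff.1 hT'')
      exact ⟨⟨(g1 _ hx).1.1, (g1 _ hx).1.2.trans (hL T' hT').2⟩, (g1 _ hx).2⟩
    · have e : potential β r = potential β P.flatten := (hr.map _).sum_eq
      rw [e]
      exact potential_flatten_le hP fun T' _ Ts hTs => hTs.2

open Classical in
/-- A set that contains all but `ℓ k ε` points of `S`, and whose covariance matrix has been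
reduced in `ℓ` rounds. -/
structure GoodSet (X : Fin n → Fin d → ℝ) (N p k : ℕ) (T : List (Fin n)) (S : Finset (Fin n))
    (ρ E ε : ℝ) (ℓ : ℕ) (T' : List (Fin n)) : Prop where
  ne_nil : T' ≠ []
  subperm : T'.Subperm T
  card_le : (S.card : ℝ) ≤ (S ∩ T'.toFinset).card + ℓ * (k * ε)
  trace_le : (setCov X N T'.toFinset ^ (2 * p + 1)).trace
    ≤ ρ ^ ℓ * (setCov X N T.toFinset ^ (2 * p + 1)).trace + E

/-- One good set per layer is followed. The bound on `θ` ensures that what is left of `S` in it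
after this layer still passes the size test. -/
theorem whp_layer {c : MultifilterConsts} {N κ : ℕ} {α β C R kb W θ ε B : ℝ} (hd : 1 ≤ d)
    (hb : Bounds c N κ α β (C * ⌈c.dir * Real.log d⌉₊) R kb W) {T : List (Fin n)}
    (hnd : T.Nodup) (hTN : T.length ≤ N) {S : Finset (Fin n)}
    (ht : Tight c α β (1 / (C * ⌈c.dir * Real.log d⌉₊ * N)) N)
    (hS : Concentrated X S
      (R / (4 * numSplits c α β (1 / (C * ⌈c.dir * Real.log d⌉₊ * N)))) ε)
    (hB : 128 ≤ B) {ℓ : ℕ} (hθ : θ ≤ S.card - (ℓ + 1) * (⌈c.dir * Real.log d⌉₊ * ε))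
    {L : List (List (Fin n))}
    (hL : ∃ T' ∈ L, GoodSet X N ⌈Real.log d⌉₊ ⌈c.dir * Real.log d⌉₊ T S (64 / B)
      (d * (B * R ^ 2) ^ (2 * ⌈Real.log d⌉₊ + 1)) ε ℓ T') :
    (layer c X N α β C R θ L).Whp ((n : ℝ) ^ 2 * (7 / 8) ^ ⌈c.dir * Real.log d⌉₊) (fun L' =>
      ∃ T' ∈ L', GoodSet X N ⌈Real.log d⌉₊ ⌈c.dir * Real.log d⌉₊ T S (64 / B)
      (d * (B * R ^ 2) ^ (2 * ⌈Real.log d⌉₊ + 1)) ε (ℓ + 1) T') := by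
  classical
  obtain ⟨T', hT', hg⟩ := hL
  rw [layer_eq]
  refine Whp.forEach_append_exists (by positivity) (T := T') ?_ L [] hT'
  have hR := hb.R_pos
  have hB0 : 0 < B := by linarith
  set p := ⌈Real.log d⌉₊ with hp
  set k := ⌈c.dir * Real.log d⌉₊ with hk
  refine Whp.bind (whp_gaussianPartition (X := X) hd hb hg.ne_nil (nodup_of_subperm hg.subperm hnd)
    (hg.subperm.length_le.trans hTN) ht hS (t := B * R ^ 2) (by positivity)) (δ₂ := 0)
    (fun Ts hTs => ?_) le_rfl (add_zero _).le
  obtain ⟨T'', hT'', ⟨h1, h2⟩, h3, h4⟩ := hTs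
  have hcard : (S.card : ℝ) ≤ (S ∩ T''.toFinset).card + ((ℓ + 1 : ℕ) : ℝ) * (k * ε) := by
    have h5 := hg.card_le
    have h3' : ((S ∩ T'.toFinset).card : ℝ) ≤ (S ∩ T''.toFinset).card + k * ε := by
      convert h3
    have h5' : (S.card : ℝ) ≤ (S ∩ T'.toFinset).card + ℓ * (k * ε) := by
      convert h5
    push_cast
    linarith
  refine ((Sat.keepLarge θ Ts).2.mono fun r hr => ⟨T'', hr.mem_iff.2 ?_, ⟨h1,
    h2.trans hg.subperm, by convert hcard, ?_⟩⟩).whp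
  · rw [List.mem_filter, decide_eq_true_eq]
    refine ⟨hT'', hθ.trans ?_⟩
    have : ((S ∩ T''.toFinset).card : ℝ) ≤ T''.length := by
      exact_mod_cast (Finset.card_le_card Finset.inter_subset_right).trans (List.toFinset_card_le _)
    push_cast at hcard
    linarith
  · refine h4.trans ?_
    have h6 := hg.trace_le
    set Φ := (setCov X N T'.toFinset ^ (2 * p + 1)).trace
    set Φ₀ := (setCov X N T.toFinset ^ (2 * p + 1)).trace
    set E := (d : ℝ) * (B * R ^ 2) ^ (2 * p + 1) with hE
    have hE0 : 0 ≤ E := by positivity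
    -- The choice `t = B * R ^ 2` makes both summands scale alike, giving the recursion `Φ' ≤ (64 /
    -- B) (Φ + E)`. Since `64 / B ≤ 1 / 2`, the additive error stays at most `E` instead of
    -- accumulating.
    have e : 64 * R ^ 2 * (Φ / (B * R ^ 2) + d * (B * R ^ 2) ^ (2 * p)) = 64 / B * (Φ + E) := by
      rw [hE]; field_simp; ring
    rw [e]
    have h7 : 64 / B ≤ 1 / 2 := by rw [div_le_iff₀ hB0]; linarith
    calc 64 / B * (Φ + E) ≤ 64 / B * (((64 / B) ^ ℓ * Φ₀ + E) + E) :=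
          mul_le_mul_of_nonneg_left (by linarith) (by positivity)
      _ = (64 / B) ^ (ℓ + 1) * Φ₀ + 64 / B * (2 * E) := by ring
      _ ≤ _ := by nlinarith

open Classical in
/-- The mean of a set with bounded covariance that contains many points of `S` is close to the
center of `S`. -/
theorem dotProduct_self_setMean_sub_le {N p : ℕ} {s S : Finset (Fin n)} {μ : Fin d → ℝ}
    {t : ℝ} (ht : 0 < t) (hN : 0 < N) (hS : 0 < S.card)
    (hS2 : ∀ x : Fin d → ℝ, ∑ i ∈ S, ((X i - μ) ⬝ᵥ x) ^ 2 ≤ S.card * (x ⬝ᵥ x))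
    (hs : (S.card : ℝ) ≤ 2 * (S ∩ s).card)
    (hp : 2 * (d : ℝ) ≤ Real.exp 2 ^ (2 * p + 1))
    (htr : (setCov X N s ^ (2 * p + 1)).trace ≤ 2 * (d * t ^ (2 * p + 1))) :
    (setMean X s - μ) ⬝ᵥ (setMean X s - μ) ≤ 4 * N * (Real.exp 2 * t) / S.card + 4 := by
  set x := setMean X s - μ with hx
  have hxx : 0 ≤ x ⬝ᵥ x := by simpa using dotProduct_star_self_nonneg x
  have hS' : (0 : ℝ) < S.card := by exact_mod_cast hS
  have hN' : (0 : ℝ) < N := by exact_mod_cast hN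
  rcases hxx.eq_or_lt with h0 | h0
  · rw [← h0]; positivity
  -- A single eigenvalue to the power `2 p + 1` is at most the trace. Taking roots turns the factor
  -- `2 d` into at most `e²`, which is why the exponent is logarithmic in `d`.
  have hq : x ⬝ᵥ (setCov X N s *ᵥ x) ≤ Real.exp 2 * t * (x ⬝ᵥ x) := by
    set y := (√(x ⬝ᵥ x))⁻¹ • x with hy
    have hyy : y ⬝ᵥ y = 1 := by
      rw [hy, smul_dotProduct, dotProduct_smul, smul_eq_mul, smul_eq_mul, ← mul_assoc, ← mul_inv,
        Real.mul_self_sqrt hxx, inv_mul_cancel₀ h0.ne']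
    have hyq : y ⬝ᵥ (setCov X N s *ᵥ y) = (x ⬝ᵥ x)⁻¹ * (x ⬝ᵥ (setCov X N s *ᵥ x)) := by
      rw [hy, mulVec_smul, smul_dotProduct, dotProduct_smul, smul_eq_mul, smul_eq_mul, ← mul_assoc,
        ← mul_inv, Real.mul_self_sqrt hxx]
    have h1 := ((posSemidef_setCov X N s).pow_quadForm_le_trace (2 * p + 1) hyy).trans htr
    have h2 : y ⬝ᵥ (setCov X N s *ᵥ y) ≤ Real.exp 2 * t := by
      by_contra hcon
      push Not at hcon
      have h3 := pow_lt_pow_left₀ hcon (by positivity) (by omega : 2 * p + 1 ≠ 0)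
      rw [mul_pow] at h3
      have h4 := mul_le_mul_of_nonneg_right hp (pow_nonneg ht.le (2 * p + 1))
      linarith
    rw [hyq, inv_mul_le_iff₀ h0] at h2
    linarith
  rw [quadForm_setCov, inv_mul_le_iff₀ hN'] at hq
  have hA : ∑ i ∈ S ∩ s, ((X i - setMean X s) ⬝ᵥ x) ^ 2 ≤ N * (Real.exp 2 * t * (x ⬝ᵥ x)) :=
    (Finset.sum_le_sum_of_subset_of_nonneg Finset.inter_subset_right
      fun i _ _ => sq_nonneg _).trans hq
  have hA' : ∑ i ∈ S ∩ s, ((X i - μ) ⬝ᵥ x) ^ 2 ≤ S.card * (x ⬝ᵥ x) :=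
    (Finset.sum_le_sum_of_subset_of_nonneg Finset.inter_subset_left
      fun i _ _ => sq_nonneg _).trans (hS2 x)
  -- Each common point writes `‖x‖²` as a difference of its deviations from the two centers along
  -- `x`. The first center has small variance over `s`, the second over `S`, and at least half of
  -- `S` is common.
  have h3 : ((S ∩ s).card : ℝ) * (x ⬝ᵥ x) ^ 2 ≤ 2 * ∑ i ∈ S ∩ s, ((X i - setMean X s) ⬝ᵥ x) ^ 2
      + 2 * ∑ i ∈ S ∩ s, ((X i - μ) ⬝ᵥ x) ^ 2 := by
    rw [← nsmul_eq_mul, ← Finset.sum_const, Finset.mul_sum, Finset.mul_sum,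
      ← Finset.sum_add_distrib]
    refine Finset.sum_le_sum fun i _ => ?_
    have : x ⬝ᵥ x = (X i - μ) ⬝ᵥ x - (X i - setMean X s) ⬝ᵥ x := by
      rw [← sub_dotProduct]; congr 1; rw [hx]; abel
    rw [this]
    nlinarith [sq_nonneg ((X i - μ) ⬝ᵥ x + (X i - setMean X s) ⬝ᵥ x)]
  have h4 : (S.card : ℝ) / 2 * (x ⬝ᵥ x) ^ 2
      ≤ (2 * N * (Real.exp 2 * t) + 2 * S.card) * (x ⬝ᵥ x) := by
    have : (S.card : ℝ) / 2 * (x ⬝ᵥ x) ^ 2 ≤ (S ∩ s).card * (x ⬝ᵥ x) ^ 2 :=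
      mul_le_mul_of_nonneg_right (by linarith) (sq_nonneg _)
    linarith
  have h5 : (S.card : ℝ) / 2 * (x ⬝ᵥ x) ≤ 2 * N * (Real.exp 2 * t) + 2 * S.card := by
    refine le_of_mul_le_mul_right ?_ h0
    linarith
  rw [div_add' _ _ _ hS'.ne', le_div_iff₀ hS']
  linarith

end BoundedDiameter
end

noncomputable section
open Matrix RAM

section BoundedDiameter

variable {n d : ℕ} {X : Fin n → Fin d → ℝ}

/-- The interval length `R` of the algorithm. -/
def MultifilterConsts.radius (c : MultifilterConsts) (d : ℕ) : ℝ :=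
  c.rad * Real.log d * Real.log (Real.log d) ^ (3 / 2 : ℝ)

/-- The number of directions. -/
def MultifilterConsts.numDirs (c : MultifilterConsts) (d : ℕ) : ℕ := ⌈c.dir * Real.log d⌉₊

/-- The loss parameter `C` times the number of directions. -/
def MultifilterConsts.lossDirs (c : MultifilterConsts) (d : ℕ) : ℝ :=
  c.loss * (Real.log d * Real.log d) * c.numDirs d

/-- The number of layers. -/
def MultifilterConsts.numLayers (c : MultifilterConsts) (d : ℕ) : ℕ :=
  ⌈c.depth * (Real.log d * Real.log d)⌉₊

/-- The cost of the algorithm for data of bounded diameter, per unit of potential. -/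
def MultifilterConsts.layersCost (c : MultifilterConsts) (d κ : ℕ) (W : ℝ) : ℝ :=
  c.numLayers d * (partCost d κ ⌈Real.log d⌉₊ (c.numDirs d) W + 9) + 18 * d + 17

/-- Each layer costs a fixed multiple of the potential, which never exceeds that of `T`. The final
sets have at least `α |T| / 2` points each, so the potential bounds their number too. -/
theorem Sat.boundedDiameter {c : MultifilterConsts} {κ : ℕ} {α kb W : ℝ} (hd : 1 ≤ d)
    {T : List (Fin n)} (hT : T ≠ []) (hnd : T.Nodup)
    (hb : Bounds c T.length κ α (1 / Real.log d) (c.lossDirs d) (c.radius d) kb W)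
    (hD : 1 ≤ c.numLayers d) :
    (fastGaussianMultifilterBoundedDiameter c X T α).Sat
      ((T.length : ℝ) ^ (1 + 1 / Real.log d) * c.layersCost d κ W) (fun r =>
        r.length * (α * T.length / 2) ≤ (T.length : ℝ) ^ (1 + 1 / Real.log d)) := by
  unfold fastGaussianMultifilterBoundedDiameter
  set β := 1 / Real.log d with hβdef
  set P := (T.length : ℝ) ^ (1 + β) with hP
  set U := partCost d κ ⌈Real.log d⌉₊ (c.numDirs d) W with hU
  set D := c.numLayers d with hDdef
  have hβ := hb.β_nonneg
  have hTP : (T.length : ℝ) ≤ P := length_le_rpow hβ hT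
  have hT1 : (1 : ℝ) ≤ T.length := Nat.one_le_cast.2 (List.length_pos_iff.2 hT)
  have hd1 : (1 : ℝ) ≤ d := Nat.one_le_cast.2 hd
  have hP1 : 1 ≤ P := hT1.trans hTP
  have hU0 : 0 ≤ U := by
    have := hb.W_nonneg
    rw [hU]; unfold partCost lineCost; positivity
  have hpot : potential β [T] = P := by simp [potential, hP]
  refine Sat.bind (Sat.size T) (t₂ := 15 + (D * (P * (U + 9)) + P * (18 * d))) ?_ ?_
  · rintro _ rfl
    simp only [castN, logR, powR, mulR, ceilR, divR, sat_op_bind]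
    -- The size threshold is claimed only after at least one round: for a tiny cluster the rescaled
    -- `α` may exceed `2`, and then the initial set itself violates it. Hence the requirement of at
    -- least one layer.
    have := Sat.forEach (w := fun _ => P * (U + 8))
      (I := fun (l : List ℕ) L => (∀ T' ∈ L, T' ≠ [] ∧ T'.Subperm T) ∧ potential β L ≤ P ∧
        (l.length < D → ∀ T' ∈ L, α * T.length / 2 ≤ T'.length))
      (f := fun L _ => _root_.layer c X T.length α β (c.loss * (Real.log d * Real.log d)) (c.radius d)
        (α * T.length / 2) L) ?_ (List.range D) [T] ?_
    · refine Sat.bind this (t₂ := P * (18 * d)) (fun L hL => ?_) ?_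
      · obtain ⟨h1, h2, h3⟩ := hL
        refine (Sat.collect (w := fun T' : List (Fin n) => 7 * (d : ℝ) + T'.length * (6 * d + 3) + 1)
          (Q := fun _ _ => True) L fun T' hT' =>
          (Sat.empMean (nodup_of_subperm (h1 T' hT').2 hnd)).mono le_rfl
            fun _ _ => trivial).mono ?_ ?_
        · calc _ ≤ (L.map fun T' => (T'.length : ℝ) ^ (1 + β) * (18 * d)).sum := by
                refine List.sum_le_sum fun T' hT' => ?_
                have h4 := length_le_rpow hβ (h1 T' hT').1
                have h5 : (1 : ℝ) ≤ T'.length :=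
                  Nat.one_le_cast.2 (List.length_pos_iff.2 (h1 T' hT').1)
                have h6 := mul_le_mul_of_nonneg_right h4 (by positivity : (0 : ℝ) ≤ 18 * d)
                nlinarith [mul_le_mul_of_nonneg_right h5 (by positivity : (0 : ℝ) ≤ (d : ℝ)),
                  mul_le_mul_of_nonneg_left hd1 (by positivity : (0 : ℝ) ≤ (T'.length : ℝ))]
            _ = potential β L * (18 * d) := by rw [List.sum_map_mul_right]; rfl
            _ ≤ _ := mul_le_mul_of_nonneg_right h2 (by positivity)
        · intro r hr
          rw [← hr.length_eq]
          have h4 : ((L.length : ℝ)) * (α * T.length / 2)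
              = (L.map fun _ => α * T.length / 2).sum := by simp
          rw [h4]
          refine (List.sum_le_sum fun T' hT' => ?_).trans h2
          exact (h3 (Nat.lt_of_lt_of_le Nat.zero_lt_one hD) T' hT').trans (length_le_rpow hβ (h1 T' hT').1)
      · simp only [List.map_const', List.sum_replicate, nsmul_eq_mul, List.length_range]
        have : (D : ℝ) * (P * (U + 8) + 1) ≤ D * (P * (U + 9)) :=
          mul_le_mul_of_nonneg_left (by linarith) (by positivity)
        linarith
    · rintro i l L ⟨h1, h2, h3⟩
      refine (Sat.layer hd (by exact hb) hnd le_rfl h1).mono ?_ ?_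
      · exact mul_le_mul_of_nonneg_right h2 (by change 0 ≤ U + 8; linarith)
      · rintro L' ⟨g1, g2⟩
        exact ⟨fun T' hT' => (g1 T' hT').1, g2.trans h2, fun _ T' hT' => (g1 T' hT').2⟩
    · exact ⟨by simpa using ⟨hT, List.Subperm.refl _⟩, hpot.le, by simp⟩
  · have : P * c.layersCost d κ W = D * (P * (U + 9)) + P * (18 * d) + 17 * P := by
      unfold MultifilterConsts.layersCost; ring
    rw [this]
    linarith

/-- The choice of the number of layers enters through `h0`: the decayed initial trace has dropped to
the level `E` of the additive error. The loss `hε` over all layers leaves half of `S`, which matches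
the threshold `α N / 2` because `α N = |S|`. -/
theorem whp_boundedDiameter {c : MultifilterConsts} {κ : ℕ} {α kb W ε B : ℝ} (hd : 1 ≤ d)
    {T : List (Fin n)} (hT : T ≠ []) (hnd : T.Nodup)
    (hb : Bounds c T.length κ α (1 / Real.log d) (c.lossDirs d) (c.radius d) kb W)
    (ht : Tight c α (1 / Real.log d) (1 / (c.lossDirs d * T.length)) T.length)
    {S : Finset (Fin n)} (hST : S ⊆ T.toFinset) (hS0 : 0 < S.card)
    (hS : Concentrated X S (c.radius d /
      (4 * numSplits c α (1 / Real.log d) (1 / (c.lossDirs d * T.length)))) ε)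
    (hε0 : 0 ≤ ε)
    (hB : 128 ≤ B) (hθ : α * T.length = S.card)
    (hε : c.numLayers d * (c.numDirs d * ε) ≤ S.card / 2)
    (h0 : (64 / B) ^ c.numLayers d * (setCov X T.length T.toFinset ^ (2 * ⌈Real.log d⌉₊ + 1)).trace
      ≤ d * (B * c.radius d ^ 2) ^ (2 * ⌈Real.log d⌉₊ + 1))
    (hp : 2 * (d : ℝ) ≤ Real.exp 2 ^ (2 * ⌈Real.log d⌉₊ + 1)) {μ : Fin d → ℝ}
    (hS2 : ∀ x : Fin d → ℝ, ∑ i ∈ S, ((X i - μ) ⬝ᵥ x) ^ 2 ≤ S.card * (x ⬝ᵥ x)) :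
    (fastGaussianMultifilterBoundedDiameter c X T α).Whp
      (c.numLayers d * ((n : ℝ) ^ 2 * (7 / 8) ^ c.numDirs d)) (fun r => ∃ m ∈ r,
        (m - μ) ⬝ᵥ (m - μ) ≤
          4 * T.length * (Real.exp 2 * (B * c.radius d ^ 2)) / S.card + 4) := by
  classical
  unfold fastGaussianMultifilterBoundedDiameter
  set β := 1 / Real.log d with hβdef
  set D := c.numLayers d with hDdef
  set E := (d : ℝ) * (B * c.radius d ^ 2) ^ (2 * ⌈Real.log d⌉₊ + 1) with hE
  have hR := hb.R_pos
  have hB0 : 0 < B := by linarith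
  refine Whp.bind (Sat.size T).2.whp
    (δ₂ := D * ((n : ℝ) ^ 2 * (7 / 8) ^ c.numDirs d)) ?_ (by positivity) (zero_add _).le
  rintro _ rfl
  simp only [castN, logR, powR, mulR, ceilR, divR, whp_op_bind]
  have := Whp.forEach (δ := (n : ℝ) ^ 2 * (7 / 8) ^ c.numDirs d) (by positivity)
    (I := fun (l : List ℕ) L => ∃ ℓ, ℓ + l.length = D ∧ ∃ T' ∈ L,
      GoodSet X T.length ⌈Real.log d⌉₊ (c.numDirs d) T S (64 / B) E ε ℓ T')
    (f := fun L _ => _root_.layer c X T.length α β (c.loss * (Real.log d * Real.log d)) (c.radius d)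
        (α * T.length / 2) L) ?_ (List.range D) [T] ?_
  · rw [List.length_range] at this
    refine Whp.bind this (δ₂ := 0) (fun L hL => ?_) le_rfl (add_zero _).le
    obtain ⟨ℓ, hℓ, T', hT', hg⟩ := hL
    rw [List.length_nil, Nat.add_zero] at hℓ
    subst hℓ
    have hcard : (S.card : ℝ) ≤ 2 * (S ∩ T'.toFinset).card := by
      have h1 := hg.card_le
      have h1' : (S.card : ℝ) ≤ (S ∩ T'.toFinset).card + D * (c.numDirs d * ε) := by convert h1
      linarith
    have hfin := dotProduct_self_setMean_sub_le (X := X) (N := T.length) (p := ⌈Real.log d⌉₊)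
      (s := T'.toFinset) (t := B * c.radius d ^ 2) (by positivity) (List.length_pos_iff.2 hT) hS0
      hS2 (by convert hcard) hp (by have := hg.trace_le; rw [← hE]; linarith)
    have hmem : (collect L fun T' => empMean X T').All (fun r => setMean X T'.toFinset ∈ r) := by
      induction L with
      | nil => simp at hT'
      | cons T'' L ih =>
        by_cases h : T' = T''
        · subst h
          exact All.bind (c := empMean X T')
            (Sat.empMean (nodup_of_subperm hg.subperm hnd)).2 fun b hb =>
            All.bind (c := collect L _) (all_true _) fun bs _ => by
              subst hb
              exact List.mem_cons_self
        · exact All.bind (c := empMean X T'') (all_true _) fun b _ =>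
            All.bind (c := collect L _) (ih (by simpa [h] using hT')) fun bs hbs =>
              List.mem_cons_of_mem _ hbs
    exact (hmem.mono fun r hr => ⟨_, hr, hfin⟩).whp
  · rintro i l L ⟨ℓ, hℓ, hL⟩
    rw [List.length_cons] at hℓ
    have hk0 : 0 ≤ (c.numDirs d : ℝ) * ε := by positivity
    have h5 : (ℓ : ℝ) + 1 ≤ D := by exact_mod_cast (by omega : ℓ + 1 ≤ D)
    refine (whp_layer (X := X) hd (by exact hb) hnd le_rfl (by exact ht) (by exact hS) hB
      ?_ hL).mono le_rfl fun L' hL' => ⟨ℓ + 1, by omega, hL'⟩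
    have h6 := mul_le_mul_of_nonneg_right h5 hk0
    rw [hθ]
    change _ ≤ (S.card : ℝ) - _ * (c.numDirs d * ε)
    linarith
  · refine ⟨0, by simp, T, by simp, hT, List.Subperm.refl _, ?_, ?_⟩
    · rw [Finset.inter_eq_left.2 (by convert hST)]; simp
    · rw [pow_zero, one_mul]
      have : 0 ≤ E := by positivity
      linarith

end BoundedDiameter
end

/-! ### Clustering along a random integer direction. -/

noncomputable section
open Matrix RAM

section Cluster

variable {n d : ℕ} {X : Fin n → Fin d → ℝ}

theorem Sat.cutAtGaps {G : ℝ} (l : List (ℝ × Fin n)) (hl : Sorted l) :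
    (cutAtGaps G l).Sat (3 * l.length) (fun cs => ∃ P : List (List (ℝ × Fin n)),
      cs = P.map (List.map Prod.snd) ∧ P.flatten = l ∧ (∀ c ∈ P, c ≠ []) ∧
      (∀ c ∈ P, c.IsChain fun x y => y.1 - x.1 ≤ G) ∧
      P.Pairwise fun c c' => ∀ x ∈ c, ∀ y ∈ c', G < y.1 - x.1) := by
  induction l with
  | nil => exact Sat.ret (by simp) ⟨[], by simp, by simp, by simp, by simp, by simp⟩
  | cons x l ih =>
    cases l with
    | nil => exact Sat.op (by simp) ⟨[[x]], by simp, by simp, by simp, by simp, by simp⟩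
    | cons y l =>
      have hl' := List.pairwise_cons.1 hl
      have hl'' := List.pairwise_cons.1 hl'.2
      refine Sat.bind (ih hl'.2) (t₂ := 3) (fun cs hcs => ?_) (by simp; linarith)
      obtain ⟨P, rfl, h1, h2, h3, h4⟩ := hcs
      simp only [subR, ltR, sat_op_bind, decide_eq_true_eq]
      split_ifs with hfar
      · refine Sat.op (by norm_num) ⟨[x] :: P, by simp, by simp [h1], by simpa using h2,
          by simpa using h3, List.pairwise_cons.2 ⟨fun c hc a ha z hz => ?_, h4⟩⟩
        rw [List.mem_singleton] at ha
        subst ha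
        have hz' : z ∈ y :: l := by
          rw [← h1]; exact List.mem_flatten.2 ⟨c, hc, hz⟩
        rcases List.mem_cons.1 hz' with rfl | hz'
        · exact hfar
        · have := hl''.1 z hz'
          linarith
      · cases P with
        | nil => simp at h1
        | cons c P =>
          simp only [List.map_cons]
          have hc := h2 c (by simp)
          cases c with
          | nil => exact absurd rfl hc
          | cons y' c =>
            obtain rfl : y' = y := by simpa using congrArg List.head? h1
            have h4' := List.pairwise_cons.1 h4
            refine Sat.op (by norm_num) ⟨(x :: y' :: c) :: P, by simp, by simpa using h1,
              by simpa using fun c' hc' => h2 c' (by simp [hc']), ?_,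
              List.pairwise_cons.2 ⟨fun c' hc' a ha z hz => ?_, h4'.2⟩⟩
            · intro c' hc'
              rcases List.mem_cons.1 hc' with rfl | hc'
              · exact List.isChain_cons_cons.2 ⟨not_lt.1 hfar, h3 _ (by simp)⟩
              · exact h3 c' (by simp [hc'])
            · rcases List.mem_cons.1 ha with rfl | ha
              · have := h4'.1 c' hc' y' (by simp) z hz
                have := hl'.1 y' (by simp)
                linarith
              · exact h4'.1 c' hc' a ha z hz

theorem sub_le_of_isChain {ι : Type} {G : ℝ} (hG : 0 ≤ G) (l : List (ℝ × ι)) (hl : Sorted l)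
    (hc : l.IsChain fun x y => y.1 - x.1 ≤ G) {x y : ℝ × ι} (hx : x ∈ l) (hy : y ∈ l) :
    y.1 - x.1 ≤ l.length * G := by
  induction l generalizing x y with
  | nil => simp at hx
  | cons a l ih =>
    have hl' := List.pairwise_cons.1 hl
    have h0 : 0 ≤ (l.length : ℝ) * G := by positivity
    rw [List.length_cons]
    push_cast
    cases l with
    | nil =>
      rw [List.mem_singleton] at hx hy
      subst hx; subst hy
      simpa using hG
    | cons b l =>
      have hc' := List.isChain_cons_cons.1 hc
      rcases List.mem_cons.1 hx with hxa | hx'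
      · rcases List.mem_cons.1 hy with hya | hy'
        · rw [hxa, hya, sub_self]; linarith
        · have := ih hl'.2 hc'.2 (x := b) (by simp) hy'
          have := hc'.1
          rw [hxa]
          linarith
      · rcases List.mem_cons.1 hy with hya | hy'
        · have := hl'.1 x hx'
          rw [hya]
          linarith
        · have := ih hl'.2 hc'.2 hx' hy'
          linarith

/-- Clustering of the data along the direction `u`. -/
def clusterAlong (X : Fin n → Fin d → ℝ) (u : Fin d → ℝ) : RAM (List (List (Fin n))) := do
  let ys ← collect (List.finRange n) (fun i => do
    let y ← dot u (X i)
    return (y, i))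
  let sorted ← mergeSort ys
  let nu ← len u
  let nR ← castN n
  let nd ← mulR nR d
  let w ← sqrtR nd
  let w ← mulR nu w
  let G ← mulR 2 w
  cutAtGaps G sorted

/-- Valid for every `u`. By Cauchy–Schwarz two points at distance at most `2 √(n d)` have
projections within the gap length, whereas points of different clusters are farther apart than that.
Inside a cluster at most `n` gaps add up. -/
theorem Sat.clusterAlong {κ : ℕ} (hn : 1 ≤ n) (hκ : n ≤ 2 ^ κ) (u : Fin d → ℝ) :
    (clusterAlong X u).Sat (n * (5 * d + 4 * κ + 5) + 5 * d + 6) (fun cs =>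
      cs.flatten.Perm (List.finRange n) ∧ (∀ c ∈ cs, c ≠ []) ∧
      (∀ S : Finset (Fin n), S.Nonempty →
        (∀ i ∈ S, ∀ j ∈ S, (X i - X j) ⬝ᵥ (X i - X j) ≤ 4 * (n * d)) →
        ∃ c ∈ cs, ∀ i ∈ S, i ∈ c) ∧
      ∀ c ∈ cs, ∀ i ∈ c, ∀ j ∈ c,
        u ⬝ᵥ X i - u ⬝ᵥ X j ≤ n * (2 * (√(u ⬝ᵥ u) * √(n * d)))) := by
  unfold _root_.clusterAlong
  refine Sat.bind (Sat.collect (w := fun _ => 5 * d) (Q := fun i y => y = (u ⬝ᵥ X i, i)) _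
    fun i _ => Sat.bind (Sat.dot u (X i)) (t₂ := 0) (by rintro _ rfl; exact Sat.pure le_rfl rfl)
      (by simp)) (fun ys hys => ?_) (t₂ := n * (4 * κ + 4) + 5 * d + 6) ?_
  swap
  · simp only [List.map_const', List.sum_replicate, nsmul_eq_mul, List.length_finRange]
    linarith
  obtain rfl := forall₂_eq_map hys
  refine Sat.bind (Sat.mergeSort κ _ (by simpa using hn) (by simpa using hκ))
    (fun sorted hs => ?_) (t₂ := n * 3 + 5 * d + 6)
    (by simp only [List.length_map, List.length_finRange]; linarith)
  obtain ⟨hperm, hsort⟩ := hs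
  have hlen : sorted.length = n := by simpa using hperm.length_eq
  have hmem : ∀ x ∈ sorted, x.1 = u ⬝ᵥ X x.2 := fun x hx => by
    obtain ⟨i, _, rfl⟩ := List.mem_map.1 (hperm.mem_iff.1 hx); rfl
  have hpermI : (sorted.map Prod.snd).Perm (List.finRange n) := by
    simpa [Function.comp_def] using hperm.map Prod.snd
  refine Sat.bind (Sat.len u) (t₂ := n * 3 + 5) ?_ (by linarith)
  rintro _ rfl
  simp only [castN, mulR, sqrtR, sat_op_bind]
  set G := 2 * (√(u ⬝ᵥ u) * √(n * d)) with hG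
  have hG0 : 0 ≤ G := by positivity
  refine (Sat.cutAtGaps (G := G) sorted hsort).mono (by rw [hlen]; linarith) ?_
  rintro cs ⟨P, rfl, h1, h2, h3, h4⟩
  have hmemP : ∀ c ∈ P, ∀ x ∈ c, x ∈ sorted := fun c hc x hx => by
    rw [← h1]; exact List.mem_flatten.2 ⟨c, hc, hx⟩
  refine ⟨?_, ?_, ?_, ?_⟩
  · rw [← List.map_flatten, h1]; exact hpermI
  · intro c hc
    obtain ⟨c', hc', rfl⟩ := List.mem_map.1 hc
    simpa using h2 c' hc'
  · rintro S ⟨i₀, hi₀⟩ hS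
    have hin : ∀ i : Fin n, ∃ c ∈ P, ∃ x ∈ c, x.2 = i := fun i => by
      obtain ⟨x, hx, hxi⟩ := List.mem_map.1 (hpermI.mem_iff.2 (List.mem_finRange i))
      rw [← h1] at hx
      obtain ⟨c, hc, hxc⟩ := List.mem_flatten.1 hx
      exact ⟨c, hc, x, hxc, hxi⟩
    obtain ⟨c₀, hc₀, x₀, hx₀, hx₀i⟩ := hin i₀
    refine ⟨_, List.mem_map.2 ⟨c₀, hc₀, rfl⟩, fun i hi => ?_⟩
    obtain ⟨c, hc, x, hx, hxi⟩ := hin i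
    by_cases hcc : c = c₀
    · subst hcc
      exact List.mem_map.2 ⟨x, hx, hxi⟩
    · exfalso
      have hsym : P.Pairwise fun c c' => ∀ x ∈ c, ∀ y ∈ c', G < |y.1 - x.1| :=
        h4.imp fun h x hx y hy => (h x hx y hy).trans_le (le_abs_self _)
      have : G < |x₀.1 - x.1| := by
        have hR : Std.Symm fun c c' : List (ℝ × Fin n) => ∀ x ∈ c, ∀ y ∈ c', G < |y.1 - x.1| :=
          ⟨fun c c' h x hx y hy => by rw [abs_sub_comm]; exact h y hy x hx⟩
        exact hsym.forall hc hc₀ hcc x hx x₀ hx₀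
      rw [hmem x (hmemP c hc x hx), hmem x₀ (hmemP c₀ hc₀ x₀ hx₀), hxi, hx₀i, ← dotProduct_sub] at this
      refine absurd this (not_lt.2 ?_)
      have h5 := hS i₀ hi₀ i hi
      set z := X i₀ - X i
      have hcs : (u ⬝ᵥ z) ^ 2 ≤ (u ⬝ᵥ u) * (z ⬝ᵥ z) := by
        simp only [dotProduct, ← sq]
        exact Finset.sum_mul_sq_le_sq_mul_sq _ _ _
      have huu : 0 ≤ u ⬝ᵥ u := by simpa using dotProduct_star_self_nonneg u
      refine abs_le_of_sq_le_sq (hcs.trans ?_) hG0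
      have e : G ^ 2 = (u ⬝ᵥ u) * (4 * (n * d)) := by
        rw [hG, mul_pow, mul_pow, Real.sq_sqrt huu, Real.sq_sqrt (by positivity)]; ring
      rw [e]
      exact mul_le_mul_of_nonneg_left h5 huu
  · intro c hc i hi j hj
    obtain ⟨c', hc', rfl⟩ := List.mem_map.1 hc
    obtain ⟨x, hx, rfl⟩ := List.mem_map.1 hi
    obtain ⟨y, hy, rfl⟩ := List.mem_map.1 hj
    rw [← hmem x (hmemP _ hc' x hx), ← hmem y (hmemP _ hc' y hy)]
    have hsub : c'.Sublist sorted := h1 ▸ List.sublist_flatten_of_mem hc'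
    refine (sub_le_of_isChain hG0 c' (hsort.sublist hsub) (h3 c' hc') hy hx).trans ?_
    refine mul_le_mul_of_nonneg_right ?_ hG0
    exact_mod_cast hlen ▸ hsub.length_le

/-! ### Random integers -/

theorem Sat.randomInt (b : ℕ) : (randomInt b).Sat (4 * b) (fun x => 0 ≤ x ∧ x ≤ 2 ^ b) := by
  have := Sat.forEach (I := fun (l : List ℕ) (s : ℝ) => 0 ≤ s ∧ (s + 1) * 2 ^ l.length ≤ 2 ^ b)
    (w := fun _ => 3) (f := fun s _ => do
      let e ← bit
      let t ← addR s s
      addR t e) ?_ (List.range b) 0 (by simp)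
  · refine this.mono ?_ ?_
    · simp only [List.map_const', List.sum_replicate, nsmul_eq_mul, List.length_range]
      linarith
    · rintro x ⟨h1, h2⟩
      simp at h2
      exact ⟨h1, by linarith⟩
  · rintro i l s ⟨h1, h2⟩
    refine Sat.bind (t₁ := 1) (P := fun e => 0 ≤ e ∧ e ≤ 1) (Sat.flip fun e => Sat.ret (by norm_num)
      (by split_ifs <;> norm_num)) (t₂ := 2) (fun e he => ?_) (by norm_num)
    simp only [addR, sat_op_bind]
    refine Sat.op (by norm_num) ⟨by linarith [he.1], ?_⟩
    rw [List.length_cons, pow_succ] at h2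
    have : (0 : ℝ) < 2 ^ l.length := by positivity
    nlinarith [he.2]

theorem ev_randomInt_loop (g : ℝ → ℝ) (l : List ℕ) (s : ℝ) :
    (forEach l s (fun s _ => do
      let e ← bit
      let t ← addR s s
      addR t e)).ev g
      = (∑ k ∈ Finset.range (2 ^ l.length), g (2 ^ l.length * s + k)) / 2 ^ l.length := by
  induction l generalizing s with
  | nil => simp [forEach, ev]
  | cons i l ih =>
    have e : ∀ h : ℝ → ℝ, (do let e ← bit; let t ← addR s s; addR t e : RAM ℝ).ev h
        = (h (s + s + 1) + h (s + s + 0)) / 2 := fun h => rfl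
    change ((do let e ← bit; let t ← addR s s; addR t e : RAM ℝ) >>= fun s' => forEach l s' _).ev g
      = _
    rw [ev_bind, e, ih, ih, List.length_cons, pow_succ 2 l.length, pow_succ 2 l.length, mul_two,
      Finset.sum_range_add, ← add_div, div_div]
    congr 1
    rw [add_comm]
    congr 1
    · refine Finset.sum_congr rfl fun k _ => ?_
      congr 1; ring
    · refine Finset.sum_congr rfl fun k _ => ?_
      congr 1; push_cast; ring

-- The values `a + k z` form an arithmetic progression with step `|z|`, so at most `2 L / |z| + 1`
-- of them lie in an interval of length `2 L`.
open Classical in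
theorem ev_randomInt_le {b : ℕ} {a z L : ℝ} (hz : z ≠ 0) (hL : 0 ≤ L) :
    (randomInt b).ev (fun x => if |a + x * z| ≤ L then 1 else 0) ≤ (2 * L / |z| + 1) / 2 ^ b := by
  have h := ev_randomInt_loop (fun x => if |a + x * z| ≤ L then 1 else 0) (List.range b) 0
  rw [List.length_range] at h
  change (randomInt b).ev _ = _ at h
  rw [h]
  refine div_le_div_of_nonneg_right ?_ (by positivity)
  simp only [mul_zero, zero_add]
  rw [Finset.sum_boole]
  have hz' : 0 < |z| := abs_pos.2 hz
  set F := (Finset.range (2 ^ b)).filter fun k : ℕ => |a + k * z| ≤ L with hF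
  rcases F.eq_empty_or_nonempty with h0 | hne
  · rw [h0]; simp; positivity
  have h1 := F.min'_mem hne
  have h2 := F.max'_mem hne
  set k₀ := F.min' hne
  set k₁ := F.max' hne
  have hsub : F ⊆ Finset.Icc k₀ k₁ := fun k hk =>
    Finset.mem_Icc.2 ⟨F.min'_le k hk, F.le_max' k hk⟩
  have h01 : k₀ ≤ k₁ := F.min'_le_max' hne
  have hcard : (F.card : ℝ) ≤ k₁ + 1 - k₀ := by
    have := Finset.card_le_card hsub
    rw [Nat.card_Icc] at this
    have h3 : (F.card : ℝ) ≤ ((k₁ + 1 - k₀ : ℕ) : ℝ) := by exact_mod_cast this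
    rwa [Nat.cast_sub (by omega), Nat.cast_add, Nat.cast_one] at h3
  have h3 := (Finset.mem_filter.1 h1).2
  have h4 := (Finset.mem_filter.1 h2).2
  have h5 : ((k₁ : ℝ) - k₀) * |z| ≤ 2 * L := by
    have h01' : (0 : ℝ) ≤ (k₁ : ℝ) - k₀ := sub_nonneg.2 (by exact_mod_cast h01)
    rw [← abs_of_nonneg h01', ← abs_mul]
    have : ((k₁ : ℝ) - k₀) * z = (a + k₁ * z) - (a + k₀ * z) := by ring
    rw [this]
    exact (abs_sub _ _).trans (by linarith)
  rw [← le_div_iff₀ hz'] at h5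
  linarith

/-- One coordinate, of weight `ζ`, has been drawn by `r` and the coordinates in `l` are still to
come. Exchanging the order of averaging fixes the latter, which only shift the offset `a`, and the
hypothesis is uniform in `a`. -/
theorem ev_loop_shift_le (c r : RAM ℝ) {z : Fin d → ℝ} {h : ℝ → ℝ} {δ ζ : ℝ}
    (hδ : ∀ a, r.ev (fun x => h (a + x * ζ)) ≤ δ) (l : List (Fin d)) (hl : l.Nodup)
    (v : ℝ → Fin d → ℝ) (a : ℝ) (hv : ∀ x, ∀ j ∈ l, v x j = 0) (hva : ∀ x, v x ⬝ᵥ z = a + x * ζ) :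
    r.ev (fun x => (forEach l (v x) fun v j => do let y ← c; store v j y).ev
      (fun u => h (u ⬝ᵥ z))) ≤ δ := by
  induction l generalizing v a with
  | nil => simpa [forEach, ev, hva] using hδ a
  | cons j l ih =>
    have hl' := List.nodup_cons.1 hl
    have e : ∀ x, (forEach (j :: l) (v x) fun v j => do let y ← c; store v j y).ev
        (fun u => h (u ⬝ᵥ z)) = c.ev fun y => (forEach l (Function.update (v x) j y)
          fun v j => do let y ← c; store v j y).ev (fun u => h (u ⬝ᵥ z)) := fun x => by
      change ((c >>= fun y => store (v x) j y) >>= fun v' => forEach l v' _).ev _ = _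
      rw [ev_bind, ev_bind]
      rfl
    simp only [e]
    rw [ev_comm]
    refine (c.ev_mono fun y => ?_).trans (c.ev_const δ).le
    refine ih hl'.2 (fun x => Function.update (v x) j y) (a + y * z j) (fun x k hk => ?_)
      fun x => ?_
    · rw [Function.update_of_ne (by rintro rfl; exact hl'.1 hk)]
      exact hv x k (by simp [hk])
    · rw [update_dotProduct (hv x j (by simp)), hva]; ring

/-- Anti-concentration in a single coordinate `k` suffices: the coordinates before `k` are averaged
out and those after `k` are handled by `ev_loop_shift_le`. -/
theorem ev_loop_le (c : RAM ℝ) {z : Fin d → ℝ} {h : ℝ → ℝ} {δ : ℝ} {k : Fin d}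
    (hδ : ∀ a, c.ev (fun x => h (a + x * z k)) ≤ δ) (l : List (Fin d)) (hl : l.Nodup) (hk : k ∈ l)
    (v : Fin d → ℝ) (hv : ∀ j ∈ l, v j = 0) :
    (forEach l v fun v j => do let y ← c; store v j y).ev (fun u => h (u ⬝ᵥ z)) ≤ δ := by
  induction l generalizing v with
  | nil => simp at hk
  | cons j l ih =>
    have hl' := List.nodup_cons.1 hl
    have hupd : ∀ x : ℝ, ∀ i ∈ l, Function.update v j x i = 0 := fun x i hi => by
      rw [Function.update_of_ne (by rintro rfl; exact hl'.1 hi)]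
      exact hv i (by simp [hi])
    change ((c >>= fun y => store v j y) >>= fun v' => forEach l v' _).ev _ ≤ _
    rw [ev_bind, ev_bind]
    change c.ev (fun y => (forEach l (Function.update v j y) _).ev _) ≤ _
    by_cases hjk : k = j
    · subst hjk
      exact ev_loop_shift_le c c hδ l hl'.2 (fun y => Function.update v k y) (v ⬝ᵥ z) hupd
        fun x => update_dotProduct (hv k (by simp)) x
    · refine (c.ev_mono fun y => ?_).trans (c.ev_const δ).le
      exact ih hl'.2 (by simpa [hjk] using hk) _ (hupd y)

/-- A random integer vector is not almost orthogonal to a vector with a large coordinate. -/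
theorem whp_tabulate_randomInt {b : ℕ} {z : Fin d → ℝ} {L ζ : ℝ} (hζ : 0 < ζ) (hL : 0 ≤ L)
    {k : Fin d} (hz : ζ ≤ |z k|) :
    (tabulate fun _ : Fin d => randomInt b).Whp ((2 * L / ζ + 1) / 2 ^ b)
      (fun u => L < |u ⬝ᵥ z|) := by
  classical
  have hzk : 0 < |z k| := hζ.trans_le hz
  have := ev_loop_le (randomInt b) (z := z) (h := fun x => if |x| ≤ L then 1 else 0)
    (δ := (2 * L / ζ + 1) / 2 ^ b) (k := k) (fun a => ?_) (List.finRange d) (List.nodup_finRange d)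
    (List.mem_finRange k) (fun _ => 0) (by simp)
  · refine le_trans (ev_mono _ fun u => ?_) this
    by_cases h : |u ⬝ᵥ z| ≤ L
    · simp [h, not_lt.2 h]
    · simp [h, not_le.1 h]
  · refine (ev_randomInt_le (abs_pos.1 hzk) hL).trans ?_
    refine div_le_div_of_nonneg_right ?_ (by positivity)
    have : 2 * L / |z k| ≤ 2 * L / ζ := div_le_div_of_nonneg_left (by positivity) hζ hz
    linarith

/-- The number of random bits per coordinate. -/
def numBits (d : ℕ) : ℕ := ⌈7 * Real.log d / Real.log 2⌉₊

theorem Sat.naiveCluster {κ : ℕ} (hn : 1 ≤ n) (hκ : n ≤ 2 ^ κ) :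
    (naiveCluster X).Sat ((4 * numBits d + 2) * d + n * (5 * d + 4 * κ + 5) + 5 * d + 12) (fun cs =>
      cs.flatten.Perm (List.finRange n) ∧ (∀ c ∈ cs, c ≠ []) ∧
      (∀ S : Finset (Fin n), S.Nonempty →
        (∀ i ∈ S, ∀ j ∈ S, (X i - X j) ⬝ᵥ (X i - X j) ≤ 4 * (n * d)) →
        ∃ c ∈ cs, ∀ i ∈ S, i ∈ c)) := by
  unfold _root_.naiveCluster
  simp only [castN, logR, mulR, divR, ceilR, sat_op_bind]
  refine Sat.bind (Sat.tabulate fun _ => Sat.randomInt _)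
    (t₂ := n * (5 * d + 4 * κ + 5) + 5 * d + 6) (fun u _ => ?_) (by unfold numBits; linarith)
  exact (Sat.clusterAlong hn hκ u).mono le_rfl fun cs h => ⟨h.1, h.2.1, h.2.2.1⟩

/-- All entries of `u` are at most `2 ^ b`, so the projections of a cluster spread over at most `L =
2 n (n d) 2 ^ b`. A pair differing by more than `2 L` in some coordinate has projections this close
with probability at most `2 / 2 ^ b`; the union bound is over pairs. -/
theorem whp_naiveCluster {κ : ℕ} (hn : 1 ≤ n) (hd : 1 ≤ d) (hκ : n ≤ 2 ^ κ) :
    (naiveCluster X).Whp ((n : ℝ) ^ 2 * (2 / 2 ^ numBits d)) (fun cs => ∀ c ∈ cs, ∀ i ∈ c, ∀ j ∈ c,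
      ∀ k, |X i k - X j k| ≤ 4 * n * (n * d) * 2 ^ numBits d) := by
  unfold _root_.naiveCluster
  simp only [castN, logR, mulR, divR, ceilR, whp_op_bind]
  change (tabulate (fun _ => randomInt (numBits d)) >>= fun u => clusterAlong X u).Whp _ _
  set b := numBits d
  have hn' : (1 : ℝ) ≤ n := Nat.one_le_cast.2 hn
  have hd' : (1 : ℝ) ≤ d := Nat.one_le_cast.2 hd
  set ζ : ℝ := 4 * n * (n * d) * 2 ^ b with hζ
  set L : ℝ := 2 * n * (n * d) * 2 ^ b with hL
  have hζ0 : 0 < ζ := by positivity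
  have h1 := Whp.forall_mem (c := tabulate fun _ : Fin d => randomInt b)
    (Finset.univ : Finset (Fin n × Fin n)) (δ := 2 / 2 ^ b)
    (Q := fun ij u => ∀ k, ζ < |X ij.1 k - X ij.2 k| → L < |u ⬝ᵥ (X ij.1 - X ij.2)|) fun ij _ => ?_
  · have hcard : ((Finset.univ : Finset (Fin n × Fin n)).card : ℝ) = (n : ℝ) ^ 2 := by simp [sq]
    rw [hcard] at h1
    refine Whp.bind (h1.and_all (Sat.tabulate fun _ => Sat.randomInt b).2) (δ₂ := 0)
      (fun u hu => ?_) le_rfl (add_zero _).le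
    refine ((Sat.clusterAlong (X := X) hn hκ u).2.mono fun cs hcs c hc i hi j hj k => ?_).whp
    by_contra hcon
    have h2 := hu.1 (i, j) (Finset.mem_univ _) k (not_le.1 hcon)
    refine absurd h2 (not_lt.2 ?_)
    have h3 := hcs.2.2.2 c hc i hi j hj
    have h4 := hcs.2.2.2 c hc j hj i hi
    have h5 : |u ⬝ᵥ (X i - X j)| ≤ n * (2 * (√(u ⬝ᵥ u) * √(n * d))) := by
      rw [dotProduct_sub]
      exact abs_le.2 ⟨by linarith, h3⟩
    refine h5.trans ?_
    have h6 : u ⬝ᵥ u ≤ n * d * (2 ^ b) ^ 2 := by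
      calc u ⬝ᵥ u ≤ ∑ _j : Fin d, ((2 : ℝ) ^ b) ^ 2 := by
            refine Finset.sum_le_sum fun j _ => ?_
            rw [← sq]
            exact pow_le_pow_left₀ (hu.2 j).1 (hu.2 j).2 2
        _ = d * (2 ^ b) ^ 2 := by simp
        _ ≤ _ := by
          refine mul_le_mul_of_nonneg_right ?_ (by positivity)
          nlinarith
    have h7 : √(u ⬝ᵥ u) ≤ √(n * d) * 2 ^ b := by
      refine (Real.sqrt_le_sqrt h6).trans (le_of_eq ?_)
      rw [Real.sqrt_mul (by positivity), Real.sqrt_sq (by positivity)]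
    have h8 : √(u ⬝ᵥ u) * √(n * d) ≤ n * d * 2 ^ b := by
      calc √(u ⬝ᵥ u) * √(n * d) ≤ √(n * d) * 2 ^ b * √(n * d) :=
            mul_le_mul_of_nonneg_right h7 (Real.sqrt_nonneg _)
        _ = (√(n * d) * √(n * d)) * 2 ^ b := by ring
        _ = _ := by rw [Real.mul_self_sqrt (by positivity)]
    calc (n : ℝ) * (2 * (√(u ⬝ᵥ u) * √(n * d))) ≤ n * (2 * (n * d * 2 ^ b)) :=
          mul_le_mul_of_nonneg_left (by linarith) (by positivity)
      _ = L := by rw [hL]; ring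
  · by_cases h : ∃ k, ζ < |X ij.1 k - X ij.2 k|
    · obtain ⟨k, hk⟩ := h
      refine (whp_tabulate_randomInt (b := b) (z := X ij.1 - X ij.2) (L := L) hζ0 (by positivity)
        (k := k) hk.le).mono (le_of_eq ?_) fun u hu _ _ => hu
      have : 2 * L / ζ = 1 := by
        rw [div_eq_one_iff_eq hζ0.ne', hL, hζ]; ring
      rw [this]; norm_num
    · push Not at h
      exact ((all_true _).mono fun u _ k hk => absurd hk (not_lt.2 (h k))).whp.mono
        (by positivity) fun _ h => h

end Cluster
end

/-! ### The complete algorithm: cost, list size and success probability. -/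

noncomputable section
open Matrix RAM

section Main

variable {n d : ℕ} {X : Fin n → Fin d → ℝ}

/-- The treatment of one cluster. -/
def processCluster (c : MultifilterConsts) (X : Fin n → Fin d → ℝ) (α : ℝ) (T : List (Fin n)) :
    RAM (List (Fin d → ℝ)) := do
  let m ← size T
  let mR ← castN m
  let t ← divR n mR
  let αT ← mulR t α
  fastGaussianMultifilterBoundedDiameter c X T αT

theorem fastGaussianMultifilter_eq (c : MultifilterConsts) (α : ℝ) :
    fastGaussianMultifilter c X α = (do
      let clusters ← naiveCluster X
      let _ ← castN n
      forEach clusters [] (fun acc T => do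
        let L ← processCluster c X α T
        append L acc)) := by
  refine congrArg (fun f => naiveCluster X >>= f) (funext fun cs => ?_)
  change RAM.step (forEach cs [] _) = RAM.step (forEach cs [] _)
  congr 2
  funext acc T
  simp only [processCluster, RAM.bind_assoc]

/-- The cost of the whole algorithm. -/
def MultifilterConsts.totalCost (c : MultifilterConsts) (n d κ : ℕ) (E W : ℝ) : ℝ :=
  (4 * numBits d + 2) * d + n * (5 * d + 4 * κ + 5) + 5 * d + 13
    + n * (E * c.layersCost d κ W + 2 * E + 6)

theorem MultifilterConsts.layersCost_nonneg (c : MultifilterConsts) (d κ : ℕ) {W : ℝ} (hW : 0 ≤ W) :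
    0 ≤ c.layersCost d κ W := by
  unfold MultifilterConsts.layersCost partCost lineCost
  positivity

theorem length_flatten_eq_sum {ι : Type} (L : List (List ι)) :
    ((L.flatten).length : ℝ) = (L.map fun T => (T.length : ℝ)).sum := by
  induction L with
  | nil => simp
  | cons T L ih => simp only [List.flatten_cons, List.length_append, Nat.cast_add, ih,
      List.map_cons, List.sum_cons]

theorem length_flatten_le {ι κ : Type} {Q : κ → List ι → Prop} {f : κ → ℝ} {L : List κ}
    {P : List (List ι)} (h : List.Forall₂ Q L P)
    (hQ : ∀ T ∈ L, ∀ Ts, Q T Ts → (Ts.length : ℝ) ≤ f T) :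
    (P.flatten.length : ℝ) ≤ (L.map f).sum := by
  induction h with
  | nil => simp
  | @cons T Ts L P h _ ih =>
    have h1 := ih fun T hT => hQ T (by simp [hT])
    have h2 := hQ T (by simp) Ts h
    simp only [List.flatten_cons, List.length_append, Nat.cast_add, List.map_cons, List.sum_cons]
    linarith

/-- The clusters partition the data, so their potentials sum to at most `n * n ^ β ≤ n * E`. The
rescaled parameter satisfies `α_T |T| = n α`; hence a cluster returns at most `2 E |T| / (n α)`
means, and summation over `T` gives `2 E / α`. -/
theorem Sat.fastGaussianMultifilter {c : MultifilterConsts} {κ : ℕ} {α kb W E : ℝ} (hd : 1 ≤ d)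
    (hn : 1 ≤ n) (hα : 0 < α) (hnα : 1 ≤ n * α) (hκ : n ≤ 2 ^ κ) (hW : 0 ≤ W)
    (hE : (n : ℝ) ^ (1 / Real.log d) ≤ E)
    (hβ : 0 ≤ 1 / Real.log d)
    (hb : ∀ m : ℕ, 1 ≤ m → m ≤ n →
      Bounds c m κ (n / m * α) (1 / Real.log d) (c.lossDirs d) (c.radius d) kb W)
    (hD : 1 ≤ c.numLayers d) :
    (fastGaussianMultifilter c X α).Sat (c.totalCost n d κ E W)
      (fun r => (r.length : ℝ) ≤ 2 * E / α) := by
  rw [fastGaussianMultifilter_eq]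
  set U := c.layersCost d κ W with hU
  have hU0 : 0 ≤ U := c.layersCost_nonneg d κ hW
  have hn' : (0 : ℝ) < n := by exact_mod_cast hn
  have hE0 : 0 ≤ E := le_trans (by positivity) hE
  refine Sat.bind (Sat.naiveCluster hn hκ) (t₂ := 1 + n * (E * U + 2 * E + 6)) (fun cs hcs => ?_)
    (by unfold MultifilterConsts.totalCost; linarith)
  obtain ⟨h1, h2, -⟩ := hcs
  simp only [castN, sat_op_bind]
  have hsum : (cs.map fun T => (T.length : ℝ)).sum = n := by
    rw [← length_flatten_eq_sum, h1.length_eq, List.length_finRange]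
  have hT : ∀ T ∈ cs, 1 ≤ T.length ∧ T.length ≤ n ∧ T.Nodup := fun T hT => by
    have hsub := List.sublist_flatten_of_mem hT
    refine ⟨List.length_pos_iff.2 (h2 T hT), ?_,
      (h1.nodup_iff.2 (List.nodup_finRange n)).sublist hsub⟩
    have := hsub.length_le
    rwa [h1.length_eq, List.length_finRange] at this
  have hpow : ∀ T ∈ cs, (T.length : ℝ) ^ (1 + 1 / Real.log d) ≤ T.length * E := fun T hTc => by
    have h3 : (0 : ℝ) < T.length := by exact_mod_cast (hT T hTc).1
    rw [Real.rpow_add h3, Real.rpow_one]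
    refine mul_le_mul_of_nonneg_left (le_trans ?_ hE) h3.le
    exact Real.rpow_le_rpow h3.le (by exact_mod_cast (hT T hTc).2.1) hβ
  have hlen : ∀ T ∈ cs, ∀ Ts : List (Fin d → ℝ),
      Ts.length * (n / T.length * α * T.length / 2) ≤ (T.length : ℝ) ^ (1 + 1 / Real.log d) →
      (Ts.length : ℝ) ≤ T.length * (2 * E / (n * α)) := fun T hTc Ts h => by
    have h3 : (0 : ℝ) < T.length := by exact_mod_cast (hT T hTc).1
    have e : (n : ℝ) / T.length * α * T.length / 2 = n * α / 2 := by field_simp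
    rw [e] at h
    have h4 := h.trans (hpow T hTc)
    rw [← mul_div_assoc, le_div_iff₀ (by positivity)]
    linarith
  refine (Sat.forEach_append (w := fun T : List (Fin n) => 2 * (T.length : ℝ) + 3 + T.length * E * U)
    (Q := fun T Ts => Ts.length * (n / T.length * α * T.length / 2)
      ≤ (T.length : ℝ) ^ (1 + 1 / Real.log d)) cs [] (fun T hTc => ?_)
    (fun T => T.length * (2 * E / (n * α))) hlen).mono ?_ ?_
  · unfold processCluster
    refine Sat.bind (Sat.size T) (t₂ := 3 + T.length * E * U) ?_ (by linarith)
    rintro _ rfl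
    simp only [castN, divR, mulR, sat_op_bind]
    obtain ⟨g1, g2, g3⟩ := hT T hTc
    refine (Sat.boundedDiameter hd (h2 T hTc) g3 (hb T.length g1 g2) hD).mono ?_ fun _ h => h
    have := mul_le_mul_of_nonneg_right (hpow T hTc) hU0
    linarith
  · calc _ ≤ (cs.map fun T => (T.length : ℝ) * (E * U + 2 * E + 6)).sum := by
          refine List.sum_le_sum fun T hTc => ?_
          have h3 : (1 : ℝ) ≤ T.length := by exact_mod_cast (hT T hTc).1
          have h4 : 2 * E / (n * α) ≤ 2 * E := div_le_self (by positivity) hnα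
          have h5 := mul_le_mul_of_nonneg_left h4 (by positivity : (0 : ℝ) ≤ (T.length : ℝ))
          linarith
      _ = n * (E * U + 2 * E + 6) := by rw [List.sum_map_mul_right, hsum]
      _ ≤ _ := by linarith
  · rintro r ⟨P, hP, hr⟩
    rw [List.append_nil] at hr
    rw [hr.length_eq]
    refine (length_flatten_le hP hlen).trans ?_
    rw [List.sum_map_mul_right, hsum]
    refine le_of_eq ?_
    field_simp

theorem Concentrated.mono {S : Finset (Fin n)} {ρ ρ' ε : ℝ} (h : Concentrated X S ρ ε)
    (hρ : ρ ≤ ρ') : Concentrated X S ρ' ε := fun v => by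
  obtain ⟨ν, hν⟩ := h v
  refine ⟨ν, le_trans ?_ hν⟩
  refine Nat.cast_le.2 (Finset.card_le_card fun i hi => ?_)
  rw [Finset.mem_filter] at hi ⊢
  exact ⟨hi.1, lt_of_le_of_lt (mul_le_mul_of_nonneg_right hρ (Real.sqrt_nonneg _)) hi.2⟩

theorem trace_setCov_pow_le_of_diam {N q : ℕ} {s : Finset (Fin n)} (hN : s.card ≤ N) {ζ : ℝ}
    (h : ∀ i ∈ s, ∀ j ∈ s, ∀ k, |X i k - X j k| ≤ ζ) :
    (setCov X N s ^ q).trace ≤ d * (d * ζ ^ 2) ^ q := by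
  refine (posSemidef_setCov X N s).trace_pow_le_of_quadForm_le (fun x hx => ?_) q
  rw [quadForm_setCov]
  have h1 : ∀ i ∈ s, ((X i - setMean X s) ⬝ᵥ x) ^ 2 ≤ d * ζ ^ 2 := fun i hi => by
    have h2 := dotProduct_self_mulVec_sub_setMean_le (X := X) (s := s) (Q := 1) (ρ := d * ζ ^ 2)
      (fun i hi j hj => ?_) hi
    · rw [one_mulVec] at h2
      refine le_trans ?_ h2
      have hcs : ((X i - setMean X s) ⬝ᵥ x) ^ 2
          ≤ ((X i - setMean X s) ⬝ᵥ (X i - setMean X s)) * (x ⬝ᵥ x) := by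
        simp only [dotProduct, ← sq]
        exact Finset.sum_mul_sq_le_sq_mul_sq _ _ _
      rwa [hx, mul_one] at hcs
    · rw [one_mulVec]
      calc (X i - X j) ⬝ᵥ (X i - X j) ≤ ∑ _k : Fin d, ζ ^ 2 := by
            refine Finset.sum_le_sum fun k _ => ?_
            rw [← sq, ← sq_abs]
            exact pow_le_pow_left₀ (abs_nonneg _) (h i hi j hj k) 2
        _ = d * ζ ^ 2 := by simp
  have h3 : ∑ i ∈ s, ((X i - setMean X s) ⬝ᵥ x) ^ 2 ≤ N * (d * ζ ^ 2) := by
    refine (Finset.sum_le_sum h1).trans ?_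
    rw [Finset.sum_const, nsmul_eq_mul]
    exact mul_le_mul_of_nonneg_right (by exact_mod_cast hN) (by positivity)
  rcases N.eq_zero_or_pos with rfl | hN0
  · simp; positivity
  rw [inv_mul_le_iff₀ (by exact_mod_cast hN0)]
  exact h3

/-- Success depends only on the cluster that contains `S`. It has at least `|S|` points, which is
why the tightness conditions are required from that size on, and its rescaled parameter satisfies
`α_T |T| = |S|`. -/
theorem whp_fastGaussianMultifilter {c : MultifilterConsts} {κ : ℕ} {α kb W ε B ρ : ℝ}
    (hd : 1 ≤ d) (hn : 1 ≤ n) (hκ : n ≤ 2 ^ κ) (hα : 0 < α) {S : Finset (Fin n)}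
    (hS0 : 0 < S.card) (hSα : (S.card : ℝ) = α * n)
    (hb : ∀ m : ℕ, 1 ≤ m → m ≤ n →
      Bounds c m κ (n / m * α) (1 / Real.log d) (c.lossDirs d) (c.radius d) kb W)
    (ht : ∀ m : ℕ, S.card ≤ m → m ≤ n →
      Tight c (n / m * α) (1 / Real.log d) (1 / (c.lossDirs d * m)) m ∧
        ρ ≤ c.radius d / (4 * numSplits c (n / m * α) (1 / Real.log d) (1 / (c.lossDirs d * m))))
    (hS : Concentrated X S ρ ε) (hε0 : 0 ≤ ε) (hB : 128 ≤ B)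
    (hε : c.numLayers d * (c.numDirs d * ε) ≤ S.card / 2)
    (h0 : (64 / B) ^ c.numLayers d * (d * (d * (4 * n * (n * d) * 2 ^ numBits d) ^ 2)
        ^ (2 * ⌈Real.log d⌉₊ + 1))
      ≤ d * (B * c.radius d ^ 2) ^ (2 * ⌈Real.log d⌉₊ + 1))
    (hp : 2 * (d : ℝ) ≤ Real.exp 2 ^ (2 * ⌈Real.log d⌉₊ + 1)) {μ : Fin d → ℝ}
    (hS2 : ∀ x : Fin d → ℝ, ∑ i ∈ S, ((X i - μ) ⬝ᵥ x) ^ 2 ≤ S.card * (x ⬝ᵥ x)) :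
    (fastGaussianMultifilter c X α).Whp ((n : ℝ) ^ 2 * (2 / 2 ^ numBits d) +
      c.numLayers d * ((n : ℝ) ^ 2 * (7 / 8) ^ c.numDirs d)) (fun r => ∃ m ∈ r,
        (m - μ) ⬝ᵥ (m - μ) ≤ 4 * (Real.exp 2 * (B * c.radius d ^ 2)) / α + 4) := by
  rw [fastGaussianMultifilter_eq]
  have hn' : (0 : ℝ) < n := by exact_mod_cast hn
  have hd' : (1 : ℝ) ≤ d := by exact_mod_cast hd
  refine Whp.bind ((whp_naiveCluster hn hd hκ).and_all (Sat.naiveCluster hn hκ).2)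
    (δ₂ := c.numLayers d * ((n : ℝ) ^ 2 * (7 / 8) ^ c.numDirs d)) (fun cs hcs => ?_)
    (by positivity) le_rfl
  obtain ⟨hdiam, h1, h2, h3⟩ := hcs
  simp only [castN, whp_op_bind]
  -- Testing the second moment bound with `y = X i - μ` itself and keeping only the term `i` gives
  -- `‖y‖⁴ ≤ |S| ‖y‖²`. Thus `S` has diameter at most `2 √n`, and the clustering cannot separate it.
  have hyy : ∀ i ∈ S, (X i - μ) ⬝ᵥ (X i - μ) ≤ S.card := fun i hi => by
    set y := X i - μ
    have h4 := (Finset.single_le_sum (f := fun i => ((X i - μ) ⬝ᵥ y) ^ 2)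
      (fun i _ => sq_nonneg _) hi).trans (hS2 y)
    have hy0 : 0 ≤ y ⬝ᵥ y := by simpa using dotProduct_star_self_nonneg y
    rcases hy0.eq_or_lt with h | h
    · rw [← h]; positivity
    · refine le_of_mul_le_mul_right ?_ h
      rw [← sq]; exact h4
  have hSn : S.card ≤ n := by simpa using Finset.card_le_univ S
  obtain ⟨T, hT, hST⟩ := h3 S (Finset.card_pos.1 hS0) fun i hi j hj => by
    have e : X i - X j = (X i - μ) - (X j - μ) := by abel
    have h5 := hyy i hi
    have h6 := hyy j hj
    have h7 : (X i - X j) ⬝ᵥ (X i - X j)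
        ≤ 2 * ((X i - μ) ⬝ᵥ (X i - μ)) + 2 * ((X j - μ) ⬝ᵥ (X j - μ)) := by
      have h8 : 0 ≤ ((X i - μ) + (X j - μ)) ⬝ᵥ ((X i - μ) + (X j - μ)) := by
        simpa using dotProduct_star_self_nonneg ((X i - μ) + (X j - μ))
      rw [e]
      simp only [add_dotProduct, dotProduct_add, sub_dotProduct, dotProduct_sub] at h8 ⊢
      linarith
    have h8 : (S.card : ℝ) ≤ n := by exact_mod_cast hSn
    nlinarith
  have hsub := List.sublist_flatten_of_mem hT
  have hnd : T.Nodup := (h1.nodup_iff.2 (List.nodup_finRange n)).sublist hsub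
  have hTn : T.length ≤ n := by
    have := hsub.length_le
    rwa [h1.length_eq, List.length_finRange] at this
  have hT1 : 1 ≤ T.length := List.length_pos_iff.2 (h2 T hT)
  have hT0 : (0 : ℝ) < T.length := by exact_mod_cast hT1
  have hSub : S ⊆ T.toFinset := fun i hi => List.mem_toFinset.2 (hST i hi)
  have hST' : S.card ≤ T.length := (Finset.card_le_card hSub).trans (List.toFinset_card_le _)
  have hS0' : (0 : ℝ) < S.card := by exact_mod_cast hS0
  refine Whp.forEach_append_exists (by positivity) (T := T) ?_ cs [] hT
  unfold processCluster
  refine Whp.bind (Sat.size T).2.whp (δ₂ := c.numLayers d * ((n : ℝ) ^ 2 * (7 / 8) ^ c.numDirs d))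
    ?_ (by positivity) (zero_add _).le
  rintro _ rfl
  simp only [castN, divR, mulR, whp_op_bind]
  obtain ⟨ht1, ht2⟩ := ht T.length hST' hTn
  refine (whp_boundedDiameter (X := X) hd (h2 T hT) hnd (hb T.length hT1 hTn) ht1 hSub hS0
    (hS.mono ht2) hε0 hB ?_ hε ?_ hp hS2).mono le_rfl ?_
  · rw [hSα]; field_simp
  · refine le_trans (mul_le_mul_of_nonneg_left (trace_setCov_pow_le_of_diam
      (List.toFinset_card_le _) fun i hi j hj => ?_) (by positivity)) h0
    rw [List.mem_toFinset] at hi hj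
    exact hdiam T hT i hi j hj
  · rintro r ⟨m, hm, hmb⟩
    refine ⟨m, hm, hmb.trans (add_le_add_left ?_ _)⟩
    have hR := (hb T.length hT1 hTn).R_pos
    rw [div_le_div_iff₀ hS0' hα, hSα]
    have : (T.length : ℝ) ≤ n := by exact_mod_cast hTn
    have h9 : 0 ≤ 4 * (Real.exp 2 * (B * c.radius d ^ 2)) * α := by positivity
    nlinarith

end Main
end

noncomputable section
open Matrix RAM

/-! ### The assumptions on the data -/

section Data

variable {n d : ℕ} {X : Fin n → EuclideanSpace ℝ (Fin d)} {S : Finset (Fin n)}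
  {μ : EuclideanSpace ℝ (Fin d)}

theorem BoundedSecondMoment.sum_sq_le (h : BoundedSecondMoment X S μ) (hS : 0 < S.card)
    (x : Fin d → ℝ) :
    ∑ i ∈ S, (((fun j => X i j) - fun j => μ j) ⬝ᵥ x) ^ 2 ≤ S.card * (x ⬝ᵥ x) := by
  have h1 := h.dotProduct_mulVec_nonneg x
  rw [star_trivial, sub_mulVec, one_mulVec, smul_mulVec, sum_mulVec, dotProduct_sub,
    dotProduct_smul, dotProduct_sum, smul_eq_mul] at h1
  have h2 : ∑ i ∈ S, x ⬝ᵥ (vecMulVec (fun j => X i j - μ j) (fun j => X i j - μ j) *ᵥ x)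
      = ∑ i ∈ S, (((fun j => X i j) - fun j => μ j) ⬝ᵥ x) ^ 2 := by
    refine Finset.sum_congr rfl fun i _ => ?_
    rw [vecMulVec_mulVec, op_smul_eq_smul, dotProduct_smul, smul_eq_mul, sq, dotProduct_comm x]
    rfl
  rw [h2] at h1
  have hS' : (0 : ℝ) < S.card := by exact_mod_cast hS
  rw [sub_nonneg, inv_mul_le_iff₀ hS'] at h1
  exact h1

/-- The tails on the two sides of `μ` come from the unit vectors along `v` and `-v`, whence the
factor `2`. -/
theorem GaussianTails.concentrated {c₁ c₂ ρ : ℝ} (h : GaussianTails c₁ c₂ X S μ) (hS : 0 < S.card)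
    (hρ : 0 ≤ ρ) (hc : 0 ≤ 1 / (c₂ * Real.log d ^ 3)) :
    Concentrated (fun i j => X i j) S ρ
      (2 * S.card * (Real.exp (-(c₁ * ρ ^ 2)) + 1 / (c₂ * Real.log d ^ 3))) := by
  classical
  intro v
  have hS' : (0 : ℝ) < S.card := by exact_mod_cast hS
  have hvv : 0 ≤ v ⬝ᵥ v := by simpa using dotProduct_star_self_nonneg v
  refine ⟨v ⬝ᵥ fun j => μ j, ?_⟩
  by_cases hv : v = 0
  · subst hv
    simp only [dotProduct_zero, zero_dotProduct, Real.sqrt_zero, mul_zero, sub_self, abs_zero,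
      lt_self_iff_false, Finset.filter_false, Finset.card_empty, Nat.cast_zero]
    positivity
  set s := √(v ⬝ᵥ v) with hs
  have hs0 : 0 < s := Real.sqrt_pos.2 (lt_of_le_of_ne hvv fun h0 =>
    hv (dotProduct_self_eq_zero.1 h0.symm))
  set w : EuclideanSpace ℝ (Fin d) := WithLp.toLp 2 (s⁻¹ • v) with hw
  have hw1 : ‖w‖ = 1 := by
    rw [EuclideanSpace.norm_eq, Real.sqrt_eq_one]
    have : ∑ i, ‖w i‖ ^ 2 = (s⁻¹ • v) ⬝ᵥ (s⁻¹ • v) := by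
      simp only [hw, dotProduct, Real.norm_eq_abs, sq, abs_mul_abs_self]
    rw [this, smul_dotProduct, dotProduct_smul, smul_eq_mul, smul_eq_mul, ← mul_assoc, ← mul_inv,
      hs, Real.mul_self_sqrt hvv, inv_mul_cancel₀]
    intro h0
    rw [hs, h0, Real.sqrt_zero] at hs0
    exact lt_irrefl _ hs0
  have hin : ∀ i, inner ℝ (X i - μ) w = s⁻¹ * (v ⬝ᵥ (fun j => X i j) - v ⬝ᵥ fun j => μ j) := by
    intro i
    rw [EuclideanSpace.inner_eq_star_dotProduct, star_trivial, ← dotProduct_sub]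
    change (s⁻¹ • v) ⬝ᵥ _ = _
    rw [smul_dotProduct, smul_eq_mul]
    rfl
  have h1 := h w hw1 ρ hρ
  have h2 := h (-w) (by rw [norm_neg, hw1]) ρ hρ
  rw [div_le_iff₀ hS'] at h1 h2
  have hsub : (S.filter fun i => ρ * s < |v ⬝ᵥ (fun j => X i j) - v ⬝ᵥ fun j => μ j|) ⊆
      (S.filter fun i => ρ < inner ℝ (X i - μ) w) ∪ (S.filter fun i => ρ < inner ℝ (X i - μ) (-w)) := by
    intro i hi
    rw [Finset.mem_filter] at hi
    rw [Finset.mem_union, Finset.mem_filter, Finset.mem_filter, inner_neg_right, hin i,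
      inv_mul_eq_div, ← neg_div, lt_div_iff₀ hs0, lt_div_iff₀ hs0]
    rcases lt_abs.1 hi.2 with h | h
    · exact Or.inl ⟨hi.1, h⟩
    · exact Or.inr ⟨hi.1, h⟩
  have hcard := (Finset.card_le_card hsub).trans (Finset.card_union_le _ _)
  have hcard' : ((S.filter fun i => ρ * s <
      |v ⬝ᵥ (fun j => X i j) - v ⬝ᵥ fun j => μ j|).card : ℝ) ≤
      (S.filter fun i => ρ < inner ℝ (X i - μ) w).card
        + (S.filter fun i => ρ < inner ℝ (X i - μ) (-w)).card := by exact_mod_cast hcard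
  refine hcard'.trans ?_
  linarith

end Data

/-! ### Numerical estimates -/

section Numerics

/-- The bound `log (1 + 1 / x) ≥ 1 / (2 x)` makes the power at least `ℓ ^ 2 / 2`, and `log 2 * ℓ ^ 2
/ 2 > ℓ` for `ℓ ≥ 4`. The factor `8` is the constant `split` of the algorithm. -/
theorem lt_log_two_mul_one_add_pow {x ℓ : ℝ} {K : ℕ} (hx : 1 ≤ x) (hℓ : 4 ≤ ℓ)
    (hK : 8 * x * Real.log ℓ ≤ K) : ℓ < Real.log 2 * (1 + 1 / x) ^ ((K - 1) / 2) := by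
  set j := (K - 1) / 2 with hj
  have hx0 : 0 < x := by linarith
  have hj' : (K : ℝ) / 2 - 1 ≤ j := by
    have : K ≤ 2 * j + 2 := by omega
    have : (K : ℝ) ≤ 2 * j + 2 := by exact_mod_cast this
    linarith
  have hlog : 1 / (2 * x) ≤ Real.log (1 + 1 / x) := by
    refine le_trans ?_ (Real.one_sub_inv_le_log_of_pos (by positivity))
    have e : 1 - (1 + 1 / x)⁻¹ = 1 / (x + 1) := by field_simp; ring
    rw [e]
    exact one_div_le_one_div_of_le (by positivity) (by linarith)
  have h1 : ℓ ^ 2 / 2 ≤ (1 + 1 / x) ^ j := by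
    have h2 : (1 + 1 / x) ^ j = Real.exp (j * Real.log (1 + 1 / x)) := by
      rw [mul_comm, Real.exp_mul, Real.exp_log (by positivity), Real.rpow_natCast]
    have h3 : 2 * Real.log ℓ - 1 / 2 ≤ j * Real.log (1 + 1 / x) := by
      have h4 : (j : ℝ) * (1 / (2 * x)) ≤ j * Real.log (1 + 1 / x) :=
        mul_le_mul_of_nonneg_left hlog (by positivity)
      refine le_trans ?_ h4
      rw [mul_one_div, le_div_iff₀ (by positivity)]
      nlinarith
    rw [h2]
    refine le_trans ?_ (Real.exp_le_exp.2 h3)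
    rw [sub_eq_add_neg, Real.exp_add, mul_comm 2, Real.exp_mul, Real.exp_log (by linarith)]
    have h5 := Real.add_one_le_exp (-(1 / 2 : ℝ))
    have h6 : ℓ ^ (2 : ℝ) = ℓ ^ 2 := by norm_cast
    rw [h6]
    nlinarith [sq_nonneg ℓ]
  have h2 := Real.log_two_gt_d9
  nlinarith [sq_nonneg ℓ]

/-- The dimension is large compared with the constants. -/
structure LargeDim (c₁ c₂ : ℝ) (d : ℕ) : Prop where
  log_ge : 10 ≤ Real.log d
  c₂_le : c₂ ≤ Real.log d
  depth : 1 ≤ c₂ / 1040 * Real.log d ^ 2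
  rad : 1 ≤ 136 / √c₁ * Real.log d
  cube_le : 65 * Real.log d ^ 3 ≤ d
  sq_le : 2 * (c₂ / 1040) * Real.log d ^ 2 ≤ d

/-- The constants of the algorithm. -/
def multifilterConsts (c₁ c₂ : ℝ) : MultifilterConsts where
  -- The directions must give `(7 / 8) ^ (64 log d) ≤ d ^ (-8)`. In `rad`, `136 = 4 * 17 * 2`: the
  -- overlap `R / (4 k_max)` with `k_max ≤ 17 log d log log d` has to be at least `(2 / √c₁) √(log
  -- log d)`. In `depth`, `1040` makes the loss over all layers and directions at most half of `S`.
  dir := 64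
  split := 8
  rad := 136 / √c₁
  loss := 1
  depth := c₂ / 1040

variable {c₁ c₂ : ℝ} {n d : ℕ}

namespace LargeDim

theorem d_pos (h : LargeDim c₁ c₂ d) : (0 : ℝ) < d := by
  have h1 := h.log_ge
  have h2 := h.cube_le
  have : (0 : ℝ) < 65 * Real.log d ^ 3 := by positivity
  linarith

theorem le_d (h : LargeDim c₁ c₂ d) : (64 : ℝ) ≤ d := by
  have h1 := h.log_ge
  have h2 := h.cube_le
  have : (1 : ℝ) ≤ Real.log d ^ 3 := one_le_pow₀ (by linarith)
  linarith

theorem exp_log (h : LargeDim c₁ c₂ d) : Real.exp (Real.log d) = d := Real.exp_log h.d_pos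

theorem exp_mul_log (h : LargeDim c₁ c₂ d) (k : ℕ) : Real.exp (k * Real.log d) = (d : ℝ) ^ k := by
  rw [Real.exp_nat_mul, h.exp_log]

theorem one_le_loglog (h : LargeDim c₁ c₂ d) : 1 ≤ Real.log (Real.log d) := by
  rw [Real.le_log_iff_exp_le (by linarith [h.log_ge])]
  have := Real.exp_one_lt_d9
  linarith [h.log_ge]

theorem numDirs_ge (_h : LargeDim c₁ c₂ d) :
    64 * Real.log d ≤ (multifilterConsts c₁ c₂).numDirs d := Nat.le_ceil _

theorem numDirs_le (h : LargeDim c₁ c₂ d) :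
    ((multifilterConsts c₁ c₂).numDirs d : ℝ) ≤ 65 * Real.log d := by
  have h1 := h.log_ge
  refine (Nat.ceil_lt_add_one (by simp only [multifilterConsts]; positivity)).le.trans ?_
  simp only [multifilterConsts]
  linarith

theorem lossDirs_ge (h : LargeDim c₁ c₂ d) :
    64 * Real.log d ^ 3 ≤ (multifilterConsts c₁ c₂).lossDirs d := by
  have h1 := h.log_ge
  have h2 := mul_le_mul_of_nonneg_left h.numDirs_ge (sq_nonneg (Real.log d))
  simp only [MultifilterConsts.lossDirs, show (multifilterConsts c₁ c₂).loss = 1 from rfl]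
  nlinarith

theorem lossDirs_le (h : LargeDim c₁ c₂ d) : (multifilterConsts c₁ c₂).lossDirs d ≤ d := by
  have h1 := h.log_ge
  have h2 := mul_le_mul_of_nonneg_left h.numDirs_le (sq_nonneg (Real.log d))
  have h3 := h.cube_le
  simp only [MultifilterConsts.lossDirs, show (multifilterConsts c₁ c₂).loss = 1 from rfl]
  nlinarith

theorem numLayers_ge (_h : LargeDim c₁ c₂ d) :
    c₂ / 1040 * Real.log d ^ 2 ≤ (multifilterConsts c₁ c₂).numLayers d := by
  rw [sq]
  exact Nat.le_ceil _

theorem numLayers_le (h : LargeDim c₁ c₂ d) :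
    ((multifilterConsts c₁ c₂).numLayers d : ℝ) ≤ 2 * (c₂ / 1040) * Real.log d ^ 2 := by
  have h1 := h.depth
  rw [sq] at h1
  refine (Nat.ceil_lt_add_one (by simp only [multifilterConsts]; linarith)).le.trans ?_
  simp only [multifilterConsts]
  linarith

theorem one_le_numLayers (h : LargeDim c₁ c₂ d) : 1 ≤ (multifilterConsts c₁ c₂).numLayers d := by
  have := h.depth.trans h.numLayers_ge
  exact_mod_cast this

theorem radius_ge (h : LargeDim c₁ c₂ d) : 1 ≤ (multifilterConsts c₁ c₂).radius d := by
  have h1 := Real.one_le_rpow h.one_le_loglog (by norm_num : (0 : ℝ) ≤ 3 / 2)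
  have h2 := h.rad
  exact one_le_mul_of_one_le_of_one_le h2 h1

/-- Size of the quantity `1 / (α Δ)` for a cluster of `m` points. -/
theorem abs_log_le (h : LargeDim c₁ c₂ d) {α : ℝ} (hα : 0 < α) (hα1 : α ≤ 1) (hnα : 1 ≤ n * α)
    (hnd : (n : ℝ) ^ 2 ≤ d ^ 5) {m : ℕ} (hm : 1 ≤ m) (hmn : m ≤ n) :
    |Real.log (1 / (n / m * α * (1 / ((multifilterConsts c₁ c₂).lossDirs d * m))))|
      ≤ Real.log d ^ 2 := by
  set Λ := (multifilterConsts c₁ c₂).lossDirs d with hΛ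
  have hx := h.log_ge
  have hm' : (1 : ℝ) ≤ m := by exact_mod_cast hm
  have hmn' : (m : ℝ) ≤ n := by exact_mod_cast hmn
  have hn' : (1 : ℝ) ≤ n := hm'.trans hmn'
  have hΛ1 : 1 ≤ Λ := by
    refine le_trans ?_ h.lossDirs_ge
    have : (1 : ℝ) ≤ Real.log d ^ 3 := one_le_pow₀ (by linarith)
    linarith
  have hΛd := h.lossDirs_le
  rw [← hΛ] at hΛd
  -- This quantity lies between `d ^ (-6)` and `d ^ 6`, so its logarithm is at most `6 log d` in
  -- absolute value.
  have e : 1 / (n / m * α * (1 / (Λ * m))) = m ^ 2 * Λ / (n * α) := by field_simp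
  rw [e]
  have hd := h.d_pos
  have hle : (m : ℝ) ^ 2 * Λ / (n * α) ≤ (d : ℝ) ^ 6 := by
    refine (div_le_self (by positivity) hnα).trans ?_
    calc (m : ℝ) ^ 2 * Λ ≤ (n : ℝ) ^ 2 * d := by gcongr
      _ ≤ (d : ℝ) ^ 5 * d := by gcongr
      _ = _ := by ring
  have hge : ((d : ℝ) ^ 6)⁻¹ ≤ (m : ℝ) ^ 2 * Λ / (n * α) := by
    rw [inv_le_comm₀ (by positivity) (by positivity), inv_div]
    have h1 : (1 : ℝ) ≤ (m : ℝ) ^ 2 * Λ := one_le_mul_of_one_le_of_one_le (one_le_pow₀ hm') hΛ1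
    refine (div_le_self (by positivity) h1).trans ?_
    have h2 : (n : ℝ) * α ≤ n ^ 2 := by nlinarith
    have h3 : (1 : ℝ) ≤ d := by linarith [h.le_d]
    calc (n : ℝ) * α ≤ d ^ 5 := h2.trans hnd
      _ ≤ d ^ 6 := pow_le_pow_right₀ h3 (by norm_num)
  have h6 : (6 : ℝ) * Real.log d ≤ Real.log d ^ 2 := by nlinarith
  rw [abs_le]
  constructor
  · have := Real.log_le_log (by positivity) hge
    rw [Real.log_inv, Real.log_pow] at this
    push_cast at this
    linarith
  · have := Real.log_le_log (by positivity) hle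
    rw [Real.log_pow] at this
    push_cast at this
    linarith

theorem numSplits_le (h : LargeDim c₁ c₂ d) {α : ℝ} (hα : 0 < α) (hα1 : α ≤ 1) (hnα : 1 ≤ n * α)
    (hnd : (n : ℝ) ^ 2 ≤ d ^ 5) {m : ℕ} (hm : 1 ≤ m) (hmn : m ≤ n) :
    (numSplits (multifilterConsts c₁ c₂) (n / m * α) (1 / Real.log d)
      (1 / ((multifilterConsts c₁ c₂).lossDirs d * m)) : ℝ)
      ≤ 17 * Real.log d * Real.log (Real.log d) := by
  have h1 := h.abs_log_le hα hα1 hnα hnd hm hmn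
  unfold numSplits
  set ℓ := Real.log (1 / (n / m * α * (1 / ((multifilterConsts c₁ c₂).lossDirs d * m))))
  have hx := h.log_ge
  have hy := h.one_le_loglog
  have h2 : Real.log ℓ ≤ 2 * Real.log (Real.log d) := by
    -- For a tiny cluster `ℓ` may be zero or negative. The values `Real.log 0 = 0` and `Real.log ℓ =
    -- Real.log |ℓ|` keep the number of thresholds bounded there.
    rcases eq_or_ne ℓ 0 with h0 | h0
    · rw [h0, Real.log_zero]; linarith
    · rw [← Real.log_abs]
      have := Real.log_le_log (abs_pos.2 h0) h1
      rwa [Real.log_pow] at this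
  have h3 : (multifilterConsts c₁ c₂).split * Real.log ℓ / (1 / Real.log d)
      ≤ 16 * Real.log d * Real.log (Real.log d) := by
    simp only [show (multifilterConsts c₁ c₂).split = 8 from rfl, div_div_eq_mul_div, div_one]
    nlinarith
  have h4 : (⌈(multifilterConsts c₁ c₂).split * Real.log ℓ / (1 / Real.log d)⌉₊ : ℝ)
      ≤ ⌈16 * Real.log d * Real.log (Real.log d)⌉₊ := by exact_mod_cast Nat.ceil_mono h3
  refine h4.trans ((Nat.ceil_lt_add_one (by positivity)).le.trans ?_)
  nlinarith

/-- A cluster with `m ≥ n α` points has rescaled parameter at most one. Hence `Y = 1 / (α Δ)` is at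
least `m Λ`, and the thresholds, whose number is governed by `log log Y`, suffice to push the tail
below `1 / Y ≤ 1 / m`. The trimming fraction satisfies `α Δ m ≤ 1 / Λ`, so no point is removed. -/
theorem tight (h : LargeDim c₁ c₂ d) {α : ℝ} (hα : 0 < α) (hnα : 1 ≤ n * α)
    {m : ℕ} (hm : (n : ℝ) * α ≤ m) :
    Tight (multifilterConsts c₁ c₂) (n / m * α) (1 / Real.log d)
      (1 / ((multifilterConsts c₁ c₂).lossDirs d * m)) m := by
  set Λ := (multifilterConsts c₁ c₂).lossDirs d with hΛ
  have hx := h.log_ge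
  have hm' : (1 : ℝ) ≤ m := hnα.trans hm
  have hn' : (0 : ℝ) < n := by
    by_contra hcon
    have : (n : ℝ) = 0 := le_antisymm (not_lt.1 hcon) (by positivity)
    rw [this] at hnα
    linarith
  have hΛ1 : 64000 ≤ Λ := by
    refine le_trans ?_ h.lossDirs_ge
    have : (10 : ℝ) ^ 3 ≤ Real.log d ^ 3 := pow_le_pow_left₀ (by norm_num) hx 3
    linarith
  have hΛ0 : 0 < Λ := by linarith
  have e : n / m * α * (1 / (Λ * m)) = n * α / (m ^ 2 * Λ) := by field_simp
  have e' : 1 / (n / m * α * (1 / (Λ * m))) = m ^ 2 * Λ / (n * α) := by field_simp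
  set Y := (m : ℝ) ^ 2 * Λ / (n * α) with hY
  have hYm : (m : ℝ) * Λ ≤ Y := by
    rw [hY, le_div_iff₀ (by positivity)]
    calc (m : ℝ) * Λ * (n * α) ≤ m * Λ * m := by gcongr
      _ = _ := by ring
  have hmY : (m : ℝ) ≤ Y := le_trans (by nlinarith) hYm
  have hΛY : Λ ≤ Y := le_trans (by nlinarith) hYm
  have hY0 : 0 < Y := by linarith
  have h4 : 4 ≤ Real.log Y := by
    rw [Real.le_log_iff_exp_le hY0]
    have h5 : Real.exp 4 = Real.exp 1 ^ 4 := by rw [← Real.exp_nat_mul]; norm_num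
    have h6 := Real.exp_one_lt_d9
    have h7 : Real.exp 1 ^ 4 ≤ 3 ^ 4 := pow_le_pow_left₀ (Real.exp_pos _).le (by linarith) 4
    rw [h5]
    linarith
  have hns : 8 * Real.log d * Real.log (Real.log Y) ≤
      numSplits (multifilterConsts c₁ c₂) (n / m * α) (1 / Real.log d) (1 / (Λ * m)) := by
    unfold numSplits
    refine le_trans (le_of_eq ?_) (Nat.le_ceil _)
    rw [e', show (multifilterConsts c₁ c₂).split = 8 from rfl, div_div_eq_mul_div, div_one]
    ring
  refine ⟨?_, ?_, ?_, ?_⟩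
  · rw [e]; positivity
  · rw [e]
    have : (n : ℝ) * α / (m ^ 2 * Λ) * m = n * α / (m * Λ) := by field_simp
    rw [this, div_lt_iff₀ (by positivity)]
    nlinarith
  · have h5 : 0 < Real.log (Real.log Y) := Real.log_pos (by linarith)
    have : (0 : ℝ) < numSplits (multifilterConsts c₁ c₂) (n / m * α) (1 / Real.log d) (1 / (Λ * m)) :=
      lt_of_lt_of_le (by positivity) hns
    exact_mod_cast this
  · have h5 := lt_log_two_mul_one_add_pow (by linarith) h4 hns
    calc (m : ℝ) ≤ Y := hmY
      _ = Real.exp (Real.log Y) := (Real.exp_log hY0).symm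
      _ < Real.exp (Real.log 2 * (1 + 1 / Real.log d) ^ ((numSplits (multifilterConsts c₁ c₂)
          (n / m * α) (1 / Real.log d) (1 / (Λ * m)) - 1) / 2)) := Real.exp_lt_exp.2 h5
      _ = _ := by rw [Real.rpow_def_of_pos (by norm_num)]

/-- Dividing `R` by `4 K` costs `log d * log log d` and leaves the factor `√(log log d)` of the
exponent `3 / 2`. This is the scale at which the Gaussian tail falls below a power of `log d`. -/
theorem radius_div_ge (h : LargeDim c₁ c₂ d) {K : ℕ} (hK1 : 1 ≤ K)
    (hK : (K : ℝ) ≤ 17 * Real.log d * Real.log (Real.log d)) :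
    2 / √c₁ * √(Real.log (Real.log d)) ≤ (multifilterConsts c₁ c₂).radius d / (4 * K) := by
  have hx := h.log_ge
  have hy := h.one_le_loglog
  have hK0 : (0 : ℝ) < K := by exact_mod_cast hK1
  rw [le_div_iff₀ (by positivity)]
  simp only [MultifilterConsts.radius, show (multifilterConsts c₁ c₂).rad = 136 / √c₁ from rfl]
  set x := Real.log d
  set y := Real.log x with hy'
  have e : y ^ (3 / 2 : ℝ) = y * √y := by
    rw [show (3 / 2 : ℝ) = 1 + 1 / 2 by norm_num, Real.rpow_add (by linarith), Real.rpow_one,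
      ← Real.sqrt_eq_rpow]
  rw [e]
  calc 2 / √c₁ * √y * (4 * K) ≤ 2 / √c₁ * √y * (4 * (17 * x * y)) := by gcongr
    _ = 136 / √c₁ * x * (y * √y) := by ring

end LargeDim

end Numerics
end

/-! ### Verification of the parameters in large dimension. -/

noncomputable section
open Matrix RAM

section Estimates

variable {c₁ c₂ : ℝ} {n d : ℕ}

/-- A number of bits that suffices for the indices of the data. -/
def indexBits (d : ℕ) : ℕ := ⌈8 * Real.log d⌉₊ + 1

/-- An upper bound for the parameter `k_max`. -/
def splitBound (d : ℕ) : ℝ := 17 * Real.log d * Real.log (Real.log d)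

/-- The cost of one splitting step. -/
def splitCost (d : ℕ) : ℝ := (2 * splitBound d + 1) * (12 * indexBits d + 25) + 32

/-- The decay rate of the trace of the powers of the covariance. -/
def traceDecay (c₂ : ℝ) : ℝ := 64 * Real.exp (84 / (c₂ / 1040) + 1)

theorem traceDecay_ge (hc₂ : 0 < c₂) : 128 ≤ traceDecay c₂ := by
  have h1 : 0 < 84 / (c₂ / 1040) := by positivity
  have h2 := Real.add_one_le_exp (84 / (c₂ / 1040) + 1)
  unfold traceDecay
  linarith

namespace LargeDim

theorem indexBits_le (h : LargeDim c₁ c₂ d) : (indexBits d : ℝ) ≤ 9 * Real.log d := by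
  have hx := h.log_ge
  have := Nat.ceil_lt_add_one (by positivity : 0 ≤ 8 * Real.log d)
  unfold indexBits
  push_cast
  linarith

theorem natCast_le_pow (hnd : (n : ℝ) ^ 2 ≤ d ^ 5) : (n : ℝ) ≤ d ^ 5 := by
  refine le_trans ?_ hnd
  exact_mod_cast Nat.le_self_pow two_ne_zero n

theorem lt_two_pow_indexBits (h : LargeDim c₁ c₂ d) (hnd : (n : ℝ) ^ 2 ≤ d ^ 5) :
    n < 2 ^ indexBits d := by
  have hx := h.log_ge
  have h1 : (n : ℝ) < 2 ^ indexBits d := by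
    refine (natCast_le_pow hnd).trans_lt ?_
    rw [← h.exp_mul_log 5, ← Real.rpow_natCast, Real.rpow_def_of_pos (by norm_num),
      Real.exp_lt_exp]
    have h2 : 8 * Real.log d ≤ indexBits d := by
      unfold indexBits
      push_cast
      linarith [Nat.le_ceil (8 * Real.log d)]
    have h3 := Real.log_two_gt_d9
    push_cast
    nlinarith
  exact_mod_cast h1

/-- The reason for `β = 1 / log d`: a polynomial in `d` to the power `β` is bounded by a constant.
-/
theorem rpow_inv_log_le (h : LargeDim c₁ c₂ d) (hnd : (n : ℝ) ^ 2 ≤ d ^ 5) :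
    (n : ℝ) ^ (1 / Real.log d) ≤ Real.exp 5 := by
  have hx := h.log_ge
  refine (Real.rpow_le_rpow (by positivity) (natCast_le_pow hnd) (by positivity)).trans ?_
  rw [← h.exp_mul_log 5, ← Real.exp_mul]
  refine Real.exp_le_exp.2 (le_of_eq ?_)
  push_cast
  field_simp

theorem bounds (h : LargeDim c₁ c₂ d) {α : ℝ} (hα : 0 < α) (hα1 : α ≤ 1) (hnα : 1 ≤ n * α)
    (hnd : (n : ℝ) ^ 2 ≤ d ^ 5) {m : ℕ} (hm : 1 ≤ m) (hmn : m ≤ n) :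
    Bounds (multifilterConsts c₁ c₂) m (indexBits d) (n / m * α) (1 / Real.log d)
      ((multifilterConsts c₁ c₂).lossDirs d) ((multifilterConsts c₁ c₂).radius d)
      (splitBound d) (splitCost d) where
  β_nonneg := by have := h.log_ge; positivity
  R_pos := by linarith [h.radius_ge]
  lt_two_pow := hmn.trans_lt (h.lt_two_pow_indexBits hnd)
  splits_le := h.numSplits_le hα hα1 hnα hnd hm hmn
  cost_le := le_rfl

theorem numBits_le (h : LargeDim c₁ c₂ d) : (numBits d : ℝ) ≤ 12 * Real.log d := by
  have hx := h.log_ge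
  have h2 := Real.log_two_gt_d9
  have h3 : 7 * Real.log d / Real.log 2 ≤ 11 * Real.log d := by
    rw [div_le_iff₀ (by linarith)]
    nlinarith
  have := Nat.ceil_lt_add_one (by positivity : 0 ≤ 7 * Real.log d / Real.log 2)
  unfold numBits
  linarith

theorem splitCost_le (h : LargeDim c₁ c₂ d) :
    splitCost d ≤ 3900 * Real.log d ^ 2 * Real.log (Real.log d) := by
  have hx := h.log_ge
  have hy := h.one_le_loglog
  have hκ := h.indexBits_le
  unfold splitCost splitBound
  set x := Real.log d
  set y := Real.log x
  have hxy : 10 ≤ x * y := by nlinarith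
  calc (2 * (17 * x * y) + 1) * (12 * indexBits d + 25) + 32
      ≤ (35 * (x * y)) * (111 * x) + 32 := by gcongr <;> linarith
    _ ≤ 3900 * x ^ 2 * y := by nlinarith

/-- There are `O(log² d)` layers with `O(log d)` directions each. A direction takes `O(log d)`
products with the covariance, at `O(d)` per point, which gives `d log⁴ d`. Splitting costs `O(log² d
log log d)` per unit of potential, from `O(log d log log d)` thresholds with binary searches of
`O(log d)` steps, which gives `log⁵ d log log d`. -/
theorem layersCost_le (h : LargeDim c₁ c₂ d) (hc₂ : 0 < c₂) :
    (multifilterConsts c₁ c₂).layersCost d (indexBits d) (splitCost d)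
      ≤ (1200000 * (c₂ / 1040) + 35)
        * (d * Real.log d ^ 4 + Real.log d ^ 5 * Real.log (Real.log d)) := by
  have hx := h.log_ge
  have hy := h.one_le_loglog
  have hκ := h.indexBits_le
  have hW := h.splitCost_le
  have hD := h.numLayers_le
  have hk := h.numDirs_le
  have hd : (1 : ℝ) ≤ d := by linarith [h.le_d]
  have hp : (⌈Real.log d⌉₊ : ℝ) ≤ 2 * Real.log d := by
    have := Nat.ceil_lt_add_one (by positivity : 0 ≤ Real.log d)
    linarith
  unfold MultifilterConsts.layersCost partCost lineCost
  set x := Real.log d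
  set y := Real.log x
  set k := (multifilterConsts c₁ c₂).numDirs d
  set D := (multifilterConsts c₁ c₂).numLayers d
  have hx2 : 10 * x ≤ x ^ 2 := by nlinarith
  have hx2y : x ^ 2 ≤ x ^ 2 * y := le_mul_of_one_le_right (by positivity) hy
  have h1 : 10 * (d : ℝ) + 4 * indexBits d + 2 * splitCost d + 12 ≤ 10 * d + 7900 * (x ^ 2 * y) := by
    nlinarith
  have h2 : (4 * d + 27 * ⌈x⌉₊ * d + (10 * (d : ℝ) + 4 * indexBits d + 2 * splitCost d + 12) + 3)
      ≤ 14 * d + 54 * (x * d) + 7903 * (x ^ 2 * y) := by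
    have : (⌈x⌉₊ : ℝ) * d ≤ 2 * x * d := by gcongr
    have : 1 ≤ x ^ 2 * y := by nlinarith
    nlinarith
  have h3 : 30 * d + k * (4 * d + 27 * ⌈x⌉₊ * d
      + (10 * (d : ℝ) + 4 * indexBits d + 2 * splitCost d + 12) + 3) + 9
      ≤ 5000 * (x ^ 2 * d) + 600000 * (x ^ 3 * y) := by
    have h4 : k * (4 * d + 27 * ⌈x⌉₊ * d
        + (10 * (d : ℝ) + 4 * indexBits d + 2 * splitCost d + 12) + 3)
        ≤ 65 * x * (14 * d + 54 * (x * d) + 7903 * (x ^ 2 * y)) :=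
      mul_le_mul hk h2 (by unfold splitCost splitBound; positivity) (by positivity)
    have h5 : 10 * (x * d) ≤ x ^ 2 * d := by nlinarith
    have h6 : 10 * d ≤ x * d := by nlinarith
    have h7 : 1 ≤ x ^ 2 * d := one_le_mul_of_one_le_of_one_le (one_le_pow₀ (by linarith)) hd
    have h8 : 0 ≤ x ^ 3 * y := by positivity
    nlinarith
  have h4 : (D : ℝ) * (30 * d + k * (4 * d + 27 * ⌈x⌉₊ * d
      + (10 * (d : ℝ) + 4 * indexBits d + 2 * splitCost d + 12) + 3) + 9)
      ≤ 2 * (c₂ / 1040) * x ^ 2 * (5000 * (x ^ 2 * d) + 600000 * (x ^ 3 * y)) :=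
    mul_le_mul hD h3 (by unfold splitCost splitBound; positivity) (by positivity)
  have h5 : (d : ℝ) ≤ d * x ^ 4 := le_mul_of_one_le_right (by positivity) (one_le_pow₀ (by linarith))
  have h6 : 0 ≤ x ^ 5 * y := by positivity
  have h7 : 0 ≤ c₂ / 1040 * (d * x ^ 4) := by positivity
  nlinarith

theorem totalCost_le (h : LargeDim c₁ c₂ d) (hc₂ : 0 < c₂) (hn : 1 ≤ n) :
    (multifilterConsts c₁ c₂).totalCost n d (indexBits d) (Real.exp 5) (splitCost d)
      ≤ (126 + Real.exp 5 * (1200000 * (c₂ / 1040) + 35) + 2 * Real.exp 5)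
        * (n * d * Real.log d ^ 4 + n * Real.log d ^ 5 * Real.log (Real.log d)) := by
  have hx := h.log_ge
  have hy := h.one_le_loglog
  have hκ := h.indexBits_le
  have hb := h.numBits_le
  have hU := h.layersCost_le hc₂
  have hd : (1 : ℝ) ≤ d := by linarith [h.le_d]
  have hn' : (1 : ℝ) ≤ n := by exact_mod_cast hn
  unfold MultifilterConsts.totalCost
  set x := Real.log d
  set y := Real.log x
  set U := (multifilterConsts c₁ c₂).layersCost d (indexBits d) (splitCost d)
  set Z := d * x ^ 4 + x ^ 5 * y with hZ
  have hE := Real.exp_pos 5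
  have h1 : x * d ≤ Z := by
    have h2 : x ≤ x ^ 4 := le_self_pow₀ (by linarith) (by norm_num)
    have h3 : 0 ≤ x ^ 5 * y := by positivity
    nlinarith
  have h2 : (d : ℝ) ≤ Z := le_trans (by nlinarith) h1
  have h3 : x ≤ Z := le_trans (by nlinarith) h1
  have h4 : 1 ≤ Z := hd.trans h2
  have h5 : (4 * numBits d + 2) * (d : ℝ) ≤ 50 * Z := by nlinarith
  have h6 : (4 * numBits d + 2) * (d : ℝ) + 5 * d + 13 ≤ n * (68 * Z) := by
    refine le_trans ?_ (le_mul_of_one_le_left (by positivity) hn')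
    linarith
  have h7 : Real.exp 5 * U ≤ Real.exp 5 * (1200000 * (c₂ / 1040) + 35) * Z := by
    rw [mul_assoc]
    exact mul_le_mul_of_nonneg_left hU hE.le
  have h8 : 2 * Real.exp 5 ≤ 2 * Real.exp 5 * Z := le_mul_of_one_le_right (by positivity) h4
  have h9 : (n : ℝ) * (5 * d + 4 * indexBits d + 5) + n * (Real.exp 5 * U + 2 * Real.exp 5 + 6)
      ≤ n * ((58 + Real.exp 5 * (1200000 * (c₂ / 1040) + 35) + 2 * Real.exp 5) * Z) := by
    rw [← mul_add]
    refine mul_le_mul_of_nonneg_left ?_ (by positivity)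
    linarith
  have e : (n : ℝ) * d * x ^ 4 + n * x ^ 5 * y = n * Z := by rw [hZ]; ring
  rw [e]
  linarith

theorem two_pow_numBits (h : LargeDim c₁ c₂ d) :
    (d : ℝ) ^ 7 ≤ 2 ^ numBits d ∧ (2 : ℝ) ^ numBits d ≤ 2 * d ^ 7 := by
  have hx := h.log_ge
  have h2 : 0 < Real.log 2 := Real.log_pos (by norm_num)
  have e : (2 : ℝ) ^ numBits d = Real.exp (Real.log 2 * numBits d) := by
    rw [← Real.rpow_natCast, Real.rpow_def_of_pos (by norm_num)]
  have h3 := Nat.le_ceil (7 * Real.log d / Real.log 2)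
  have h4 := Nat.ceil_lt_add_one (by positivity : 0 ≤ 7 * Real.log d / Real.log 2)
  have h5 : Real.log 2 * (7 * Real.log d / Real.log 2) = 7 * Real.log d := by field_simp
  rw [e, ← h.exp_mul_log 7]
  constructor
  · rw [Real.exp_le_exp]
    have := mul_le_mul_of_nonneg_left h3 h2.le
    rw [h5] at this
    exact_mod_cast this
  · have h6 : (2 : ℝ) * Real.exp ((7 : ℕ) * Real.log d)
        = Real.exp (Real.log 2 + (7 : ℕ) * Real.log d) := by
      rw [Real.exp_add, Real.exp_log (by norm_num)]
    rw [h6, Real.exp_le_exp]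
    have := mul_le_mul_of_nonneg_left h4.le h2.le
    rw [mul_add, h5] at this
    push_cast
    unfold numBits
    linarith

/-- With `ζ` the bound on coordinate differences in a cluster, `d ζ² ≤ d ^ 28`, and the exponent is
at most `3 log d`. The initial trace is therefore at most `d * exp (84 log² d)`, and `traceDecay` is
chosen so that the layers contribute `exp (-84 log² d)`. -/
theorem traceDecay_pow_mul_le (h : LargeDim c₁ c₂ d) (hc₂ : 0 < c₂) (hnd : (n : ℝ) ^ 2 ≤ d ^ 5) :
    (64 / traceDecay c₂) ^ (multifilterConsts c₁ c₂).numLayers d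
        * (d * (d * (4 * n * (n * d) * 2 ^ numBits d) ^ 2) ^ (2 * ⌈Real.log d⌉₊ + 1))
      ≤ d * (traceDecay c₂ * (multifilterConsts c₁ c₂).radius d ^ 2)
        ^ (2 * ⌈Real.log d⌉₊ + 1) := by
  have hx := h.log_ge
  have hB := traceDecay_ge hc₂
  have hd := h.d_pos
  have hR := h.radius_ge
  have hD := h.numLayers_ge
  have hp : (⌈Real.log d⌉₊ : ℝ) ≤ Real.log d + 1 :=
    (Nat.ceil_lt_add_one (by positivity)).le
  set q := 2 * ⌈Real.log d⌉₊ + 1 with hq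
  have hq' : (q : ℝ) ≤ 3 * Real.log d := by rw [hq]; push_cast; linarith
  have h1 : (64 / traceDecay c₂) ^ (multifilterConsts c₁ c₂).numLayers d
      ≤ Real.exp (-(84 * Real.log d ^ 2)) := by
    have e : 64 / traceDecay c₂ = Real.exp (-(84 / (c₂ / 1040) + 1)) := by
      rw [traceDecay, Real.exp_neg]; field_simp
    rw [e, ← Real.exp_nat_mul, Real.exp_le_exp]
    have h2 : 84 * Real.log d ^ 2 = 84 / (c₂ / 1040) * (c₂ / 1040 * Real.log d ^ 2) := by
      field_simp
    have h3 : 0 < 84 / (c₂ / 1040) := by positivity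
    have h4 := mul_le_mul_of_nonneg_left hD h3.le
    have h5 : (0 : ℝ) ≤ (multifilterConsts c₁ c₂).numLayers d := by positivity
    rw [h2]
    nlinarith
  have h2 : (d : ℝ) * (4 * n * (n * d) * 2 ^ numBits d) ^ 2 ≤ Real.exp (28 * Real.log d) := by
    have h3 : (4 : ℝ) * n * (n * d) * 2 ^ numBits d ≤ 8 * d ^ 13 := by
      calc (4 : ℝ) * n * (n * d) * 2 ^ numBits d = 4 * (n ^ 2 * d) * 2 ^ numBits d := by ring
        _ ≤ 4 * (d ^ 5 * d) * (2 * d ^ 7) := by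
          gcongr
          exact h.two_pow_numBits.2
        _ = 8 * d ^ 13 := by ring
    have e := h.exp_mul_log 28
    push_cast at e
    rw [e]
    calc (d : ℝ) * (4 * n * (n * d) * 2 ^ numBits d) ^ 2 ≤ d * (8 * d ^ 13) ^ 2 := by gcongr
      _ = 64 * (d : ℝ) ^ 27 := by ring
      _ ≤ d * (d : ℝ) ^ 27 := by gcongr; exact h.le_d
      _ = (d : ℝ) ^ 28 := by ring
  have h3 : ((d : ℝ) * (4 * n * (n * d) * 2 ^ numBits d) ^ 2) ^ q
      ≤ Real.exp (84 * Real.log d ^ 2) := by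
    refine (pow_le_pow_left₀ (by positivity) h2 q).trans ?_
    rw [← Real.exp_nat_mul, Real.exp_le_exp]
    nlinarith
  have h4 : (1 : ℝ) ≤ (traceDecay c₂ * (multifilterConsts c₁ c₂).radius d ^ 2) ^ q :=
    one_le_pow₀ (one_le_mul_of_one_le_of_one_le (by linarith) (one_le_pow₀ hR))
  calc _ ≤ Real.exp (-(84 * Real.log d ^ 2)) * (d * Real.exp (84 * Real.log d ^ 2)) := by
        have : 0 ≤ 64 / traceDecay c₂ := by positivity
        gcongr
    _ = d * 1 := by rw [mul_left_comm, ← Real.exp_add, neg_add_cancel, Real.exp_zero]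
    _ ≤ _ := by gcongr

theorem two_mul_le_exp_pow (h : LargeDim c₁ c₂ d) :
    2 * (d : ℝ) ≤ Real.exp 2 ^ (2 * ⌈Real.log d⌉₊ + 1) := by
  have hx := h.log_ge
  have h1 := Nat.le_ceil (Real.log d)
  have h2 : Real.exp (2 + Real.log d) = Real.exp 2 * d := by rw [Real.exp_add, h.exp_log]
  have h3 := Real.add_one_le_exp (2 : ℝ)
  refine le_trans (b := Real.exp (2 + Real.log d)) ?_ ?_
  · rw [h2]
    have := h.d_pos
    nlinarith
  · rw [← Real.exp_nat_mul, Real.exp_le_exp]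
    push_cast
    linarith

/-- At distance `(2 / √c₁) √(log log d)` the Gaussian term equals `(log d) ^ (-4)`, which is below
the other term `1 / (c₂ log³ d)`. The number of layers times directions is at most `2 * 65 * (c₂ /
1040) log³ d`, and `2 * 65 * 4 / 1040 = 1 / 2`. -/
theorem loss_le (h : LargeDim c₁ c₂ d) (hc₁ : 0 < c₁) (hc₂ : 0 < c₂) {s : ℝ} (hs : 0 ≤ s) :
    (multifilterConsts c₁ c₂).numLayers d * ((multifilterConsts c₁ c₂).numDirs d *
      (2 * s * (Real.exp (-(c₁ * (2 / √c₁ * √(Real.log (Real.log d))) ^ 2))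
        + 1 / (c₂ * Real.log d ^ 3)))) ≤ s / 2 := by
  have hx := h.log_ge
  have hy := h.one_le_loglog
  have hx0 : 0 < Real.log d := by linarith
  have e1 : c₁ * (2 / √c₁ * √(Real.log (Real.log d))) ^ 2 = 4 * Real.log (Real.log d) := by
    rw [mul_pow, div_pow, Real.sq_sqrt hc₁.le, Real.sq_sqrt (by linarith)]
    field_simp
    norm_num
  have e2 : Real.exp (-(4 * Real.log (Real.log d))) = 1 / Real.log d ^ 4 := by
    rw [Real.exp_neg, show (4 : ℝ) = (4 : ℕ) by norm_num, Real.exp_nat_mul, Real.exp_log hx0,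
      one_div]
  rw [e1, e2]
  have hD := h.numLayers_le
  have hk := h.numDirs_le
  have h1 : 1 / Real.log d ^ 4 ≤ 1 / (c₂ * Real.log d ^ 3) := by
    refine one_div_le_one_div_of_le (by positivity) ?_
    rw [pow_succ' _ 3]
    exact mul_le_mul_of_nonneg_right h.c₂_le (by positivity)
  calc _ ≤ (2 * (c₂ / 1040) * Real.log d ^ 2) * (65 * Real.log d *
        (2 * s * (1 / (c₂ * Real.log d ^ 3) + 1 / (c₂ * Real.log d ^ 3)))) := by gcongr
    _ = s / 2 := by field_simp; ring

/-- The clustering fails with probability at most `2 / d ^ 2` because `2 ^ b ≥ d ^ 7`. The layers,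
at most `d` in number, fail with total probability at most `1 / d ^ 2`. -/
theorem failure_le (h : LargeDim c₁ c₂ d) (hnd : (n : ℝ) ^ 2 ≤ d ^ 5) :
    (n : ℝ) ^ 2 * (2 / 2 ^ numBits d) + (multifilterConsts c₁ c₂).numLayers d *
      ((n : ℝ) ^ 2 * (7 / 8) ^ (multifilterConsts c₁ c₂).numDirs d) ≤ 1 / d := by
  have hx := h.log_ge
  have hd := h.d_pos
  have h1 : (n : ℝ) ^ 2 * (2 / 2 ^ numBits d) ≤ 2 / d ^ 2 := by
    calc (n : ℝ) ^ 2 * (2 / 2 ^ numBits d) ≤ (d : ℝ) ^ 5 * (2 / d ^ 7) := by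
          gcongr
          exact h.two_pow_numBits.1
      _ = 2 / (d : ℝ) ^ 2 := by field_simp
  have h2 : (7 / 8 : ℝ) ^ (multifilterConsts c₁ c₂).numDirs d ≤ 1 / d ^ 8 := by
    have h3 : (7 / 8 : ℝ) ≤ Real.exp (-(1 / 8)) := by
      have := Real.add_one_le_exp (-(1 / 8 : ℝ))
      linarith
    refine (pow_le_pow_left₀ (by norm_num) h3 _).trans ?_
    rw [← Real.exp_nat_mul, one_div ((d : ℝ) ^ 8), ← h.exp_mul_log 8, ← Real.exp_neg, Real.exp_le_exp]
    have := h.numDirs_ge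
    push_cast
    linarith
  have h3 : ((multifilterConsts c₁ c₂).numLayers d : ℝ) *
      ((n : ℝ) ^ 2 * (7 / 8) ^ (multifilterConsts c₁ c₂).numDirs d) ≤ 1 / d ^ 2 := by
    calc _ ≤ (d : ℝ) * (d ^ 5 * (1 / d ^ 8)) := by
          gcongr
          exact_mod_cast h.numLayers_le.trans h.sq_le
      _ = 1 / (d : ℝ) ^ 2 := by field_simp
  have h4 : 2 / (d : ℝ) ^ 2 + 1 / d ^ 2 ≤ 1 / d := by
    rw [← add_div, div_le_div_iff₀ (by positivity) hd]
    nlinarith [h.le_d]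
  linarith

end LargeDim

theorem eventually_mul_log_pow_le {C : ℝ} (k : ℕ) (hC : 0 < C) :
    ∀ᶠ d : ℕ in Filter.atTop, C * Real.log d ^ k ≤ d := by
  have h1 := (Real.isLittleO_pow_log_id_atTop (n := k)).bound (inv_pos.2 hC)
  filter_upwards [tendsto_natCast_atTop_atTop.eventually h1] with d hd
  simp only [id, Real.norm_eq_abs, Nat.abs_cast] at hd
  rw [← div_eq_inv_mul, le_div_iff₀ hC] at hd
  nlinarith [le_abs_self (Real.log d ^ k)]

theorem eventually_largeDim (c₁ c₂ : ℝ) (hc₁ : 0 < c₁) (hc₂ : 0 < c₂) :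
    ∀ᶠ d : ℕ in Filter.atTop, LargeDim c₁ c₂ d := by
  have hlog : Filter.Tendsto (fun d : ℕ => Real.log d) Filter.atTop Filter.atTop :=
    Real.tendsto_log_atTop.comp tendsto_natCast_atTop_atTop
  have hs : 0 < 136 / √c₁ := by have := Real.sqrt_pos.2 hc₁; positivity
  filter_upwards [hlog.eventually_ge_atTop 10, hlog.eventually_ge_atTop c₂,
    (hlog.const_mul_atTop (by positivity : 0 < c₂ / 1040)).eventually_ge_atTop 1,
    (hlog.const_mul_atTop hs).eventually_ge_atTop 1, eventually_mul_log_pow_le 3 (by norm_num : (0 : ℝ) < 65),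
    eventually_mul_log_pow_le 2 (by positivity : 0 < 2 * (c₂ / 1040))] with d h1 h2 h3 h4 h5 h6
  refine ⟨h1, h2, ?_, h4, h5, h6⟩
  nlinarith

end Estimates
end

/-! ### Assembly of the theorem. -/

open Matrix RAM

/-- The polylogarithmic upper bound on `α n` enters here: with `α ≥ 1 / d` it makes `n` polynomial
in `d`, which is what the potential, the union bounds and the word lengths rely on. -/
theorem sq_natCast_le_pow_five {n d p : ℕ} {α A : ℝ} (hd : (0 : ℝ) < d) (hα : 1 / (d : ℝ) ≤ α)
    (h : α * n ≤ A * d * Real.log d ^ p)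
    (hlog : A ^ 2 * Real.log d ^ (2 * p) ≤ d) : (n : ℝ) ^ 2 ≤ d ^ 5 := by
  have h1 : 1 / (d : ℝ) * n ≤ A * d * Real.log d ^ p :=
    (mul_le_mul_of_nonneg_right hα (by positivity)).trans h
  rw [one_div, inv_mul_le_iff₀ hd] at h1
  calc (n : ℝ) ^ 2 ≤ (d * (A * d * Real.log d ^ p)) ^ 2 := pow_le_pow_left₀ (by positivity) h1 2
    _ = (d : ℝ) ^ 4 * (A ^ 2 * Real.log d ^ (2 * p)) := by ring
    _ ≤ (d : ℝ) ^ 4 * d := by gcongr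
    _ = (d : ℝ) ^ 5 := by ring

theorem norm_toLp_sub_eq {d : ℕ} (m : Fin d → ℝ) (μ : EuclideanSpace ℝ (Fin d)) :
    ‖WithLp.toLp 2 m - μ‖ = √((m - fun j => μ j) ⬝ᵥ (m - fun j => μ j)) := by
  rw [EuclideanSpace.norm_eq]
  congr 1
  refine Finset.sum_congr rfl fun j _ => ?_
  rw [Real.norm_eq_abs, sq_abs, sq]
  rfl

theorem norm_sub_le_of_sq_le {c₁ c₂ : ℝ} {d : ℕ} (h : LargeDim c₁ c₂ d) {α G : ℝ}
    (hα : 0 < α) (hα1 : α ≤ 1) (hG : 0 ≤ G) {m : Fin d → ℝ} {μ : EuclideanSpace ℝ (Fin d)}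
    (hm : (m - fun j => μ j) ⬝ᵥ (m - fun j => μ j)
      ≤ 4 * (G * (multifilterConsts c₁ c₂).radius d ^ 2) / α + 4) :
    ‖WithLp.toLp 2 m - μ‖ ≤ √(4 * G + 4) * (136 / √c₁)
      * (Real.log d * Real.log (Real.log d) ^ (3 / 2 : ℝ) / √α) := by
  have hR := h.radius_ge
  set R := (multifilterConsts c₁ c₂).radius d with hRdef
  have hs := Real.sqrt_pos.2 hα
  -- Since `R ≥ 1` and `α ≤ 1`, the additive `4` is absorbed by `4 * (R ^ 2 / α)`.
  have h1 : 4 * (G * R ^ 2) / α + 4 ≤ (4 * G + 4) * (R / √α) ^ 2 := by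
    rw [div_pow, Real.sq_sqrt hα.le]
    have h2 : 1 ≤ R ^ 2 / α := by
      rw [le_div_iff₀ hα]
      nlinarith
    have e : 4 * (G * R ^ 2) / α = 4 * G * (R ^ 2 / α) := by ring
    rw [e]
    linarith
  rw [norm_toLp_sub_eq]
  calc √((m - fun j => μ j) ⬝ᵥ (m - fun j => μ j)) ≤ √((4 * G + 4) * (R / √α) ^ 2) :=
        Real.sqrt_le_sqrt (hm.trans h1)
    _ = √(4 * G + 4) * (R / √α) := by
        rw [Real.sqrt_mul (by positivity), Real.sqrt_sq (by positivity)]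
    _ = _ := by
        rw [hRdef, MultifilterConsts.radius, show (multifilterConsts c₁ c₂).rad = 136 / √c₁ from rfl]
        ring

theorem mainTheorem6 (c₁ c₂ a A : ℝ) (p : ℕ)
    (hc₁ : 0 < c₁) (hc₂ : 0 < c₂) (ha : 0 < a) (hA : 0 < A) :
    ∃ (c : MultifilterConsts) (K : ℝ) (d₀ : ℕ), c.Pos ∧ 0 < K ∧ 3 ≤ d₀ ∧
      ∀ (d n : ℕ) (α : ℝ) (X : Fin n → EuclideanSpace ℝ (Fin d)) (S : Finset (Fin n))
        (μ : EuclideanSpace ℝ (Fin d)),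
        d₀ ≤ d → 1 / (d : ℝ) ≤ α → α < 1 / 2 →
        (S.card : ℝ) = α * n →
        a * d ≤ α * n → α * n ≤ A * d * Real.log d ^ p →
        BoundedSecondMoment X S μ →
        GaussianTails c₁ c₂ X S μ →
        ((fastGaussianMultifilter c (fun i j => X i j) α).time : ℝ) ≤
            K * (n * d * Real.log d ^ 4 + n * Real.log d ^ 5 * Real.log (Real.log d)) ∧
          1 - ENNReal.ofReal (1 / (d : ℝ)) ≤
            (fastGaussianMultifilter c (fun i j => X i j) α).dist.toOuterMeasure
              {L : List (Fin d → ℝ) | (L.length : ℝ) ≤ K / α ∧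
                ∃ m ∈ L, ‖WithLp.toLp 2 m - μ‖ ≤
                  K * (Real.log d * Real.log (Real.log d) ^ (3 / 2 : ℝ) / Real.sqrt α)} := by
  have hlarge : ∀ᶠ d : ℕ in Filter.atTop,
      LargeDim c₁ c₂ d ∧ A ^ 2 * Real.log d ^ (2 * p) ≤ d ∧ 1 ≤ a * d := by
    refine (eventually_largeDim c₁ c₂ hc₁ hc₂).and
      ((eventually_mul_log_pow_le (2 * p) (by positivity)).and ?_)
    exact (tendsto_natCast_atTop_atTop.const_mul_atTop ha).eventually_ge_atTop 1
  obtain ⟨d₀, hd₀⟩ := Filter.eventually_atTop.1 hlarge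
  set Kt := 126 + Real.exp 5 * (1200000 * (c₂ / 1040) + 35) + 2 * Real.exp 5 with hKt
  set G := Real.exp 2 * traceDecay c₂ with hG
  set Ke := √(4 * G + 4) * (136 / √c₁) with hKe
  have hc₁' := Real.sqrt_pos.2 hc₁
  have hB := traceDecay_ge hc₂
  have hG0 : 0 ≤ G := by positivity
  have hKt0 : 2 * Real.exp 5 ≤ Kt := by
    have : 0 < Real.exp 5 * (1200000 * (c₂ / 1040) + 35) := by positivity
    linarith
  have hKt1 : 0 < Kt := lt_of_lt_of_le (by positivity) hKt0
  have hKe0 : 0 ≤ Ke := by positivity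
  refine ⟨multifilterConsts c₁ c₂, Kt + Ke, max d₀ 3, ?_, by linarith, le_max_right _ _, ?_⟩
  · refine ⟨?_, ?_, ?_, ?_, ?_⟩ <;> simp only [multifilterConsts] <;> positivity
  intro d n α X S μ hd hαd hα2 hSα hlo hhi hcov htail
  obtain ⟨h, hlog, had⟩ := hd₀ d ((le_max_left _ _).trans hd)
  have hd0 := h.d_pos
  have hx := h.log_ge
  have hy := h.one_le_loglog
  have hα : 0 < α := lt_of_lt_of_le (by positivity) hαd
  have hα1 : α ≤ 1 := by linarith
  have hnα : 1 ≤ n * α := by linarith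
  have hnd := sq_natCast_le_pow_five hd0 hαd hhi hlog
  have hd1 : 1 ≤ d := by exact_mod_cast hd0
  have hn : 1 ≤ n := by
    rcases n.eq_zero_or_pos with rfl | hn
    · simp only [Nat.cast_zero, zero_mul] at hnα; linarith
    · exact hn
  have hS0 : 0 < S.card := by
    have : (0 : ℝ) < S.card := by rw [hSα]; linarith
    exact_mod_cast this
  have hb := fun (m : ℕ) (hm : 1 ≤ m) (hmn : m ≤ n) => h.bounds hα hα1 hnα hnd hm hmn
  have hκ := (h.lt_two_pow_indexBits hnd).le
  have hsat := Sat.fastGaussianMultifilter (X := fun i j => X i j) hd1 hn hα hnα hκ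
    (hb 1 le_rfl hn).W_nonneg (h.rpow_inv_log_le hnd) (by positivity) hb h.one_le_numLayers
  have hwhp := whp_fastGaussianMultifilter (μ := fun j => μ j)
    (ρ := 2 / √c₁ * √(Real.log (Real.log d))) hd1 hn hκ hα hS0 hSα hb (fun m hSm hmn => by
      have hm1 : 1 ≤ m := hS0.trans_le hSm
      have hm : (n : ℝ) * α ≤ m := by
        rw [mul_comm, ← hSα]
        -- The cluster containing `S` has `m ≥ |S| = n α` points, exactly the range in which `tight`
        -- applies.
        exact_mod_cast hSm
      have ht := h.tight hα hnα hm
      exact ⟨ht, h.radius_div_ge ht.pos (h.numSplits_le hα hα1 hnα hnd hm1 hmn)⟩)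
    (htail.concentrated hS0 (by positivity) (by positivity)) (by positivity) hB
    (h.loss_le hc₁ hc₂ (by positivity)) (h.traceDecay_pow_mul_le hc₂ hnd) h.two_mul_le_exp_pow
    (hcov.sum_sq_le hS0)
  constructor
  · refine hsat.1.trans ((h.totalCost_le hc₂ hn).trans ?_)
    refine mul_le_mul_of_nonneg_right (by linarith) (by positivity)
  · refine ((hwhp.and_all hsat.2).mono (h.failure_le hnd) ?_).le_toOuterMeasure
    rintro L ⟨⟨m, hm, hmb⟩, hL⟩
    refine ⟨hL.trans ?_, m, hm, ?_⟩
    · exact div_le_div_of_nonneg_right (by linarith) hα.le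
    · rw [← mul_assoc (Real.exp 2)] at hmb
      refine (norm_sub_le_of_sq_le h hα hα1 hG0 hmb).trans ?_
      refine mul_le_mul_of_nonneg_right (by linarith) (by positivity)
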